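/- Let $g>0$ and let $M_n$ be the $n\times n$ GUE matrix, i.e. the Hermitian random matrix with law $\mathbf P_n(dM)=Z_n^{-1}\exp\{-\tfrac{n}{2g}\mathrm{Tr}\,M^2\}\,\prod_j dM_{jj}\prod_{j<k}d\Re M_{jk}\,d\Im M_{jk}$, where $Z_n$ is the normalizing constant. Let $\mathcal N_n(\Delta)$ be the number of eigenvalues of $M_n$ (with multiplicity) in $\Delta\subset\mathbb R$, and put $\sigma=[-2\sqrt g,2\sqrt g]$ and $$k(\lambda,\mu)=\frac{4g-\lambda\mu}{(\lambda-\mu)^2\sqrt{4g-\lambda^2}\,\sqrt{4g-\mu^2}} .$$ If $\Delta=(a,b)$ with $-2\sqrt g<a<b<2\sqrt g$, then as $n\to\infty$ $$\mathbf{Var}\{\mathcal N_n(\Delta)\}=\frac1{\pi^2}\log n\,(1+o(1)).$$ Let $\Delta_1=(a_1,b_1)$ and $\Delta_2=(a_2,b_2)$ be nonempty open intervals contained in $(-2\sqrt g,2\sqrt g)$ (in (i), (ii), (iv) and (v) endpoints $\pm2\sqrt g$ are allowed, in (iii) the common left endpoint is larger than $-2\sqrt g$). Then the covariance $C_n=\mathbf{Cov}\{\mathcal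 N_n(\Delta_1),\mathcal N_n(\Delta_2)\}$ satisfies, as $n\to\infty$: (i) disjoint intervals ($b_1<a_2$): $\displaystyle C_n\to-\frac1{2\pi^2}\int_{\Delta_1}d\lambda\int_{\Delta_2}k(\lambda,\mu)\,d\mu$; (ii) intervals touching from outside ($a_2=b_1$): $\displaystyle C_n=-\frac1{2\pi^2}\log n\,(1+o(1))$; (iii) intervals touching from inside ($a_1=a_2$, $b_1<b_2$): $\displaystyle C_n=\frac1{2\pi^2}\log n\,(1+o(1))$; (iv) embedded intervals ($a_2<a_1$, $b_1<b_2$): $\displaystyle C_n\to\frac1{2\pi^2}\int_{\Delta_1}d\lambda\int_{\sigma\setminus\Delta_2}k(\lambda,\mu)\,d\mu$; (v) intersecting intervals ($a_1<a_2<b_1<b_2$): $\displaystyle C_n\to\frac1{2\pi^2}\left[\int_{a_2}^{b_1}d\lambda\int_{\sigma\setminus(a_1,b_2)}k(\lambda,\mu)\,d\mu-\int_{a_1}^{a_2}d\lambda\int_{b_1}^{b_2}k(\lambda,\mu)\,d\mu\right]$. All these integrals converge absolutely; in particular $C_n=O(1)$ in cases (i), (iv), (v). -/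

import Mathlib

open MeasureTheory ProbabilityTheory Filter Topology Asymptotics

namespace GUE

noncomputable section

/-- The free real coordinates of an `n × n` Hermitian matrix: the diagonal entries `M j j`, and
for `j < k` the pair `(Re M j k, Im M j k)`. Its `volume` is the product Lebesgue measure
`∏ dM_{jj} ∏_{j<k} dRe M_{jk} dIm M_{jk}`. -/
abbrev Coord (n : ℕ) : Type :=
  (Fin n → ℝ) × ({p : Fin n × Fin n // p.1 < p.2} → ℝ × ℝ)

/-- The Hermitian matrix with given coordinates. -/
def toMatrix {n : ℕ} (x : Coord n) : Matrix (Fin n) (Fin n) ℂ :=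
  Matrix.of fun j k =>
    if h : j < k then ⟨(x.2 ⟨(j, k), h⟩).1, (x.2 ⟨(j, k), h⟩).2⟩
    else if h : k < j then ⟨(x.2 ⟨(k, j), h⟩).1, -(x.2 ⟨(k, j), h⟩).2⟩
    else (x.1 j : ℂ)

theorem toMatrix_isHermitian {n : ℕ} (x : Coord n) : (toMatrix x).IsHermitian := by
  ext j k
  rcases lt_trichotomy j k with h | h | h
  · simp [toMatrix, h, h.not_gt, Complex.ext_iff]
  · subst h
    simp [toMatrix]
  · simp [toMatrix, h, h.not_gt, Complex.ext_iff]

/-- The unnormalized density `exp (-n Tr V(M))` for the potential `V(t) = t² / (2g)`. -/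
def weight (g : ℝ) (n : ℕ) (x : Coord n) : ℝ :=
  Real.exp (-((n : ℝ) * ((toMatrix x ^ 2).trace.re / (2 * g))))

/-- The Gaussian Unitary Ensemble, as a law on the coordinates of a Hermitian matrix:
`P_n(dM) = Z_n⁻¹ exp (-n Tr V(M)) dM`, with `Z_n` the total mass of `exp (-n Tr V(M)) dM`. -/
def law (g : ℝ) (n : ℕ) : Measure (Coord n) :=
  (∫⁻ x : Coord n, ENNReal.ofReal (weight g n x))⁻¹ •
    (volume : Measure (Coord n)).withDensity (fun x => ENNReal.ofReal (weight g n x))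

open Classical in
/-- The eigenvalue counting measure: the number of eigenvalues, with multiplicity, of the
random matrix in the set `Δ`. -/
def count (n : ℕ) (Δ : Set ℝ) (x : Coord n) : ℝ :=
  ((Finset.univ.filter fun i => (toMatrix_isHermitian x).eigenvalues i ∈ Δ).card : ℝ)

/-- The limiting spectrum `σ = [-2√g, 2√g]`. -/
def spectralSupport (g : ℝ) : Set ℝ := Set.Icc (-(2 * √g)) (2 * √g)

/-- The kernel `(4g - λμ) / ((λ - μ)² √(4g - λ²) √(4g - μ²))`. -/
def covKernel (g s t : ℝ) : ℝ :=
  (4 * g - s * t) / ((s - t) ^ 2 * √(4 * g - s ^ 2) * √(4 * g - t ^ 2))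

end

end GUE

/-!
The proof computes the covariance of two eigenvalue counts exactly, as a mass of the squared
Christoffel–Darboux kernel `K_n`, and then finds the asymptotics of that mass.

**The covariance formula.** Gaussian integration by parts, applied to the vector field `M ↦ M ^ p`,
gives the loop equations for the moments of the traces `Tr M ^ k` (`loopEquations_matrix`). The same
equations hold for the power sums under the density `Δ(l) ^ 2 exp (-n / (2 g) ∑ l_i ^ 2)`
(`loopEquations_vandermonde`), and since they determine the moments (`LoopEquations.unique`), the
mixed second moments of power sums of eigenvalues agree with those of this density
(`integral_law_powerSum_mul`). This replaces Weyl's integration formula: the measure `E ∑_{i, j}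
δ_{(λ_i, λ_j)}` has exponential moments and is thus determined by its mixed moments
(`ext_of_moments`), so second moments of counting functions may be computed from the density
(`integral_count_mul_eq_of_moments`). The density is the square of a Slater determinant of the
orthonormal Hermite functions `φ_k`, and the usual expansion (`integral_slater_sq_sum_mul_sum`)
yields

  `Cov (N(A), N(B)) = ∫∫_{(A ∩ B) × ℝ} K_n ^ 2 - ∫∫_{A × B} K_n ^ 2`    (`covariance_count`).

By additivity of the mass `pairMass` of `K_n ^ 2`, the covariance for two intervals is a combination
of masses of products `A × B` with `A` on the left of `B` (`covariance_count_of_subset`,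
`covariance_count_of_disjoint`, `covariance_count_of_overlap`). Such masses converge if `A` and `B`
are separated, and grow like a logarithm if they touch.

**Separated sets.** The Christoffel–Darboux formula writes `K_n ^ 2` as `(x - y)⁻²` times a sum of
products of functions of `x` and functions of `y` of the form `φ_j φ_k`, where `j` and `k` are `n`
or `n - 1`. Since `s⁻² = ∫₀^∞ t e^{-t s} dt`, its mass is an integral over `t` of products of
one-dimensional integrals (`setIntegral_div_sub_sq`). These converge: by the three-term recurrence
the moments of `φ_j φ_k` tend to those of `cos ((j - k) θ) dθ / π` under `x = 2 √g cos θ`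
(`tendsto_moment`), and the convergence extends to functions with finitely many discontinuities
(`tendsto_piecewise_continuous`). In terms of the arcsine density `ρ` the limits are `ρ` and `x ρ /
(2 √g)`, which gives the kernel `covKernel` (`tendsto_pairMass_separated`).

**Touching sets.** Let the sets touch at a point `a` of the bulk. As `K_n(y, y) = O(n)` near `a`,
the strip of the points `y ∈ B` at distance less than `1 / n` from `a` contributes `O(1)`
(`exists_pairMass_strip_le`). On the rest the integral over `t` is available, with the extra factor
`e^{-t / n}`. The function `φ = φ_n` solves `φ'' = -n² q φ`, and its energy `(φ' / n)² + q φ²`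
varies slowly; hence `φ²`, `φ φ' / n` and `(φ' / n)²` are slowly varying up to `1 / n` times
derivatives of bounded functions (`OscillatesAround`), and the integrals of the products `φ_j φ_k`
over intervals of length `s` ending near `a` are `κ_n s + O(s² + 1 / n)`. Weak convergence
identifies `lim κ_n`, and the Laplace transforms are `κ_n / t + O(t⁻² + 1 / n)`. The mass is
therefore a convergent factor times `∫_1^∞ e^{-t / n} dt / t ∼ log n`, up to `O(1)`
(`tendsto_laplace_div_log`). The limit of the factor is `g (2 ρ(a)² - 2 (a ρ(a) / (2 √g))²) = 1 / (2
π²)`, which does not depend on `a` (`tendsto_pairMass_touching`). The variance of one interval comes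
from both of its endpoints, and so has the constant `1 / π²`.
-/

namespace GUE

/-! ### Functions of subgaussian growth and integration by parts -/

/-- `f` grows slower than every Gaussian `exp (δ T)`, `δ > 0`, of the quadratic form `T`. Such
functions form an algebra, and all of them are integrable against `exp (-α T)` for `α > 0`. -/
def Tame {V E : Type*} [Norm E] (T : V → ℝ) (f : V → E) : Prop :=
  ∀ δ : ℝ, 0 < δ → ∃ C : ℝ, ∀ x, ‖f x‖ ≤ C * Real.exp (δ * T x)

section Tame

variable {V E : Type*} {T : V → ℝ}

theorem Tame.mul [NormedRing E] {f h : V → E} (hf : Tame T f) (hh : Tame T h) :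
    Tame T (fun x => f x * h x) := by
  intro δ hδ
  obtain ⟨C, hC⟩ := hf (δ / 2) (by positivity)
  obtain ⟨D, hD⟩ := hh (δ / 2) (by positivity)
  refine ⟨C * D, fun x => ?_⟩
  calc ‖f x * h x‖ ≤ ‖f x‖ * ‖h x‖ := norm_mul_le _ _
    _ ≤ (C * Real.exp (δ / 2 * T x)) * (D * Real.exp (δ / 2 * T x)) :=
        mul_le_mul (hC x) (hD x) (norm_nonneg _) ((norm_nonneg _).trans (hC x))
    _ = C * D * Real.exp (δ * T x) := by
        rw [mul_mul_mul_comm, ← Real.exp_add]; ring_nf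

theorem Tame.add [NormedRing E] {f h : V → E} (hf : Tame T f) (hh : Tame T h) :
    Tame T (fun x => f x + h x) := by
  intro δ hδ
  obtain ⟨C, hC⟩ := hf δ hδ
  obtain ⟨D, hD⟩ := hh δ hδ
  exact ⟨C + D, fun x => (norm_add_le _ _).trans (by rw [add_mul]; exact add_le_add (hC x) (hD x))⟩

theorem Tame.const [NormedRing E] (hT : ∀ x, 0 ≤ T x) (c : E) : Tame T (fun _ => c) := by
  intro δ hδ
  refine ⟨‖c‖, fun x => le_mul_of_one_le_right (norm_nonneg _) ?_⟩
  exact Real.one_le_exp (mul_nonneg hδ.le (hT x))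

theorem Tame.mono [Norm E] {F : Type*} [Norm F] {f : V → E} {h : V → F} (hh : Tame T h)
    (hfh : ∀ x, ‖f x‖ ≤ ‖h x‖) : Tame T f := by
  intro δ hδ
  obtain ⟨C, hC⟩ := hh δ hδ
  exact ⟨C, fun x => (hfh x).trans (hC x)⟩

/-- Functions of exponential type in `√T` are tame. -/
theorem tame_exp_of_sq_le {u : V → ℝ} (hu : ∀ x, u x ^ 2 ≤ T x) (c : ℝ) :
    Tame T (fun x => Real.exp (c * |u x|)) := by
  intro δ hδ
  refine ⟨Real.exp (c ^ 2 / (4 * δ)), fun x => ?_⟩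
  rw [Real.norm_of_nonneg (Real.exp_pos _).le, ← Real.exp_add]
  apply Real.exp_le_exp.2
  have h1 : δ * u x ^ 2 ≤ δ * T x := mul_le_mul_of_nonneg_left (hu x) hδ.le
  have h2 : c ^ 2 / (4 * δ) + δ * |u x| ^ 2 - c * |u x| = (c - 2 * δ * |u x|) ^ 2 / (4 * δ) := by
    field_simp; ring
  have h3 : 0 ≤ (c - 2 * δ * |u x|) ^ 2 / (4 * δ) := by positivity
  rw [sq_abs] at h2
  linarith

/-- Functions of linear growth in `√T` are tame. -/
theorem tame_of_sq_le [NormedRing E] {u : V → E} (hu : ∀ x, ‖u x‖ ^ 2 ≤ T x) :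
    Tame T u := by
  refine (tame_exp_of_sq_le (u := fun x => ‖u x‖) hu 1).mono fun x => ?_
  rw [Real.norm_of_nonneg (Real.exp_pos _).le, one_mul, abs_of_nonneg (norm_nonneg _)]
  linarith [Real.add_one_le_exp ‖u x‖]

theorem tame_eval {σ : Type*} (hT : ∀ x, 0 ≤ T x) (e : V → σ → ℂ)
    (he : ∀ x s, ‖e x s‖ ^ 2 ≤ T x) (P : MvPolynomial σ ℂ) :
    Tame T (fun x => MvPolynomial.eval (e x) P) := by
  induction P using MvPolynomial.induction_on with
  | C a => simpa using Tame.const hT a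
  | add p q hp hq => simpa using hp.add hq
  | mul_X p s hp =>
    simpa using hp.mul (tame_of_sq_le (u := fun x => e x s) fun x => he x s)

end Tame

/-- The derivative of a polynomial function along a line. -/
theorem hasLineDerivAt_eval {V : Type*} [NormedAddCommGroup V] [NormedSpace ℝ V] {σ : Type*}
    [Fintype σ] (e : V →ₗ[ℝ] (σ → ℂ)) (P : MvPolynomial σ ℂ) (x v : V) :
    HasLineDerivAt ℝ (fun x => MvPolynomial.eval (e x) P)
      (∑ s, e v s * MvPolynomial.eval (e x) (MvPolynomial.pderiv s P)) x v := by
  classical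
  unfold HasLineDerivAt
  induction P using MvPolynomial.induction_on with
  | C a => simpa using hasDerivAt_const (0 : ℝ) a
  | add p q hp hq =>
    simp only [map_add, mul_add, Finset.sum_add_distrib]
    simp only [map_add] at hp hq
    exact hp.add hq
  | mul_X p s hp =>
    have h1 : HasDerivAt (fun t : ℝ => e (x + t • v) s) (e v s) 0 := by
      have : (fun t : ℝ => e (x + t • v) s) = fun t : ℝ => e x s + (t : ℂ) * e v s := by
        ext t; simp
      rw [this]
      simpa using
        ((Complex.ofRealCLM.hasDerivAt (x := (0 : ℝ))).mul_const (e v s)).const_add (e x s)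
    have h2 := hp.mul h1
    simp only [map_mul, MvPolynomial.eval_X]
    refine h2.congr_deriv ?_
    simp only [zero_smul, add_zero, Derivation.leibniz, MvPolynomial.pderiv_X, smul_eq_mul,
      map_add, map_mul, MvPolynomial.eval_X, mul_add, Finset.sum_add_distrib]
    rw [add_comm, Finset.sum_mul]
    congr 1
    · rw [Finset.sum_eq_single s]
      · simp; ring
      · intro b _ hb
        simp [hb.symm]
      · simp
    · exact Finset.sum_congr rfl fun i _ => by ring

section Gaussian

variable {V : Type*} [NormedAddCommGroup V] [NormedSpace ℝ V] [FiniteDimensional ℝ V]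
  [MeasurableSpace V] [BorelSpace V] {μ : Measure V} [μ.IsAddHaarMeasure]
  {T : V → ℝ}

/-- Tame functions are integrable against Gaussians. -/
theorem Tame.integrable {𝕜 : Type*} [RCLike 𝕜] (hTc : Continuous T) (hT : ∀ x, ‖x‖ ^ 2 ≤ T x)
    {f : V → 𝕜} (hf : Tame T f) (hfm : AEStronglyMeasurable f μ) {α : ℝ} (hα : 0 < α) :
    Integrable (fun x => f x * (Real.exp (-(α * T x)) : 𝕜)) μ := by
  obtain ⟨C, hC⟩ := hf (α / 2) (by positivity)
  set r : ℝ := Module.finrank ℝ V + 1 with hr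
  have h1 : Integrable (fun x : V => ((1 : ℝ) + ‖x‖ ^ 2) ^ (-r / 2)) μ :=
    integrable_rpow_neg_one_add_norm_sq (by rw [hr]; linarith)
  -- the Gaussian factor beats the power `(1 + t) ^ (r / 2)`
  obtain ⟨m, hm⟩ := exists_nat_ge (r / 2)
  obtain ⟨B, hB⟩ : ∃ B : ℝ, ∀ t : ℝ, 0 ≤ t → (1 + t) ^ m * Real.exp (-(α / 2 * t)) ≤ B := by
    have hlim : Tendsto (fun t : ℝ => (1 + t) ^ m * Real.exp (-(α / 2) * (1 + t))) atTop (𝓝 0) := by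
      have h := tendsto_rpow_mul_exp_neg_mul_atTop_nhds_zero m (α / 2) (by positivity)
      have := h.comp (tendsto_atTop_add_const_left atTop (1 : ℝ) tendsto_id)
      simpa [Function.comp_def] using this
    have hcont : Continuous (fun t : ℝ => (1 + t) ^ m * Real.exp (-(α / 2) * (1 + t))) := by
      fun_prop
    obtain ⟨R, hR⟩ := (hlim.eventually (ge_mem_nhds one_pos)).exists_forall_of_atTop
    obtain ⟨B, hB⟩ := (isCompact_Icc (a := (0 : ℝ)) (b := R)).bddAbove_image hcont.continuousOn
    refine ⟨max 1 B * Real.exp (α / 2), fun t ht => ?_⟩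
    have key : (1 + t) ^ m * Real.exp (-(α / 2) * (1 + t)) ≤ max 1 B := by
      rcases le_total R t with h | h
      · exact (hR t h).trans (le_max_left _ _)
      · exact (hB ⟨t, ⟨ht, h⟩, rfl⟩).trans (le_max_right _ _)
    calc (1 + t) ^ m * Real.exp (-(α / 2 * t))
        = ((1 + t) ^ m * Real.exp (-(α / 2) * (1 + t))) * Real.exp (α / 2) := by
          rw [mul_assoc, ← Real.exp_add]; ring_nf
      _ ≤ _ := by gcongr
  have hC0 : 0 ≤ C := by
    have := (norm_nonneg _).trans (hC 0)
    exact nonneg_of_mul_nonneg_left this (Real.exp_pos _)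
  refine (h1.const_mul (C * B)).mono' (hfm.mul ?_) (ae_of_all _ fun x => ?_)
  · exact (RCLike.continuous_ofReal.comp (by fun_prop :
      Continuous fun x => Real.exp (-(α * T x)))).aestronglyMeasurable
  have hTx : 0 ≤ T x := (sq_nonneg _).trans (hT x)
  rw [norm_mul, RCLike.norm_ofReal, abs_of_pos (Real.exp_pos _)]
  have h2 : (1 + ‖x‖ ^ 2) ^ (r / 2) ≤ (1 + T x) ^ m := by
    calc (1 + ‖x‖ ^ 2) ^ (r / 2) ≤ (1 + T x) ^ (r / 2) := by
          apply Real.rpow_le_rpow (by positivity) (by linarith [hT x]) (by positivity)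
      _ ≤ (1 + T x) ^ (m : ℝ) := Real.rpow_le_rpow_of_exponent_le (by linarith) hm
      _ = _ := Real.rpow_natCast _ _
  have h3 : Real.exp (-(α / 2 * T x)) ≤ B * (1 + ‖x‖ ^ 2) ^ (-r / 2) := by
    rw [neg_div, Real.rpow_neg (by positivity), ← div_eq_mul_inv, le_div_iff₀ (by positivity)]
    calc _ ≤ Real.exp (-(α / 2 * T x)) * (1 + T x) ^ m := by gcongr
      _ ≤ B := by rw [mul_comm]; exact hB _ hTx
  calc ‖f x‖ * Real.exp (-(α * T x)) ≤ C * Real.exp (α / 2 * T x) * Real.exp (-(α * T x)) := by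
        gcongr; exact hC x
    _ = C * Real.exp (-(α / 2 * T x)) := by rw [mul_assoc, ← Real.exp_add]; ring_nf
    _ ≤ C * (B * (1 + ‖x‖ ^ 2) ^ (-r / 2)) := by gcongr
    _ = _ := by ring

/-- Gaussian integration by parts for polynomial functions: the integral of the derivative of
`P exp (-α T)` in the direction `v` vanishes. The quadratic form `T` is itself given by a polynomial
`Q` in the coordinates `e`. -/
theorem stein_eval {σ : Type*} [Fintype σ] (e : V →ₗ[ℝ] (σ → ℂ)) (hTc : Continuous T)
    (hT : ∀ x, ‖x‖ ^ 2 ≤ T x) (he : ∀ x s, ‖e x s‖ ^ 2 ≤ T x) (Q : MvPolynomial σ ℂ)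
    (hTQ : ∀ x, (T x : ℂ) = MvPolynomial.eval (e x) Q) (P : MvPolynomial σ ℂ) (v : V)
    {α : ℝ} (hα : 0 < α) :
    ∫ x, (∑ s, e v s * MvPolynomial.eval (e x) (MvPolynomial.pderiv s P)) *
        (Real.exp (-(α * T x)) : ℂ) ∂μ =
      α * ∫ x, (∑ s, e v s * MvPolynomial.eval (e x) (MvPolynomial.pderiv s Q)) *
        MvPolynomial.eval (e x) P * (Real.exp (-(α * T x)) : ℂ) ∂μ := by
  have hT0 : ∀ x, 0 ≤ T x := fun x => (sq_nonneg _).trans (hT x)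
  have hec : Continuous e := e.continuous_of_finiteDimensional
  have hsum : ∀ R : MvPolynomial σ ℂ, ∃ S : MvPolynomial σ ℂ, ∀ x,
      (∑ s, e v s * MvPolynomial.eval (e x) (MvPolynomial.pderiv s R)) =
        MvPolynomial.eval (e x) S := fun R =>
    ⟨∑ s, MvPolynomial.C (e v s) * MvPolynomial.pderiv s R, fun x => by simp⟩
  have hint : ∀ R : MvPolynomial σ ℂ, Integrable (fun x => MvPolynomial.eval (e x) R *
      (Real.exp (-(α * T x)) : ℂ)) μ := fun R =>
    (tame_eval hT0 e he R).integrable (𝕜 := ℂ) hTc hT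
      ((MvPolynomial.continuous_eval R).comp hec).aestronglyMeasurable hα
  have hw : ∀ x, HasLineDerivAt ℝ (fun x => (Real.exp (-(α * T x)) : ℂ))
      (-(α * (∑ s, e v s * MvPolynomial.eval (e x) (MvPolynomial.pderiv s Q)) *
        (Real.exp (-(α * T x)) : ℂ))) x v := by
    intro x
    have h := hasLineDerivAt_eval e Q x v
    unfold HasLineDerivAt at h ⊢
    have h1 := ((h.const_mul (α : ℂ)).fun_neg).cexp
    have h2 : (fun t : ℝ => (Real.exp (-(α * T (x + t • v))) : ℂ)) =
        fun t : ℝ => Complex.exp (-(α * MvPolynomial.eval (e (x + t • v)) Q)) := by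
      ext t; rw [← hTQ]; push_cast; rfl
    rw [h2]
    refine h1.congr_deriv ?_
    simp only [zero_smul, add_zero, ← hTQ]
    push_cast; ring
  obtain ⟨S, hS⟩ := hsum P
  obtain ⟨U, hU⟩ := hsum Q
  have key := integral_bilinear_hasLineDerivAt_right_eq_neg_left_of_integrable
    (μ := μ) (B := ContinuousLinearMap.mul ℝ ℂ) (v := v)
    (f := fun x => (Real.exp (-(α * T x)) : ℂ))
    (g := fun x => MvPolynomial.eval (e x) P)
    (f' := fun x => (-(α * (∑ s, e v s * MvPolynomial.eval (e x) (MvPolynomial.pderiv s Q)) *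
        (Real.exp (-(α * T x)) : ℂ))))
    (g' := fun x => ∑ s, e v s * MvPolynomial.eval (e x) (MvPolynomial.pderiv s P))
    (by
      simp only [ContinuousLinearMap.mul_apply']
      refine ((hint (U * P)).const_mul (-(α : ℂ))).congr (ae_of_all _ fun x => ?_)
      simp only [hU]; rw [map_mul]; ring)
    (by
      simp only [ContinuousLinearMap.mul_apply']
      refine (hint S).congr (ae_of_all _ fun x => ?_)
      simp only [hS]; ring)
    (by
      simp only [ContinuousLinearMap.mul_apply']
      refine (hint P).congr (ae_of_all _ fun x => ?_)
      simp only; ring)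
    (fun x _ => hw x) (fun x _ => hasLineDerivAt_eval e P x v)
  simp only [ContinuousLinearMap.mul_apply'] at key
  calc _ = ∫ x, (Real.exp (-(α * T x)) : ℂ) *
        ∑ s, e v s * MvPolynomial.eval (e x) (MvPolynomial.pderiv s P) ∂μ := by
        congr 1; ext x; ring
    _ = _ := by
        rw [key, ← integral_neg, ← integral_const_mul]
        congr 1; ext x; ring

end Gaussian

/-! ### Schwinger–Dyson equations -/

section Loop

open MvPolynomial

/-- The derivation of `ℂ[t₀, t₁, …]` with `t_q ↦ q t_{p + q - 1}`. It describes how power sums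
change along the vector field `M ↦ M ^ p`. -/
noncomputable def loopDerivation (p : ℕ) :
    Derivation ℂ (MvPolynomial ℕ ℂ) (MvPolynomial ℕ ℂ) :=
  mkDerivation ℂ fun q => (q : MvPolynomial ℕ ℂ) * X (p + q - 1)

/-- The element `∑_{i + j = p - 1} t_i t_j` of `ℂ[t₀, t₁, …]`. -/
noncomputable def loopSplit (p : ℕ) : MvPolynomial ℕ ℂ :=
  ∑ i ∈ Finset.range p, X i * X (p - 1 - i)

/-- The Schwinger–Dyson (loop) equations at size `n` and variance `v`, for a linear functional on
polynomials in the power sums `t_k`. -/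
structure LoopEquations (n : ℕ) (v : ℂ) (m : MvPolynomial ℕ ℂ →ₗ[ℂ] ℂ) : Prop where
  one : m 1 = 1
  zero : ∀ G, m (X 0 * G) = n * m G
  succ : ∀ p G, m (X (p + 1) * G) = v * m (loopSplit p * G + loopDerivation p G)

/-- The span of the products `∏ t_k` of weight at most `N`, where `t_k` has weight `k + 1`. -/
noncomputable def weightFiltration (N : ℕ) : Submodule ℂ (MvPolynomial ℕ ℂ) :=
  Submodule.span ℂ
    {x | ∃ l : List ℕ, (l.map (· + 1)).sum ≤ N ∧ x = (l.map (X (R := ℂ))).prod}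

theorem weightFiltration_mono {M N : ℕ} (h : M ≤ N) :
    weightFiltration M ≤ weightFiltration N :=
  Submodule.span_mono fun _ ⟨l, hl, hx⟩ => ⟨l, hl.trans h, hx⟩

theorem prod_mem_weightFiltration (l : List ℕ) :
    (l.map (X (R := ℂ))).prod ∈ weightFiltration (l.map (· + 1)).sum :=
  Submodule.subset_span ⟨l, le_rfl, rfl⟩

theorem X_mul_mem_weightFiltration (q : ℕ) {N : ℕ} {G : MvPolynomial ℕ ℂ}
    (hG : G ∈ weightFiltration N) : X q * G ∈ weightFiltration (q + 1 + N) := by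
  induction hG using Submodule.span_induction with
  | mem x hx =>
    obtain ⟨l, hl, rfl⟩ := hx
    exact Submodule.subset_span ⟨q :: l, by simpa using hl, by simp⟩
  | zero => simp
  | add x y _ _ hx hy => rw [mul_add]; exact add_mem hx hy
  | smul a x _ hx => rw [mul_smul_comm]; exact Submodule.smul_mem _ _ hx

/-- The derivation `loopDerivation p` raises the weight by at most `p`. -/
theorem loopDerivation_prod_mem (p : ℕ) (l : List ℕ) :
    loopDerivation p (l.map (X (R := ℂ))).prod ∈
      weightFiltration ((l.map (· + 1)).sum + p) := by
  induction l with
  | nil => simp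
  | cons q l ih =>
    have h1 : loopDerivation p (X q) = (q : MvPolynomial ℕ ℂ) * X (p + q - 1) := by
      simp [loopDerivation]
    simp only [List.map_cons, List.prod_cons, List.sum_cons, Derivation.leibniz, h1, smul_eq_mul]
    refine add_mem ?_ ?_
    · refine weightFiltration_mono ?_ (X_mul_mem_weightFiltration q ih)
      simp; omega
    · rcases Nat.eq_zero_or_pos q with rfl | hq
      · simp
      · have h2 : (List.map (X (R := ℂ)) l).prod * ((q : MvPolynomial ℕ ℂ) * X (p + q - 1)) =
            (q : ℂ) • (X (p + q - 1) * (List.map (X (R := ℂ)) l).prod) := by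
          rw [smul_eq_C_mul, map_natCast]
          ring
        rw [h2]
        refine Submodule.smul_mem _ _ (weightFiltration_mono ?_
          (X_mul_mem_weightFiltration (p + q - 1) (prod_mem_weightFiltration l)))
        simp; omega

/-- The loop equations express a moment through moments of lower weight, so that they have at most
one solution. -/
theorem LoopEquations.unique {n : ℕ} {v : ℂ} {m m' : MvPolynomial ℕ ℂ →ₗ[ℂ] ℂ}
    (h : LoopEquations n v m) (h' : LoopEquations n v m') (l : List ℕ) :
    m (l.map X).prod = m' (l.map X).prod := by
  suffices H : ∀ N, ∀ G ∈ weightFiltration N, m G = m' G from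
    H _ _ (prod_mem_weightFiltration l)
  intro N
  induction N using Nat.strong_induction_on with
  | _ N ih =>
    intro G hG
    induction hG using Submodule.span_induction with
    | zero => simp
    | add x y _ _ hx hy => rw [map_add, map_add, hx, hy]
    | smul a x _ hx => rw [map_smul, map_smul, hx]
    | mem x hx =>
      obtain ⟨l, hl, rfl⟩ := hx
      -- A factor `t₀` is the constant `n`; a factor `t_{p + 1}` is removed by the loop equation,
      -- whose right-hand side has weight lower by at least one.
      rcases l with _ | ⟨_ | p, l⟩
      · simp [h.one, h'.one]
      · rw [List.map_cons, List.prod_cons, h.zero, h'.zero,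
          ih (l.map (· + 1)).sum (by simp only [List.map_cons, List.sum_cons] at hl; omega) _
            (prod_mem_weightFiltration l)]
      · simp only [List.map_cons, List.sum_cons] at hl
        rw [List.map_cons, List.prod_cons, h.succ, h'.succ]
        congr 1
        refine ih ((l.map (· + 1)).sum + p + 1) (by omega) _ (add_mem ?_ ?_)
        · rw [loopSplit, Finset.sum_mul]
          refine sum_mem fun i hi => ?_
          rw [Finset.mem_range] at hi
          rw [mul_assoc]
          refine weightFiltration_mono ?_ (X_mul_mem_weightFiltration _
            (X_mul_mem_weightFiltration _ (prod_mem_weightFiltration l)))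
          omega
        · exact weightFiltration_mono (by omega) (loopDerivation_prod_mem p l)

/-- If a derivation `D` acts on the images `τ q` of the `t_q` like `loopDerivation p`, then it acts
so on the whole image of `ℂ[t₀, t₁, …]`. -/
theorem derivation_aeval {σ : Type*} (p : ℕ) (τ : ℕ → MvPolynomial σ ℂ)
    (D : Derivation ℂ (MvPolynomial σ ℂ) (MvPolynomial σ ℂ))
    (hD : ∀ q, D (τ q) = (q : MvPolynomial σ ℂ) * τ (p + q - 1)) (G : MvPolynomial ℕ ℂ) :
    D (aeval τ G) = aeval τ (loopDerivation p G) := by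
  induction G using MvPolynomial.induction_on with
  | C a => simp [algHom_C]
  | add x y hx hy => simp only [map_add, hx, hy]
  | mul_X x q hx =>
    rw [map_mul, aeval_X, Derivation.leibniz, Derivation.leibniz, hx, hD]
    simp [loopDerivation]

/-- A derivation of a polynomial ring in finitely many variables is a vector field. -/
theorem mkDerivation_eq_sum {σ : Type*} [Fintype σ] (f : σ → MvPolynomial σ ℂ)
    (Q : MvPolynomial σ ℂ) : mkDerivation ℂ f Q = ∑ s, f s * pderiv s Q := by
  classical
  have h : mkDerivation ℂ f = ∑ s, f s • pderiv s := by
    refine derivation_ext fun i => ?_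
    have h1 : (∑ s, f s • pderiv s : Derivation ℂ (MvPolynomial σ ℂ) (MvPolynomial σ ℂ)) (X i) =
        ∑ s, f s * pderiv s (X i) := by
      rw [← Derivation.coeFnAddMonoidHom_apply, map_sum, Finset.sum_apply]
      rfl
    rw [h1, mkDerivation_X, Finset.sum_eq_single i]
    · simp
    · intro b _ hb
      simp [hb.symm]
    · simp
  rw [h, ← Derivation.coeFnAddMonoidHom_apply, map_sum, Finset.sum_apply]
  rfl

end Loop

section GenericMatrix

open MvPolynomial Matrix

variable {n : ℕ}

/-- The generic `n × n` matrix. -/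
noncomputable abbrev genMatrix (n : ℕ) : Matrix (Fin n) (Fin n) (MvPolynomial (Fin n × Fin n) ℂ) :=
  mvPolynomialX (Fin n) (Fin n) ℂ

/-- The traces of the powers of the generic matrix. -/
noncomputable def genTrace (n k : ℕ) : MvPolynomial (Fin n × Fin n) ℂ :=
  (genMatrix n ^ k).trace

/-- The derivation of the coordinate ring of matrices given by the vector field `M ↦ M ^ p`. -/
noncomputable def matrixDerivation (n p : ℕ) :
    Derivation ℂ (MvPolynomial (Fin n × Fin n) ℂ) (MvPolynomial (Fin n × Fin n) ℂ) :=
  mkDerivation ℂ fun s => (genMatrix n ^ p) s.1 s.2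

/-- The derivative of `M ^ q` along `M ↦ M ^ p` is `q M ^ (p + q - 1)`, since these matrices
commute. -/
theorem matrixDerivation_pow (p q : ℕ) (a b : Fin n) :
    matrixDerivation n p ((genMatrix n ^ q) a b) =
      (q : MvPolynomial (Fin n × Fin n) ℂ) * (genMatrix n ^ (p + q - 1)) a b := by
  induction q generalizing a b with
  | zero =>
    by_cases h : a = b <;> simp [h]
  | succ q ih =>
    rw [pow_succ, Matrix.mul_apply, map_sum]
    have h1 : ∀ c, matrixDerivation n p ((genMatrix n ^ q) a c * genMatrix n c b) =
        (genMatrix n ^ q) a c * (genMatrix n ^ p) c b +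
        (q : MvPolynomial (Fin n × Fin n) ℂ) *
          ((genMatrix n ^ (p + q - 1)) a c * genMatrix n c b) := by
      intro c
      rw [Derivation.leibniz, ih, smul_eq_mul, smul_eq_mul]
      simp [matrixDerivation]; ring
    simp only [h1, Finset.sum_add_distrib, ← Finset.mul_sum, ← Matrix.mul_apply, ← pow_add,
      ← pow_succ]
    rcases Nat.eq_zero_or_pos q with rfl | hq
    · simp
    · rw [show p + (q + 1) - 1 = q + p by omega, show p + q - 1 + 1 = q + p by omega]
      push_cast; ring

theorem matrixDerivation_genTrace (p q : ℕ) :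
    matrixDerivation n p (genTrace n q) =
      (q : MvPolynomial (Fin n × Fin n) ℂ) * genTrace n (p + q - 1) := by
  simp only [genTrace, Matrix.trace, Matrix.diag, map_sum, matrixDerivation_pow, Finset.mul_sum]

theorem pderiv_genMatrix_pow (p : ℕ) (a b c d : Fin n) :
    pderiv (a, b) ((genMatrix n ^ p) c d) =
      ∑ i ∈ Finset.range p, (genMatrix n ^ i) c a * (genMatrix n ^ (p - 1 - i)) b d := by
  induction p generalizing d with
  | zero => by_cases h : c = d <;> simp [h, Matrix.one_apply]
  | succ p ih =>
    rw [pow_succ, Matrix.mul_apply, map_sum, Finset.sum_range_succ]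
    simp only [Derivation.leibniz, ih, smul_eq_mul, Finset.sum_add_distrib]
    rw [add_comm]
    congr 1
    · simp only [Finset.mul_sum]
      rw [Finset.sum_comm]
      refine Finset.sum_congr rfl fun i hi => ?_
      rw [Finset.mem_range] at hi
      rw [show p + 1 - 1 - i = p - 1 - i + 1 by omega, pow_succ, Matrix.mul_apply, Finset.mul_sum]
      exact Finset.sum_congr rfl fun j _ => by ring
    · rw [show p + 1 - 1 - p = 0 by omega, pow_zero, Matrix.one_apply]
      rw [Finset.sum_eq_single a]
      · by_cases h : b = d
        · subst h; simp
        · simp [h, Ne.symm h]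
      · intro e _ he
        simp [he]
      · simp

/-- The divergence of the vector field `M ↦ M ^ p`. -/
theorem sum_pderiv_genMatrix_pow (p : ℕ) :
    ∑ s : Fin n × Fin n, pderiv s ((genMatrix n ^ p) s.1 s.2) =
      aeval (genTrace n) (loopSplit p) := by
  rw [Fintype.sum_prod_type]
  simp only [pderiv_genMatrix_pow, loopSplit, map_sum, map_mul, aeval_X, genTrace, Matrix.trace,
    Matrix.diag, Finset.sum_mul_sum]
  have : ∀ a : Fin n, ∑ b : Fin n, ∑ i ∈ Finset.range p,
      (genMatrix n ^ i) a a * (genMatrix n ^ (p - 1 - i)) b b = ∑ i ∈ Finset.range p,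
      ∑ b : Fin n, (genMatrix n ^ i) a a * (genMatrix n ^ (p - 1 - i)) b b :=
    fun a => Finset.sum_comm
  simp only [this]
  exact Finset.sum_comm

/-- A functional on matrix polynomials that satisfies Gaussian integration by parts satisfies the
loop equations. -/
theorem loopEquations_matrix {v : ℂ} (E : MvPolynomial (Fin n × Fin n) ℂ →ₗ[ℂ] ℂ) (h1 : E 1 = 1)
    (hE : ∀ a b P, E (X (a, b) * P) = v * E (pderiv (b, a) P)) :
    LoopEquations n v (E ∘ₗ (aeval (genTrace n)).toLinearMap) where
  one := by simpa using h1
  zero G := by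
    have : genTrace n 0 = C (n : ℂ) := by simp [genTrace]
    simp only [LinearMap.comp_apply, AlgHom.toLinearMap_apply, map_mul, aeval_X, this,
      ← smul_eq_C_mul, map_smul, smul_eq_mul]
  succ p G := by
    set P := aeval (genTrace n) G with hP
    have h2 : genTrace n (p + 1) * P =
        ∑ s : Fin n × Fin n, X (s.2, s.1) * ((genMatrix n ^ p) s.1 s.2 * P) := by
      rw [genTrace, pow_succ, Matrix.trace, Finset.sum_mul, Fintype.sum_prod_type]
      refine Finset.sum_congr rfl fun a _ => ?_
      rw [Matrix.diag, Matrix.mul_apply, Finset.sum_mul]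
      refine Finset.sum_congr rfl fun b _ => ?_
      simp only [mvPolynomialX_apply]; ring
    have h3 : matrixDerivation n p P = ∑ s, (genMatrix n ^ p) s.1 s.2 * pderiv s P :=
      mkDerivation_eq_sum _ _
    simp only [LinearMap.comp_apply, AlgHom.toLinearMap_apply, map_mul, aeval_X, map_add, ← hP]
    rw [h2, map_sum]
    simp only [hE, ← Finset.mul_sum]
    rw [← map_sum]
    simp only [Derivation.leibniz, smul_eq_mul, Finset.sum_add_distrib, ← Finset.mul_sum,
      sum_pderiv_genMatrix_pow]
    rw [← h3, hP, derivation_aeval p _ _ (matrixDerivation_genTrace p), ← map_add]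
    congr 2
    ring

end GenericMatrix

section Vandermonde

open MvPolynomial

variable {n : ℕ}

/-- The power sums in `n` variables. -/
noncomputable def powerSum (n k : ℕ) : MvPolynomial (Fin n) ℂ := ∑ i, X i ^ k

/-- The generic Vandermonde product. -/
noncomputable def vandermondeProd (n : ℕ) : MvPolynomial (Fin n) ℂ :=
  ∏ i, ∏ j ∈ Finset.Ioi i, (X j - X i)

/-- The derivation given by the vector field `∑ λ_i ^ p ∂_i`. -/
noncomputable def powerDerivation (n p : ℕ) :
    Derivation ℂ (MvPolynomial (Fin n) ℂ) (MvPolynomial (Fin n) ℂ) :=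
  mkDerivation ℂ fun i => X i ^ p

theorem powerDerivation_powerSum (p q : ℕ) :
    powerDerivation n p (powerSum n q) =
      (q : MvPolynomial (Fin n) ℂ) * powerSum n (p + q - 1) := by
  rw [powerSum, powerSum, map_sum, Finset.mul_sum]
  refine Finset.sum_congr rfl fun i _ => ?_
  rw [Derivation.leibniz_pow, powerDerivation, mkDerivation_X]
  rcases Nat.eq_zero_or_pos q with rfl | hq
  · simp
  · rw [show p + q - 1 = q - 1 + p by omega, pow_add]
    simp

/-- The logarithmic derivative of a product. -/
theorem derivation_prod_eq_mul {ι A : Type*} [CommRing A] [Algebra ℂ A] (D : Derivation ℂ A A)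
    (s : Finset ι) (f h : ι → A) (hf : ∀ i ∈ s, D (f i) = f i * h i) :
    D (∏ i ∈ s, f i) = (∏ i ∈ s, f i) * ∑ i ∈ s, h i := by
  classical
  induction s using Finset.induction_on with
  | empty => simp
  | insert a s ha ih =>
    rw [Finset.prod_insert ha, Finset.sum_insert ha, Derivation.leibniz,
      ih fun i hi => hf i (Finset.mem_insert_of_mem hi), hf a (Finset.mem_insert_self _ _)]
    simp only [smul_eq_mul]; ring

/-- A symmetric double sum splits into its diagonal and twice its part above the diagonal. -/
theorem sum_sum_eq_diag_add_two_mul {A : Type*} [CommRing A] (c : Fin n → Fin n → A)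
    (hc : ∀ i j, c i j = c j i) :
    ∑ i, ∑ j, c i j = ∑ i, c i i + 2 * ∑ i, ∑ j ∈ Finset.Ioi i, c j i := by
  have h1 : ∀ i : Fin n, ∑ j, c i j =
      c i i + (∑ j ∈ Finset.Ioi i, c i j + ∑ j ∈ Finset.Iio i, c i j) := by
    intro i
    have h2 : (Finset.univ : Finset (Fin n)) =
        insert i (Finset.Ioi i ∪ Finset.Iio i) := by
      ext j
      simp only [Finset.mem_univ, Finset.mem_insert, Finset.mem_union, Finset.mem_Ioi,
        Finset.mem_Iio, true_iff]
      rcases lt_trichotomy i j with h | h | h <;> simp [h]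
    rw [h2, Finset.sum_insert (by simp), Finset.sum_union]
    rw [Finset.disjoint_left]
    intro j hj hj'
    rw [Finset.mem_Ioi] at hj
    rw [Finset.mem_Iio] at hj'
    exact lt_asymm hj hj'
  have h3 : ∑ i : Fin n, ∑ j ∈ Finset.Iio i, c i j = ∑ i : Fin n, ∑ j ∈ Finset.Ioi i, c j i :=
    Finset.sum_comm' (by simp)
  have h4 : ∑ i : Fin n, ∑ j ∈ Finset.Ioi i, c i j = ∑ i : Fin n, ∑ j ∈ Finset.Ioi i, c j i :=
    Finset.sum_congr rfl fun i _ => Finset.sum_congr rfl fun j _ => hc i j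
  simp only [h1, Finset.sum_add_distrib, h3]
  rw [h4]; ring

/-- The logarithmic derivative of the Vandermonde product along `∑ λ_i ^ p ∂_i` is
`∑_{i < j} (λ_j ^ p - λ_i ^ p) / (λ_j - λ_i)`. -/
theorem powerDerivation_vandermonde (p : ℕ) :
    powerDerivation n p (vandermondeProd n) = vandermondeProd n *
      ∑ i, ∑ j ∈ Finset.Ioi i, ∑ k ∈ Finset.range p, X j ^ k * X i ^ (p - 1 - k) := by
  refine derivation_prod_eq_mul _ _ _ _ fun i _ => derivation_prod_eq_mul _ _ _ _ fun j _ => ?_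
  rw [mul_comm, geom_sum₂_mul]
  simp [powerDerivation]

/-- A functional on polynomials in the eigenvalues, `P ↦ E (P Δ²)` with `E` satisfying Gaussian
integration by parts, satisfies the loop equations. -/
theorem loopEquations_vandermonde {v : ℂ} (E : MvPolynomial (Fin n) ℂ →ₗ[ℂ] ℂ)
    (h1 : E (vandermondeProd n ^ 2) = 1) (hE : ∀ i P, E (X i * P) = v * E (pderiv i P)) :
    LoopEquations n v (E ∘ₗ LinearMap.mulRight ℂ (vandermondeProd n ^ 2) ∘ₗ
      (aeval (powerSum n)).toLinearMap) where
  one := by simpa using h1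
  zero G := by
    have : powerSum n 0 = C (n : ℂ) := by simp [powerSum]
    simp only [LinearMap.comp_apply, AlgHom.toLinearMap_apply, map_mul, aeval_X, this,
      ← smul_eq_C_mul, map_smul, smul_eq_mul]
  succ p G := by
    set P := aeval (powerSum n) G with hP
    have h2 : powerSum n (p + 1) * P * vandermondeProd n ^ 2 =
        ∑ i, X i * (X i ^ p * (P * vandermondeProd n ^ 2)) := by
      rw [powerSum, mul_assoc, Finset.sum_mul]
      exact Finset.sum_congr rfl fun i _ => by ring
    have h3 : ∀ Q, powerDerivation n p Q = ∑ i, X i ^ p * pderiv i Q :=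
      mkDerivation_eq_sum _
    -- The divergence of the vector field is the diagonal of this double sum, and the derivative of
    -- `Δ ^ 2` contributes twice the part above the diagonal.
    have h4 : aeval (powerSum n) (loopSplit p) =
        ∑ i, (p : MvPolynomial (Fin n) ℂ) * X i ^ (p - 1) +
        2 * ∑ i, ∑ j ∈ Finset.Ioi i, ∑ k ∈ Finset.range p, X j ^ k * X i ^ (p - 1 - k) := by
      have h5 : aeval (powerSum n) (loopSplit p) = ∑ i, ∑ j,
          ∑ k ∈ Finset.range p, (X i ^ k * X j ^ (p - 1 - k) : MvPolynomial (Fin n) ℂ) := by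
        simp only [loopSplit, map_sum, map_mul, aeval_X, powerSum, Finset.sum_mul_sum]
        rw [Finset.sum_comm]
        exact Finset.sum_congr rfl fun i _ => Finset.sum_comm
      rw [h5, sum_sum_eq_diag_add_two_mul]
      · congr 1
        refine Finset.sum_congr rfl fun i _ => ?_
        rw [Finset.sum_congr rfl (g := fun _ => (X i ^ (p - 1) : MvPolynomial (Fin n) ℂ))]
        · simp
        · intro k hk
          rw [Finset.mem_range] at hk
          rw [← pow_add, show k + (p - 1 - k) = p - 1 by omega]
      · intro i j
        rw [← Finset.sum_range_reflect]
        refine Finset.sum_congr rfl fun k hk => ?_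
        rw [Finset.mem_range] at hk
        rw [show p - 1 - (p - 1 - k) = k by omega, mul_comm]
    simp only [LinearMap.comp_apply, AlgHom.toLinearMap_apply, map_mul, aeval_X, map_add, ← hP,
      LinearMap.mulRight_apply]
    rw [h2, map_sum]
    simp only [hE, ← Finset.mul_sum]
    rw [← map_sum, ← map_add]
    congr 2
    have h6 : ∀ i : Fin n, pderiv i (X i ^ p * (P * vandermondeProd n ^ 2)) =
        ((p : MvPolynomial (Fin n) ℂ) * X i ^ (p - 1)) * (P * vandermondeProd n ^ 2) +
          X i ^ p * pderiv i (P * vandermondeProd n ^ 2) := by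
      intro i
      rw [Derivation.leibniz, Derivation.leibniz_pow]
      simp; ring
    simp only [h6, Finset.sum_add_distrib, ← h3, ← Finset.sum_mul]
    rw [Derivation.leibniz, Derivation.leibniz_pow, powerDerivation_vandermonde, hP,
      derivation_aeval p _ _ (powerDerivation_powerSum p), h4]
    simp only [smul_eq_mul, nsmul_eq_mul]
    push_cast; ring

end Vandermonde

/-! ### The two ensembles -/

section MatrixEnsemble

open MvPolynomial Matrix

variable {n : ℕ}

/-- The entries of the matrix with given coordinates, as a real linear map. -/
noncomputable def entries (n : ℕ) : Coord n →ₗ[ℝ] (Fin n × Fin n → ℂ) where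
  toFun x s := toMatrix x s.1 s.2
  map_add' x y := by
    ext ⟨j, k⟩
    rcases lt_trichotomy j k with h | h | h
    · simp [toMatrix, h, Complex.ext_iff]
    · subst h; simp [toMatrix]
    · simp [toMatrix, h, h.not_gt, Complex.ext_iff, add_comm]
  map_smul' c x := by
    ext ⟨j, k⟩
    rcases lt_trichotomy j k with h | h | h
    · simp [toMatrix, h, Complex.ext_iff]
    · subst h; simp [toMatrix]
    · simp [toMatrix, h, h.not_gt, Complex.ext_iff]

/-- Every Hermitian matrix is given by coordinates. -/
theorem exists_entries_eq {N : Matrix (Fin n) (Fin n) ℂ} (hN : N.IsHermitian) :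
    ∃ x : Coord n, ∀ a b, entries n x (a, b) = N a b := by
  refine ⟨(fun j => (N j j).re, fun p => ((N p.1.1 p.1.2).re, (N p.1.1 p.1.2).im)), fun j k => ?_⟩
  have hs := hN.apply
  rcases lt_trichotomy j k with h | h | h
  · simp [entries, toMatrix, h]
  · subst h
    have := hs j j
    simp only [Complex.ext_iff, Complex.star_def, Complex.conj_re, Complex.conj_im] at this
    simp [entries, toMatrix, Complex.ext_iff]; linarith [this.2]
  · have := hs j k
    simp only [Complex.ext_iff, Complex.star_def, Complex.conj_re, Complex.conj_im] at this
    simp only [entries, toMatrix, LinearMap.coe_mk, AddHom.coe_mk, of_apply, h.not_gt, h,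
      dite_true, dite_false, Complex.ext_iff]
    exact ⟨this.1, this.2⟩

theorem eval_genMatrix_pow (x : Coord n) (k : ℕ) (a b : Fin n) :
    eval (entries n x) ((genMatrix n ^ k) a b) = (toMatrix x ^ k) a b := by
  induction k generalizing b with
  | zero => by_cases h : a = b <;> simp [h]
  | succ k ih =>
    rw [pow_succ, pow_succ, Matrix.mul_apply, Matrix.mul_apply, map_sum]
    simp only [map_mul, ih]
    simp [entries]

theorem eval_genTrace (x : Coord n) (k : ℕ) :
    eval (entries n x) (genTrace n k) = (toMatrix x ^ k).trace := by
  simp [genTrace, Matrix.trace, eval_genMatrix_pow]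

/-- The quadratic form `Tr M ^ 2`. -/
noncomputable def traceSq (x : Coord n) : ℝ := (toMatrix x ^ 2).trace.re

theorem trace_sq_eq_sum_norm (x : Coord n) :
    (toMatrix x ^ 2).trace = ((∑ a, ∑ b, ‖toMatrix x a b‖ ^ 2 : ℝ) : ℂ) := by
  rw [pow_two, Matrix.trace]
  push_cast
  refine Finset.sum_congr rfl fun a _ => ?_
  rw [Matrix.diag, Matrix.mul_apply]
  refine Finset.sum_congr rfl fun b _ => ?_
  rw [← (toMatrix_isHermitian x).apply b a, ← Complex.mul_conj']
  rfl

theorem traceSq_eq_sum_norm (x : Coord n) :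
    traceSq x = ∑ a, ∑ b, ‖toMatrix x a b‖ ^ 2 := by
  rw [traceSq, trace_sq_eq_sum_norm, Complex.ofReal_re]

theorem ofReal_traceSq (x : Coord n) : (traceSq x : ℂ) = eval (entries n x) (genTrace n 2) := by
  rw [eval_genTrace, traceSq_eq_sum_norm, trace_sq_eq_sum_norm]

theorem norm_toMatrix_sq_le (x : Coord n) (a b : Fin n) : ‖toMatrix x a b‖ ^ 2 ≤ traceSq x := by
  rw [traceSq_eq_sum_norm]
  calc ‖toMatrix x a b‖ ^ 2 ≤ ∑ b, ‖toMatrix x a b‖ ^ 2 :=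
        Finset.single_le_sum (f := fun b => ‖toMatrix x a b‖ ^ 2) (fun _ _ => sq_nonneg _)
          (Finset.mem_univ b)
    _ ≤ _ := Finset.single_le_sum (f := fun a => ∑ b, ‖toMatrix x a b‖ ^ 2)
        (fun _ _ => Finset.sum_nonneg fun _ _ => sq_nonneg _) (Finset.mem_univ a)

theorem traceSq_nonneg (x : Coord n) : 0 ≤ traceSq x := by
  rw [traceSq_eq_sum_norm]
  exact Finset.sum_nonneg fun _ _ => Finset.sum_nonneg fun _ _ => sq_nonneg _

theorem norm_sq_le_traceSq (x : Coord n) : ‖x‖ ^ 2 ≤ traceSq x := by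
  have h0 := traceSq_nonneg x
  have key : ‖x‖ ≤ √(traceSq x) := by
    rw [Prod.norm_def]
    refine max_le ((pi_norm_le_iff_of_nonneg (Real.sqrt_nonneg _)).2 fun j => ?_)
      ((pi_norm_le_iff_of_nonneg (Real.sqrt_nonneg _)).2 fun p => ?_)
    · apply Real.le_sqrt_of_sq_le
      have := norm_toMatrix_sq_le x j j
      simpa [toMatrix] using this
    · have h1 := norm_toMatrix_sq_le x p.1.1 p.1.2
      have h2 : toMatrix x p.1.1 p.1.2 = ⟨(x.2 p).1, (x.2 p).2⟩ := by
        simp [toMatrix, p.2]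
      rw [h2, ← Complex.normSq_eq_norm_sq, Complex.normSq_mk] at h1
      rw [Prod.norm_def]
      refine max_le ?_ ?_ <;> apply Real.le_sqrt_of_sq_le <;>
        rw [Real.norm_eq_abs, sq_abs] <;> nlinarith [sq_nonneg (x.2 p).1, sq_nonneg (x.2 p).2]
  calc ‖x‖ ^ 2 ≤ √(traceSq x) ^ 2 := by gcongr
    _ = _ := Real.sq_sqrt h0

theorem continuous_toMatrix_pow_trace (k : ℕ) :
    Continuous fun x : Coord n => (toMatrix x ^ k).trace := by
  simp only [← eval_genTrace]
  exact (continuous_eval _).comp (entries n).continuous_of_finiteDimensional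

theorem continuous_traceSq : Continuous (traceSq (n := n)) :=
  Complex.continuous_re.comp (continuous_toMatrix_pow_trace 2)

/-- The gradient of `Tr M ^ 2` is twice the transpose of `M`. -/
theorem pderiv_genTrace_two (s : Fin n × Fin n) :
    pderiv s (genTrace n 2) = 2 * X (s.2, s.1) := by
  obtain ⟨a, b⟩ := s
  rw [genTrace, Matrix.trace, map_sum]
  simp only [Matrix.diag, pderiv_genMatrix_pow, Finset.sum_range_succ, Finset.range_zero,
    Finset.sum_empty, zero_add, Finset.sum_add_distrib, pow_zero]
  norm_num [Matrix.one_apply]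
  ring

instance : (volume : Measure (Coord n)).IsAddHaarMeasure := by
  have h1 : (volume : Measure (ℝ × ℝ)).IsAddHaarMeasure := by
    rw [Measure.volume_eq_prod]; infer_instance
  have h2 : (volume : Measure ({p : Fin n × Fin n // p.1 < p.2} → ℝ × ℝ)).IsAddHaarMeasure := by
    rw [volume_pi]; infer_instance
  have h3 : (volume : Measure (Fin n → ℝ)).IsAddHaarMeasure := by infer_instance
  rw [Measure.volume_eq_prod]
  exact Measure.prod.instIsAddHaarMeasure _ _

theorem weight_eq (g : ℝ) (x : Coord n) :
    weight g n x = Real.exp (-(n / (2 * g) * traceSq x)) := by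
  rw [weight, traceSq]; ring_nf

theorem Tame.integrable_weight {𝕜 : Type*} [RCLike 𝕜] {g : ℝ} (hg : 0 < g) (hn : 0 < n)
    {f : Coord n → 𝕜} (hf : Tame traceSq f) (hfm : AEStronglyMeasurable f volume) :
    Integrable (fun x => f x * (weight g n x : 𝕜)) := by
  simp only [weight_eq]
  exact hf.integrable continuous_traceSq norm_sq_le_traceSq hfm (by positivity)

theorem integrable_weight {g : ℝ} (hg : 0 < g) (hn : 0 < n) :
    Integrable (weight g n) := by
  have := (Tame.const (T := traceSq (n := n)) traceSq_nonneg (1 : ℝ)).integrable_weight hg hn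
    aestronglyMeasurable_const
  simpa using this

theorem weight_pos (g : ℝ) (x : Coord n) : 0 < weight g n x := Real.exp_pos _

theorem measurable_weight (g : ℝ) : Measurable (weight g n) := by
  have : weight g n = fun x => Real.exp (-(n / (2 * g) * traceSq x)) := funext (weight_eq g)
  rw [this]
  exact (Real.continuous_exp.comp (continuous_const.mul continuous_traceSq).neg).measurable

theorem integral_weight_pos {g : ℝ} (hg : 0 < g) (hn : 0 < n) :
    0 < ∫ x : Coord n, weight g n x := by
  rw [integral_pos_iff_support_of_nonneg (fun x => (weight_pos g x).le) (integrable_weight hg hn)]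
  have : Function.support (weight g n) = Set.univ := by
    ext x; simp [(weight_pos g x).ne']
  rw [this]
  exact NeZero.pos _

theorem lintegral_weight {g : ℝ} (hg : 0 < g) (hn : 0 < n) :
    ∫⁻ x : Coord n, ENNReal.ofReal (weight g n x) = ENNReal.ofReal (∫ x : Coord n, weight g n x) :=
  (ofReal_integral_eq_lintegral_ofReal (integrable_weight hg hn)
    (ae_of_all _ fun x => (weight_pos g x).le)).symm

/-- The expectation under the GUE law, through the weight and its total mass. -/
theorem integral_law {𝕜 : Type*} [RCLike 𝕜] {g : ℝ} (hg : 0 < g) (hn : 0 < n) (f : Coord n → 𝕜) :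
    ∫ x, f x ∂(law g n) =
      ((∫ x : Coord n, weight g n x)⁻¹ : ℝ) * ∫ x, f x * (weight g n x : 𝕜) := by
  have hZ := integral_weight_pos (n := n) hg hn
  rw [law, integral_smul_measure, lintegral_weight hg hn, ENNReal.toReal_inv,
    ENNReal.toReal_ofReal hZ.le, integral_withDensity_eq_integral_toReal_smul
      (measurable_weight g).ennreal_ofReal (ae_of_all _ fun _ => ENNReal.ofReal_lt_top),
      RCLike.real_smul_eq_coe_mul]
  congr 2
  ext x
  rw [ENNReal.toReal_ofReal (weight_pos g x).le, RCLike.real_smul_eq_coe_mul, mul_comm]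

theorem isProbabilityMeasure_law {g : ℝ} (hg : 0 < g) (hn : 0 < n) :
    IsProbabilityMeasure (law g n) := by
  constructor
  have hZ := integral_weight_pos (n := n) hg hn
  rw [law, Measure.smul_apply, withDensity_apply _ MeasurableSet.univ, Measure.restrict_univ,
    smul_eq_mul, lintegral_weight hg hn]
  exact ENNReal.inv_mul_cancel (by simpa using hZ) ENNReal.ofReal_ne_top

theorem Tame.integrable_law {𝕜 : Type*} [RCLike 𝕜] {g : ℝ} (hg : 0 < g) (hn : 0 < n)
    {f : Coord n → 𝕜} (hf : Tame traceSq f) (hfm : AEStronglyMeasurable f volume) :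
    Integrable f (law g n) := by
  have hZ := integral_weight_pos (n := n) hg hn
  rw [law]
  refine Integrable.smul_measure ?_ ?_
  · rw [integrable_withDensity_iff_integrable_smul' (measurable_weight g).ennreal_ofReal
      (ae_of_all _ fun _ => ENNReal.ofReal_lt_top)]
    refine (hf.integrable_weight hg hn hfm).congr (ae_of_all _ fun x => ?_)
    simp only
    rw [ENNReal.toReal_ofReal (weight_pos g x).le, RCLike.real_smul_eq_coe_mul, mul_comm]
  · rw [lintegral_weight hg hn]
    exact ENNReal.inv_ne_top.2 (by simpa using hZ)

theorem tame_eval_entries (P : MvPolynomial (Fin n × Fin n) ℂ) :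
    Tame traceSq (fun x => eval (entries n x) P) :=
  tame_eval traceSq_nonneg (fun x => entries n x) (fun x s => norm_toMatrix_sq_le x s.1 s.2) P

/-- The expectation of a polynomial in the matrix entries. -/
noncomputable def matrixExpectation {g : ℝ} (hg : 0 < g) (hn : 0 < n) :
    MvPolynomial (Fin n × Fin n) ℂ →ₗ[ℂ] ℂ where
  toFun P := ∫ x, eval (entries n x) P ∂(law g n)
  map_add' P Q := by
    have h : ∀ P, Integrable (fun x => eval (entries n x) P) (law g n) := fun P =>
      (tame_eval_entries P).integrable_law hg hn
        ((continuous_eval P).comp (entries n).continuous_of_finiteDimensional).aestronglyMeasurable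
    simp only [map_add]
    exact integral_add (h P) (h Q)
  map_smul' c P := by
    simp only [smul_eval, RingHom.id_apply, smul_eq_mul]
    exact integral_const_mul _ _

/-- Gaussian integration by parts for the entries of a GUE matrix. -/
theorem matrixExpectation_stein {g : ℝ} (hg : 0 < g) (hn : 0 < n) (a b : Fin n)
    (P : MvPolynomial (Fin n × Fin n) ℂ) :
    matrixExpectation hg hn (X (a, b) * P) =
      ((g / n : ℝ) : ℂ) * matrixExpectation hg hn (pderiv (b, a) P) := by
  have hZ := integral_weight_pos (n := n) hg hn
  -- the identity contracted with a matrix `N`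
  let Φ : Matrix (Fin n) (Fin n) ℂ → ℂ := fun N => ∑ s : Fin n × Fin n, N s.1 s.2 *
    (matrixExpectation hg hn (pderiv s P) -
      ((n / g : ℝ) : ℂ) * matrixExpectation hg hn (X (s.2, s.1) * P))
  have hherm : ∀ N : Matrix (Fin n) (Fin n) ℂ, N.IsHermitian → Φ N = 0 := by
    intro N hN
    obtain ⟨v, hv⟩ := exists_entries_eq hN
    have h := stein_eval (μ := (volume : Measure (Coord n))) (entries n) continuous_traceSq
      norm_sq_le_traceSq (fun x s => norm_toMatrix_sq_le x s.1 s.2) (genTrace n 2)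
      ofReal_traceSq P v (α := n / (2 * g)) (by positivity)
    simp only [← weight_eq] at h
    have e1 : matrixExpectation hg hn (∑ s, C (entries n v s) * pderiv s P) =
        ((n / (2 * g) : ℝ) : ℂ) *
          matrixExpectation hg hn ((∑ s, C (entries n v s) * pderiv s (genTrace n 2)) * P) := by
      simp only [matrixExpectation, LinearMap.coe_mk, AddHom.coe_mk, integral_law hg hn]
      simp only [map_sum, map_mul, eval_C]
      rw [mul_left_comm]
      congr 1
    simp only [pderiv_genTrace_two, ← smul_eq_C_mul, map_sum, map_smul, Finset.sum_mul,
      Finset.mul_sum] at e1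
    simp only [Φ, mul_sub, Finset.sum_sub_distrib]
    rw [sub_eq_zero]
    convert e1 using 2 with s _ s _
    · rw [← hv, smul_eq_mul]
    · rw [← hv]
      have : entries n v (s.1, s.2) • (2 * X (s.2, s.1)) * P =
          (2 * entries n v s) • (X (s.2, s.1) * P) := by
        rw [smul_eq_C_mul, smul_eq_C_mul, map_mul, map_ofNat]
        ring
      rw [this, map_smul, smul_eq_mul]
      push_cast
      field_simp
  -- `Φ` is complex linear, and every matrix is a complex combination of Hermitian matrices.
  have hall : ∀ N : Matrix (Fin n) (Fin n) ℂ, Φ N = 0 := by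
    intro N
    have h1 := hherm (N + N.conjTranspose) (isHermitian_add_transpose_self N)
    have h2 := hherm (Complex.I • (N - N.conjTranspose)) (by
      rw [IsHermitian, conjTranspose_smul, conjTranspose_sub, conjTranspose_conjTranspose]
      ext i j; simp; ring)
    have h3 : Φ (N + N.conjTranspose) - Complex.I * Φ (Complex.I • (N - N.conjTranspose)) =
        2 * Φ N := by
      simp only [Φ, Finset.mul_sum]
      rw [← Finset.sum_sub_distrib]
      refine Finset.sum_congr rfl fun s _ => ?_
      simp only [Matrix.add_apply, Matrix.smul_apply, Matrix.sub_apply, smul_eq_mul]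
      linear_combination (-(N s.1 s.2 - N.conjTranspose s.1 s.2)) *
        (matrixExpectation hg hn (pderiv s P) - ((n / g : ℝ) : ℂ) *
          matrixExpectation hg hn (X (s.2, s.1) * P)) * Complex.I_mul_I
    rw [h1, h2] at h3
    simpa using h3.symm
  have h := hall (Matrix.single b a 1)
  simp only [Φ] at h
  rw [Finset.sum_eq_single (b, a)] at h
  · simp only [Matrix.single_apply_same, one_mul, sub_eq_zero] at h
    rw [h, ← mul_assoc, ← Complex.ofReal_mul]
    have : g / n * (n / g) = 1 := by field_simp
    rw [this]; simp
  · rintro ⟨c, d⟩ _ hcd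
    have : (Matrix.single b a (1 : ℂ)) c d = 0 := by
      apply Matrix.single_apply_of_ne
      rintro ⟨rfl, rfl⟩; exact hcd rfl
    simp [this]
  · simp

theorem trace_pow_eq_sum_eigenvalues (x : Coord n) (k : ℕ) :
    (toMatrix x ^ k).trace = ((∑ i, (toMatrix_isHermitian x).eigenvalues i ^ k : ℝ) : ℂ) := by
  set hA := toMatrix_isHermitian x
  have h : (toMatrix x ^ k).trace = _ := congrArg (fun N => (N ^ k).trace) hA.spectral_theorem
  rw [h, ← map_pow, Unitary.conjStarAlgAut_apply, Matrix.trace_mul_comm, ← mul_assoc]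
  simp [Matrix.diagonal_pow, Matrix.trace]

end MatrixEnsemble

section EigenvalueEnsemble

open MvPolynomial

variable {n : ℕ}

/-- The embedding of real points into complex points. -/
noncomputable def realPoints (n : ℕ) : (Fin n → ℝ) →ₗ[ℝ] (Fin n → ℂ) where
  toFun l i := l i
  map_add' x y := by ext; simp
  map_smul' c x := by ext; simp

/-- The Vandermonde product `∏_{i < j} (l_j - l_i)`. -/
noncomputable def vandermondeReal (l : Fin n → ℝ) : ℝ :=
  ∏ i, ∏ j ∈ Finset.Ioi i, (l j - l i)

theorem eval_vandermondeProd (l : Fin n → ℝ) :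
    eval (realPoints n l) (vandermondeProd n) = (vandermondeReal l : ℂ) := by
  simp [vandermondeProd, vandermondeReal, realPoints]

theorem eval_powerSum (l : Fin n → ℝ) (k : ℕ) :
    eval (realPoints n l) (powerSum n k) = ((∑ i, l i ^ k : ℝ) : ℂ) := by
  simp [powerSum, realPoints]

theorem norm_sq_le_sum_sq (l : Fin n → ℝ) : ‖l‖ ^ 2 ≤ ∑ i, l i ^ 2 := by
  have h0 : 0 ≤ ∑ i, l i ^ 2 := Finset.sum_nonneg fun _ _ => sq_nonneg _
  have key : ‖l‖ ≤ √(∑ i, l i ^ 2) := by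
    refine (pi_norm_le_iff_of_nonneg (Real.sqrt_nonneg _)).2 fun j => ?_
    apply Real.le_sqrt_of_sq_le
    rw [Real.norm_eq_abs, sq_abs]
    exact Finset.single_le_sum (f := fun i => l i ^ 2) (fun _ _ => sq_nonneg _) (Finset.mem_univ j)
  calc ‖l‖ ^ 2 ≤ √(∑ i, l i ^ 2) ^ 2 := by gcongr
    _ = _ := Real.sq_sqrt h0

theorem norm_realPoints_sq_le (l : Fin n → ℝ) (i : Fin n) :
    ‖realPoints n l i‖ ^ 2 ≤ ∑ i, l i ^ 2 := by
  simp only [realPoints, LinearMap.coe_mk, AddHom.coe_mk, Complex.norm_real, Real.norm_eq_abs,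
    sq_abs]
  exact Finset.single_le_sum (f := fun i => l i ^ 2) (fun _ _ => sq_nonneg _) (Finset.mem_univ i)

theorem integrable_eval_realPoints {α : ℝ} (hα : 0 < α) (P : MvPolynomial (Fin n) ℂ) :
    Integrable (fun l : Fin n → ℝ =>
      eval (realPoints n l) P * (Real.exp (-(α * ∑ i, l i ^ 2)) : ℂ)) :=
  (tame_eval (fun l => Finset.sum_nonneg fun _ _ => sq_nonneg _) _ norm_realPoints_sq_le
    P).integrable (𝕜 := ℂ) (by fun_prop) norm_sq_le_sum_sq
    ((continuous_eval P).comp (realPoints n).continuous_of_finiteDimensional).aestronglyMeasurable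
    hα

/-- The expectation of a polynomial under `c exp (-α ∑ l_i ^ 2) dl`. -/
noncomputable def gaussianExpectation (n : ℕ) (c : ℝ) {α : ℝ} (hα : 0 < α) :
    MvPolynomial (Fin n) ℂ →ₗ[ℂ] ℂ where
  toFun P := c * ∫ l : Fin n → ℝ, eval (realPoints n l) P * (Real.exp (-(α * ∑ i, l i ^ 2)) : ℂ)
  map_add' P Q := by
    simp only [map_add, add_mul]
    rw [integral_add (integrable_eval_realPoints hα P) (integrable_eval_realPoints hα Q), mul_add]
  map_smul' a P := by
    simp only [smul_eval, RingHom.id_apply, smul_eq_mul, mul_assoc, integral_const_mul]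
    ring

/-- Gaussian integration by parts for independent Gaussian variables of variance `1 / (2 α)`. -/
theorem gaussianExpectation_stein (c : ℝ) {α : ℝ} (hα : 0 < α) (i : Fin n)
    (P : MvPolynomial (Fin n) ℂ) :
    gaussianExpectation n c hα (X i * P) =
      (((2 * α)⁻¹ : ℝ) : ℂ) * gaussianExpectation n c hα (pderiv i P) := by
  have hQ : ∀ l : Fin n → ℝ, ((∑ i, l i ^ 2 : ℝ) : ℂ) =
      eval (realPoints n l) (∑ i, X i ^ 2) := fun l => by simp [realPoints]
  have h := stein_eval (μ := (volume : Measure (Fin n → ℝ))) (realPoints n) (by fun_prop)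
      norm_sq_le_sum_sq norm_realPoints_sq_le (∑ i, X i ^ 2) hQ P (Pi.single i 1) hα
  have h1 : ∀ s, pderiv s (∑ i : Fin n, X i ^ 2 : MvPolynomial (Fin n) ℂ) = 2 * X s := by
    intro s
    rw [map_sum, Finset.sum_eq_single s]
    · rw [Derivation.leibniz_pow]; simp
    · intro b _ hb
      rw [Derivation.leibniz_pow, pderiv_X_of_ne hb]; simp
    · simp
  have h2 : ∀ s, realPoints n (Pi.single i 1) s = if s = i then 1 else 0 := by
    intro s
    by_cases hs : s = i
    · subst hs; simp [realPoints]
    · simp [realPoints, hs]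
  simp only [h1, h2, ite_mul, one_mul, zero_mul, Finset.sum_ite_eq', Finset.mem_univ, if_true] at h
  simp only [gaussianExpectation, LinearMap.coe_mk, AddHom.coe_mk]
  rw [h]
  have h3 : (∫ l : Fin n → ℝ, eval (realPoints n l) (2 * X i) * eval (realPoints n l) P *
      (Real.exp (-(α * ∑ i, l i ^ 2)) : ℂ)) =
      2 * ∫ l : Fin n → ℝ, eval (realPoints n l) (X i * P) *
        (Real.exp (-(α * ∑ i, l i ^ 2)) : ℂ) := by
    rw [← integral_const_mul]
    congr 1; ext l
    simp only [map_mul, map_ofNat]; ring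
  rw [h3]
  have : (α : ℂ) ≠ 0 := by exact_mod_cast hα.ne'
  push_cast
  field_simp

end EigenvalueEnsemble

/-- A polynomial form of Weyl's integration formula: the mixed moments of two power sums of the
eigenvalues of a GUE matrix are those of the density `c Δ(l)² exp (-n / (2g) ∑ l_i²)`. -/
theorem integral_law_powerSum_mul {n : ℕ} {g : ℝ} (hg : 0 < g) (hn : 0 < n) {c : ℝ}
    (hc : c * ∫ l : Fin n → ℝ,
      vandermondeReal l ^ 2 * Real.exp (-(n / (2 * g) * ∑ i, l i ^ 2)) = 1) (a b : ℕ) :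
    ∫ x, (∑ i, (toMatrix_isHermitian x).eigenvalues i ^ a) *
        (∑ i, (toMatrix_isHermitian x).eigenvalues i ^ b) ∂(law g n) =
      c * ∫ l : Fin n → ℝ, (∑ i, l i ^ a) * (∑ i, l i ^ b) *
        (vandermondeReal l ^ 2 * Real.exp (-(n / (2 * g) * ∑ i, l i ^ 2))) := by
  have hα : 0 < (n : ℝ) / (2 * g) := by positivity
  have hP := isProbabilityMeasure_law (n := n) hg hn
  have L1 := loopEquations_matrix (matrixExpectation hg hn)
    (by simp [matrixExpectation]) (matrixExpectation_stein hg hn)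
  have hv : (((2 * ((n : ℝ) / (2 * g)))⁻¹ : ℝ) : ℂ) = ((g / n : ℝ) : ℂ) := by
    congr 1; field_simp
  have L2 := loopEquations_vandermonde (gaussianExpectation n c hα)
    (by
      simp only [gaussianExpectation, LinearMap.coe_mk, AddHom.coe_mk, map_pow,
        eval_vandermondeProd]
      exact_mod_cast congrArg (Complex.ofReal) hc)
    (fun i P => hv ▸ gaussianExpectation_stein c hα i P)
  -- Both functionals satisfy the loop equations with the same parameters.
  have h := L1.unique L2 [a, b]
  simp only [List.map_cons, List.map_nil, List.prod_cons, List.prod_nil, mul_one,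
    LinearMap.comp_apply, AlgHom.toLinearMap_apply, map_mul, MvPolynomial.aeval_X,
    matrixExpectation, gaussianExpectation, LinearMap.coe_mk, AddHom.coe_mk, eval_genTrace,
    eval_powerSum, trace_pow_eq_sum_eigenvalues, LinearMap.mulRight_apply, map_pow,
    eval_vandermondeProd] at h
  have e1 : ((∫ x, (∑ i, (toMatrix_isHermitian x).eigenvalues i ^ a) *
        (∑ i, (toMatrix_isHermitian x).eigenvalues i ^ b) ∂(law g n) : ℝ) : ℂ) =
      ((c * ∫ l : Fin n → ℝ, (∑ i, l i ^ a) * (∑ i, l i ^ b) *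
        (vandermondeReal l ^ 2 * Real.exp (-(n / (2 * g) * ∑ i, l i ^ 2))) : ℝ) : ℂ) := by
    rw [Complex.ofReal_mul, ← integral_complex_ofReal, ← integral_complex_ofReal]
    push_cast at h ⊢
    rw [h]
    congr 2; ext l; ring
  exact_mod_cast e1

/-! ### Measurability of the eigenvalues -/

section Measurability

variable {n : ℕ}

/-- The eigenvalues of the Hermitian matrix with coordinates `x`. -/
noncomputable abbrev eig (x : Coord n) (i : Fin n) : ℝ := (toMatrix_isHermitian x).eigenvalues i

/-- Power sums of the eigenvalues are traces of powers, hence continuous. -/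
theorem measurable_sum_pow_eig (k : ℕ) : Measurable fun x : Coord n => ∑ i, eig x i ^ k := by
  have h : (fun x : Coord n => ∑ i, eig x i ^ k) = fun x => (toMatrix x ^ k).trace.re := by
    ext x; rw [trace_pow_eq_sum_eigenvalues, Complex.ofReal_re]
  rw [h]
  exact (Complex.continuous_re.comp (continuous_toMatrix_pow_trace k)).measurable

theorem measurable_sum_polynomial_eig (p : Polynomial ℝ) :
    Measurable fun x : Coord n => ∑ i, p.eval (eig x i) := by
  have h : (fun x : Coord n => ∑ i, p.eval (eig x i)) =
      fun x => ∑ k ∈ Finset.range (p.natDegree + 1), p.coeff k * ∑ i, eig x i ^ k := by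
    ext x
    simp only [Polynomial.eval_eq_sum_range, Finset.mul_sum]
    exact Finset.sum_comm
  rw [h]
  exact Finset.measurable_sum _ fun k _ => (measurable_sum_pow_eig k).const_mul _

/-- By the Weierstrass theorem, linear statistics of continuous functions are limits of polynomial
ones. -/
theorem measurable_sum_continuous_eig {f : ℝ → ℝ} (hf : Continuous f) :
    Measurable fun x : Coord n => ∑ i, f (eig x i) := by
  have h : ∀ m : ℕ, ∃ p : Polynomial ℝ, ∀ t ∈ Set.Icc (-m : ℝ) m,
      |p.eval t - f t| < 1 / ((m : ℝ) + 1) := fun m =>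
    exists_polynomial_near_of_continuousOn _ _ f hf.continuousOn _ (by positivity)
  choose p hp using h
  refine measurable_of_tendsto_metrizable (fun m => measurable_sum_polynomial_eig (p m))
    (tendsto_pi_nhds.2 fun x => tendsto_finsetSum _ fun i _ => ?_)
  rw [tendsto_iff_dist_tendsto_zero]
  refine squeeze_zero' (Eventually.of_forall fun _ => dist_nonneg) ?_
    tendsto_one_div_add_atTop_nhds_zero_nat
  obtain ⟨M, hM⟩ := exists_nat_ge |eig x i|
  filter_upwards [eventually_ge_atTop M] with m hm
  rw [Real.dist_eq]
  refine (hp m _ (abs_le.1 (hM.trans ?_))).le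
  exact_mod_cast hm

/-- The number of eigenvalues above `c` is a limit of linear statistics of continuous functions. -/
theorem measurable_card_lt_eig (c : ℝ) :
    Measurable fun x : Coord n => ∑ i, if c < eig x i then (1 : ℝ) else 0 := by
  refine measurable_of_tendsto_metrizable (fun m : ℕ => measurable_sum_continuous_eig (n := n)
    (f := fun t => min 1 (max 0 (m * (t - c)))) (by fun_prop))
    (tendsto_pi_nhds.2 fun x => tendsto_finsetSum _ fun i _ => ?_)
  split_ifs with h
  · have h0 : 0 < eig x i - c := sub_pos.2 h
    obtain ⟨M, hM⟩ := exists_nat_ge (eig x i - c)⁻¹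
    refine tendsto_const_nhds.congr' ?_
    filter_upwards [eventually_ge_atTop M] with m hm
    have h1 : 1 ≤ (m : ℝ) * (eig x i - c) := by
      rw [← inv_mul_cancel₀ h0.ne']
      gcongr
      exact hM.trans (by exact_mod_cast hm)
    rw [max_eq_right (by linarith), min_eq_left h1]
  · refine tendsto_const_nhds.congr fun m => ?_
    have h1 : (m : ℝ) * (eig x i - c) ≤ 0 :=
      mul_nonpos_of_nonneg_of_nonpos (Nat.cast_nonneg m) (by linarith)
    rw [max_eq_left h1, min_eq_right zero_le_one]

/-- The `k`-th largest of finitely many numbers exceeds `c` iff more than `k` of them do. -/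
theorem lt_apply_iff_card_of_antitone {N : ℕ} {e : Fin N → ℝ} (he : Antitone e) (c : ℝ)
    (k : Fin N) : c < e k ↔ (k : ℕ) < (Finset.univ.filter fun j => c < e j).card := by
  constructor
  · intro h
    have h1 : Finset.Iic k ⊆ Finset.univ.filter fun j => c < e j := by
      intro j hj
      simp only [Finset.mem_filter, Finset.mem_univ, true_and]
      exact h.trans_le (he (Finset.mem_Iic.1 hj))
    have h2 := Finset.card_le_card h1
    rw [Fin.card_Iic] at h2
    omega
  · intro h
    by_contra hc
    have h1 : (Finset.univ.filter fun j => c < e j) ⊆ Finset.Iio k := by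
      intro j hj
      simp only [Finset.mem_filter, Finset.mem_univ, true_and] at hj
      rw [Finset.mem_Iio]
      by_contra hjk
      exact hc (hj.trans_le (he (not_lt.1 hjk)))
    have h2 := Finset.card_le_card h1
    rw [Fin.card_Iio] at h2
    omega

/-- The eigenvalues are sorted, so each of them is an order statistic, determined by the numbers of
eigenvalues above the levels `c`. -/
theorem measurable_eig (i : Fin n) : Measurable fun x : Coord n => eig x i := by
  refine measurable_of_Ioi fun c => ?_
  -- `eigenvalues` is the antitone family `eigenvalues₀` reindexed by this bijection.
  set σ := (Fintype.equivOfCardEq (Fintype.card_fin (Fintype.card (Fin n))) :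
    Fin (Fintype.card (Fin n)) ≃ Fin n)
  have h : (fun x : Coord n => eig x i) ⁻¹' Set.Ioi c =
      {x | ((σ.symm i : ℕ) : ℝ) < ∑ j, if c < eig x j then (1 : ℝ) else 0} := by
    ext x
    set hA := toMatrix_isHermitian x
    have h1 := lt_apply_iff_card_of_antitone hA.eigenvalues₀_antitone c (σ.symm i)
    have h2 : (Finset.univ.filter fun j => c < hA.eigenvalues₀ j).card =
        (Finset.univ.filter fun j => c < eig x j).card := by
      refine Finset.card_bij (fun j _ => σ j) ?_ (fun _ _ _ _ h => σ.injective h) ?_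
      · intro j hj
        simp only [Finset.mem_filter, Finset.mem_univ, true_and] at hj ⊢
        change c < hA.eigenvalues₀ (σ.symm (σ j))
        rwa [Equiv.symm_apply_apply]
      · intro j hj
        simp only [Finset.mem_filter, Finset.mem_univ, true_and] at hj
        refine ⟨σ.symm j, ?_, by simp⟩
        simp only [Finset.mem_filter, Finset.mem_univ, true_and]
        exact hj
    have h3 : (∑ j, if c < eig x j then (1 : ℝ) else 0) =
        ((Finset.univ.filter fun j => c < eig x j).card : ℝ) := by
      rw [Finset.sum_boole]
    rw [Set.mem_preimage, Set.mem_Ioi, Set.mem_ofPred_eq, h3, Nat.cast_lt, ← h2, ← h1]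
    rfl
  rw [h]
  exact measurableSet_lt measurable_const (measurable_card_lt_eig c)

theorem count_eq_sum (Δ : Set ℝ) (x : Coord n) :
    count n Δ x = ∑ i, Δ.indicator (fun _ => (1 : ℝ)) (eig x i) := by
  classical
  rw [count]
  simp only [Set.indicator_apply]
  rw [Finset.sum_boole]

theorem measurable_count {Δ : Set ℝ} (hΔ : MeasurableSet Δ) : Measurable (count n Δ) := by
  have : count n Δ = fun x => ∑ i, Δ.indicator (fun _ => (1 : ℝ)) (eig x i) :=
    funext (count_eq_sum Δ)
  rw [this]
  exact Finset.measurable_sum _ fun i _ =>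
    (measurable_const.indicator hΔ).comp (measurable_eig i)

theorem sum_eig_sq (x : Coord n) : ∑ i, eig x i ^ 2 = traceSq x := by
  rw [traceSq, trace_pow_eq_sum_eigenvalues, Complex.ofReal_re]

theorem eig_sq_le (x : Coord n) (i : Fin n) : eig x i ^ 2 ≤ traceSq x := by
  rw [← sum_eig_sq]
  exact Finset.single_le_sum (f := fun i => eig x i ^ 2) (fun _ _ => sq_nonneg _)
    (Finset.mem_univ i)

theorem integrable_exp_eig {g : ℝ} (hg : 0 < g) (hn : 0 < n) (c : ℝ) (i : Fin n) :
    Integrable (fun x => Real.exp (c * |eig x i|)) (law g n) :=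
  (tame_exp_of_sq_le (fun x => eig_sq_le x i) c).integrable_law hg hn
    (Real.measurable_exp.comp ((measurable_eig i).abs.const_mul c)).aestronglyMeasurable

end Measurability

/-! ### Moment determinacy in the plane -/

section Moments

/-- A measure on the plane with exponential moments in both coordinates. -/
def HasExpMoments (μ : Measure (ℝ × ℝ)) : Prop :=
  ∀ c : ℝ, Integrable (fun z => Real.exp (c * |z.1|)) μ ∧
    Integrable (fun z => Real.exp (c * |z.2|)) μ

variable {μ ν : Measure (ℝ × ℝ)}

theorem HasExpMoments.integrable_exp (h : HasExpMoments μ) (s t : ℝ) :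
    Integrable (fun z : ℝ × ℝ => Real.exp (|s| * |z.1| + |t| * |z.2|)) μ := by
  refine ((h (2 * |s|)).1.add (h (2 * |t|)).2).mono'
    (by fun_prop) (ae_of_all _ fun z => ?_)
  rw [Real.norm_of_nonneg (Real.exp_pos _).le, Pi.add_apply, Real.exp_add,
    show 2 * |s| * |z.1| = |s| * |z.1| + |s| * |z.1| by ring,
    show 2 * |t| * |z.2| = |t| * |z.2| + |t| * |z.2| by ring, Real.exp_add, Real.exp_add]
  nlinarith [sq_nonneg (Real.exp (|s| * |z.1|) - Real.exp (|t| * |z.2|)),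
    sq_nonneg (Real.exp (|s| * |z.1|) + Real.exp (|t| * |z.2|))]

theorem HasExpMoments.integrable_monomial (h : HasExpMoments μ) (a b : ℕ) :
    Integrable (fun z : ℝ × ℝ => z.1 ^ a * z.2 ^ b) μ := by
  refine ((h.integrable_exp 1 1).const_mul (a.factorial * b.factorial : ℝ)).mono'
    (by fun_prop) (ae_of_all _ fun z => ?_)
  rw [norm_mul, norm_pow, norm_pow, abs_one, one_mul, one_mul, Real.exp_add, Real.norm_eq_abs,
    Real.norm_eq_abs, mul_mul_mul_comm]
  have h1 : ∀ (u : ℝ) (k : ℕ), |u| ^ k ≤ k.factorial * Real.exp |u| := fun u k => by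
    have := Real.pow_div_factorial_le_exp |u| (abs_nonneg _) k
    rwa [div_le_iff₀ (by positivity), mul_comm] at this
  exact mul_le_mul (h1 _ _) (h1 _ _) (by positivity) (by positivity)

theorem HasExpMoments.integrable_linear_pow (h : HasExpMoments μ) (s t : ℝ) (k : ℕ) :
    Integrable (fun z : ℝ × ℝ => (s * z.1 + t * z.2) ^ k) μ := by
  simp only [add_pow, mul_pow]
  refine integrable_finsetSum _ fun m _ => ?_
  refine ((h.integrable_monomial m (k - m)).const_mul
    (s ^ m * t ^ (k - m) * (k.choose m : ℝ))).congr (ae_of_all _ fun z => ?_)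
  simp only; ring

/-- The characteristic function is the sum of its power series, whose coefficients are moments. -/
theorem HasExpMoments.hasSum_charFun (h : HasExpMoments μ) (s t : ℝ) :
    HasSum (fun k : ℕ => Complex.I ^ k / k.factorial *
        ((∫ z : ℝ × ℝ, (s * z.1 + t * z.2) ^ k ∂μ : ℝ) : ℂ))
      (∫ z : ℝ × ℝ, Complex.exp ((s * z.1 + t * z.2 : ℝ) * Complex.I) ∂μ) := by
  set F : ℕ → ℝ × ℝ → ℂ := fun k z =>
    Complex.I ^ k / k.factorial * (((s * z.1 + t * z.2) ^ k : ℝ) : ℂ) with hF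
  have hint : ∀ k, Integrable (F k) μ := fun k =>
    ((h.integrable_linear_pow s t k).ofReal (𝕜 := ℂ)).const_mul _
  have hnorm : ∀ k z, ‖F k z‖ = |s * z.1 + t * z.2| ^ k / k.factorial := by
    intro k z
    rw [hF, norm_mul, norm_div, norm_pow, Complex.norm_I, one_pow, Complex.norm_natCast,
      Complex.norm_real, norm_pow, Real.norm_eq_abs]
    ring
  have hsum : Summable fun k => ∫ z, ‖F k z‖ ∂μ := by
    refine summable_of_sum_range_le (c := ∫ z : ℝ × ℝ, Real.exp (|s| * |z.1| + |t| * |z.2|) ∂μ)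
      (fun k => integral_nonneg fun _ => norm_nonneg _) fun N => ?_
    rw [← integral_finsetSum _ fun k _ => (hint k).norm]
    refine integral_mono (integrable_finsetSum _ fun k _ => (hint k).norm)
      (h.integrable_exp s t) fun z => ?_
    simp only [hnorm]
    refine (Real.sum_le_exp_of_nonneg (abs_nonneg _) N).trans (Real.exp_le_exp.2 ?_)
    rw [← abs_mul, ← abs_mul]
    exact abs_add_le _ _
  have := hasSum_integral_of_summable_integral_norm hint hsum
  have e1 : ∀ z : ℝ × ℝ, ∑' k, F k z = Complex.exp ((s * z.1 + t * z.2 : ℝ) * Complex.I) := by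
    intro z
    rw [Complex.exp_eq_exp_ℂ, NormedSpace.exp_eq_tsum_div]
    refine tsum_congr fun k => ?_
    rw [hF, mul_pow]; push_cast; ring
  have e2 : ∀ k, ∫ z, F k z ∂μ = Complex.I ^ k / k.factorial *
      ((∫ z : ℝ × ℝ, (s * z.1 + t * z.2) ^ k ∂μ : ℝ) : ℂ) := fun k => by
    rw [← integral_complex_ofReal, ← integral_const_mul]
  simpa only [e1, e2] using this

/-- A measure on the plane with exponential moments is determined by its mixed moments, because they
determine its characteristic function. -/
theorem ext_of_moments [IsFiniteMeasure μ] [IsFiniteMeasure ν] (hμ : HasExpMoments μ)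
    (hν : HasExpMoments ν)
    (h : ∀ a b : ℕ, ∫ z, z.1 ^ a * z.2 ^ b ∂μ = ∫ z, z.1 ^ a * z.2 ^ b ∂ν) : μ = ν := by
  refine Measure.ext_of_charFunDual ?_
  ext L
  obtain ⟨s, t, hL⟩ : ∃ s t : ℝ, ∀ z : ℝ × ℝ, L z = s * z.1 + t * z.2 := by
    refine ⟨L (1, 0), L (0, 1), fun z => ?_⟩
    have : z = z.1 • ((1, 0) : ℝ × ℝ) + z.2 • ((0, 1) : ℝ × ℝ) := by ext <;> simp
    conv_lhs => rw [this, map_add, map_smul, map_smul]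
    simp [mul_comm]
  have hpow : ∀ {μ : Measure (ℝ × ℝ)}, HasExpMoments μ → ∀ (s t : ℝ) (k : ℕ),
      ∫ z : ℝ × ℝ, (s * z.1 + t * z.2) ^ k ∂μ = ∑ m ∈ Finset.range (k + 1),
        (s ^ m * t ^ (k - m) * (k.choose m : ℝ)) * ∫ z, z.1 ^ m * z.2 ^ (k - m) ∂μ := by
    intro μ hμ s t k
    simp only [← integral_const_mul]
    rw [← integral_finsetSum _ fun m _ => (hμ.integrable_monomial m (k - m)).const_mul _]
    congr 1; ext z
    rw [add_pow]
    exact Finset.sum_congr rfl fun m _ => by rw [mul_pow, mul_pow]; ring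
  simp only [charFunDual_apply, hL]
  rw [← (hμ.hasSum_charFun _ _).tsum_eq, ← (hν.hasSum_charFun _ _).tsum_eq]
  refine tsum_congr fun k => ?_
  rw [hpow hμ, hpow hν]
  congr 2
  exact Finset.sum_congr rfl fun m _ => by rw [h]

/-- The joint intensity of pairs of points of a point process `X₁, …, X_n`. -/
noncomputable def pairIntensity {Ω : Type*} [MeasurableSpace Ω] {n : ℕ} (P : Measure Ω)
    (X : Fin n → Ω → ℝ) : Measure (ℝ × ℝ) :=
  ∑ p : Fin n × Fin n, P.map fun ω => (X p.1 ω, X p.2 ω)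

section Pair

variable {Ω : Type*} [MeasurableSpace Ω] {n : ℕ} {P : Measure Ω}
  {X : Fin n → Ω → ℝ}

instance [IsFiniteMeasure P] : IsFiniteMeasure (pairIntensity P X) := by
  unfold pairIntensity; infer_instance

theorem integrable_pairIntensity (hX : ∀ i, Measurable (X i)) {f : ℝ × ℝ → ℝ} (hf : Measurable f)
    (h : ∀ i j, Integrable (fun ω => f (X i ω, X j ω)) P) : Integrable f (pairIntensity P X) := by
  rw [pairIntensity, integrable_finsetSum_measure]
  intro p _
  rw [integrable_map_measure hf.aestronglyMeasurable ((hX _).prodMk (hX _)).aemeasurable]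
  exact h _ _

theorem integral_pairIntensity (hX : ∀ i, Measurable (X i)) {f : ℝ × ℝ → ℝ} (hf : Measurable f)
    (h : ∀ i j, Integrable (fun ω => f (X i ω, X j ω)) P) :
    ∫ z, f z ∂(pairIntensity P X) = ∫ ω, ∑ i, ∑ j, f (X i ω, X j ω) ∂P := by
  have hm : ∀ i j, Measurable fun ω => (X i ω, X j ω) := fun i j => (hX i).prodMk (hX j)
  rw [pairIntensity, integral_finsetSum_measure, Fintype.sum_prod_type, integral_finsetSum]
  · refine Finset.sum_congr rfl fun i _ => ?_
    rw [integral_finsetSum _ fun j _ => h i j]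
    refine Finset.sum_congr rfl fun j _ => ?_
    rw [integral_map (hm i j).aemeasurable hf.aestronglyMeasurable]
  · exact fun i _ => integrable_finsetSum _ fun j _ => h i j
  · intro p _
    rw [integrable_map_measure hf.aestronglyMeasurable (hm _ _).aemeasurable]
    exact h _ _

theorem hasExpMoments_pairIntensity (hX : ∀ i, Measurable (X i))
    (hexp : ∀ c i, Integrable (fun ω => Real.exp (c * |X i ω|)) P) :
    HasExpMoments (pairIntensity P X) := fun c =>
  ⟨integrable_pairIntensity hX (by fun_prop) fun i _ => hexp c i,
    integrable_pairIntensity hX (by fun_prop) fun _ j => hexp c j⟩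

theorem integrable_monomial_pair (hX : ∀ i, Measurable (X i))
    (hexp : ∀ c i, Integrable (fun ω => Real.exp (c * |X i ω|)) P) (a b : ℕ) (i j : Fin n) :
    Integrable (fun ω => X i ω ^ a * X j ω ^ b) P := by
  have hm : Measurable fun ω => (X i ω, X j ω) := (hX i).prodMk (hX j)
  have h : HasExpMoments (P.map fun ω => (X i ω, X j ω)) := fun c =>
    ⟨(integrable_map_measure (by fun_prop) hm.aemeasurable).2 (hexp c i),
      (integrable_map_measure (by fun_prop) hm.aemeasurable).2 (hexp c j)⟩
  exact (integrable_map_measure (by fun_prop) hm.aemeasurable).1 (h.integrable_monomial a b)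

/-- Two point processes with exponential moments whose power sums have the same mixed second
moments have the same second moments of all counting functions. -/
theorem integral_count_mul_eq_of_moments [IsFiniteMeasure P] {Ω' : Type*}
    [MeasurableSpace Ω'] {P' : Measure Ω'} [IsFiniteMeasure P'] {Y : Fin n → Ω' → ℝ}
    (hX : ∀ i, Measurable (X i)) (hY : ∀ i, Measurable (Y i))
    (hXexp : ∀ c i, Integrable (fun ω => Real.exp (c * |X i ω|)) P)
    (hYexp : ∀ c i, Integrable (fun ω => Real.exp (c * |Y i ω|)) P')
    (h : ∀ a b : ℕ, ∫ ω, (∑ i, X i ω ^ a) * (∑ i, X i ω ^ b) ∂P =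
      ∫ ω, (∑ i, Y i ω ^ a) * (∑ i, Y i ω ^ b) ∂P')
    {A B : Set ℝ} (hA : MeasurableSet A) (hB : MeasurableSet B) :
    ∫ ω, (∑ i, A.indicator (fun _ => (1 : ℝ)) (X i ω)) *
        (∑ i, B.indicator (fun _ => (1 : ℝ)) (X i ω)) ∂P =
      ∫ ω, (∑ i, A.indicator (fun _ => (1 : ℝ)) (Y i ω)) *
        (∑ i, B.indicator (fun _ => (1 : ℝ)) (Y i ω)) ∂P' := by
  have heq : pairIntensity P X = pairIntensity P' Y := by
    refine ext_of_moments (hasExpMoments_pairIntensity hX hXexp)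
      (hasExpMoments_pairIntensity hY hYexp) fun a b => ?_
    rw [integral_pairIntensity hX (by fun_prop) fun i j =>
        integrable_monomial_pair hX hXexp a b i j,
      integral_pairIntensity hY (by fun_prop) fun i j =>
        integrable_monomial_pair hY hYexp a b i j]
    simpa only [Finset.sum_mul_sum] using h a b
  set f : ℝ × ℝ → ℝ := fun z =>
    A.indicator (fun _ => (1 : ℝ)) z.1 * B.indicator (fun _ => (1 : ℝ)) z.2 with hf
  have hfm : Measurable f := ((measurable_const.indicator hA).comp measurable_fst).mul
    ((measurable_const.indicator hB).comp measurable_snd)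
  have hfb : ∀ z, ‖f z‖ ≤ 1 := by
    intro z
    by_cases h1 : z.1 ∈ A <;> by_cases h2 : z.2 ∈ B <;> simp [hf, h1, h2]
  have e1 := integral_pairIntensity hX hfm (fun i j =>
    Integrable.of_bound (hfm.comp ((hX i).prodMk (hX j))).aestronglyMeasurable 1
      (ae_of_all P fun _ => hfb _))
  have e2 := integral_pairIntensity hY hfm (fun i j =>
    Integrable.of_bound (hfm.comp ((hY i).prodMk (hY j))).aestronglyMeasurable 1
      (ae_of_all P' fun _ => hfb _))
  rw [heq, e2] at e1
  simpa only [Finset.sum_mul_sum, hf] using e1.symm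

end Pair

end Moments

/-! ### Hermite functions -/

section Hermite

open Polynomial

/-- The (probabilists') Hermite polynomial as a real function. -/
noncomputable def hermiteEval (k : ℕ) (x : ℝ) : ℝ := aeval x (hermite k)

theorem derivative_hermite_succ (k : ℕ) :
    derivative (hermite (k + 1)) = (k + 1 : ℤ[X]) * hermite k := by
  induction k with
  | zero => simp
  | succ k ih =>
    rw [hermite_succ, derivative_sub, derivative_mul, ih, derivative_mul, hermite_succ k]
    simp only [derivative_X, derivative_add, derivative_natCast, derivative_one]
    push_cast; ring

theorem hermiteEval_zero (x : ℝ) : hermiteEval 0 x = 1 := by simp [hermiteEval]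

theorem hermiteEval_succ (k : ℕ) (x : ℝ) :
    hermiteEval (k + 1) x = x * hermiteEval k x - k * hermiteEval (k - 1) x := by
  unfold hermiteEval
  rcases k with _ | k
  · simp
  · rw [hermite_succ, derivative_hermite_succ]
    simp

theorem hasDerivAt_hermiteEval (k : ℕ) (x : ℝ) :
    HasDerivAt (hermiteEval k) (k * hermiteEval (k - 1) x) x := by
  have h := (hermite k).hasDerivAt_aeval x
  refine h.congr_deriv ?_
  rcases k with _ | k
  · simp
  · rw [derivative_hermite_succ]; simp [hermiteEval]

/-- The normalized Hermite functions, an orthonormal system in `L²(ℝ)`: the `k`-th one is a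
polynomial of degree `k` times `exp (-x² / (4v))`. -/
noncomputable def hermiteFun (v : ℝ) (k : ℕ) (x : ℝ) : ℝ :=
  (√(√(2 * Real.pi * v)))⁻¹ * ((√(k.factorial : ℝ))⁻¹ * hermiteEval k (x / √v)) *
    Real.exp (-(x ^ 2 / (4 * v)))

variable {v : ℝ}

theorem sqrt_mul_inv_sqrt_factorial_pred (k : ℕ) :
    √(k : ℝ) * (√((k - 1).factorial : ℝ))⁻¹ = k * (√(k.factorial : ℝ))⁻¹ := by
  rcases k with _ | k
  · simp
  · rw [Nat.add_sub_cancel, Nat.factorial_succ]; push_cast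
    rw [Real.sqrt_mul (by positivity)]
    have h3 : √(k + 1 : ℝ) ≠ 0 := (Real.sqrt_pos.2 (by positivity)).ne'
    have h4 : √(k + 1 : ℝ) * √(k + 1 : ℝ) = k + 1 := Real.mul_self_sqrt (by positivity)
    have h5 : √(k.factorial : ℝ) ≠ 0 := (Real.sqrt_pos.2 (by positivity)).ne'
    field_simp
    rw [pow_two, h4]

/-- The three-term recurrence. For `k = 0` the last term vanishes because of the factor `√0`. -/
theorem hermiteFun_recurrence (hv : 0 < v) (k : ℕ) (x : ℝ) :
    x * hermiteFun v k x =
      √v * (√(k + 1 : ℝ) * hermiteFun v (k + 1) x + √(k : ℝ) * hermiteFun v (k - 1) x) := by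
  have hs : √v ≠ 0 := (Real.sqrt_pos.2 hv).ne'
  have h1 : √(k + 1 : ℝ) * (√((k + 1).factorial : ℝ))⁻¹ = (√(k.factorial : ℝ))⁻¹ := by
    rw [Nat.factorial_succ]; push_cast
    rw [Real.sqrt_mul (by positivity)]
    have : √(k + 1 : ℝ) ≠ 0 := (Real.sqrt_pos.2 (by positivity)).ne'
    field_simp
  have h2 := sqrt_mul_inv_sqrt_factorial_pred k
  have h3 := hermiteEval_succ k (x / √v)
  have h4 : x = √v * (x / √v) := by field_simp
  unfold hermiteFun
  calc _ = √v * ((√(√(2 * Real.pi * v)))⁻¹ * ((√(k.factorial : ℝ))⁻¹ *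
        ((x / √v) * hermiteEval k (x / √v))) * Real.exp (-(x ^ 2 / (4 * v)))) := by
        rw [show ∀ c a H E : ℝ, √v * (c * (a * (x / √v * H)) * E) =
          (√v * (x / √v)) * (c * (a * H) * E) by intros; ring, ← h4]
    _ = _ := by
        rw [show (x / √v) * hermiteEval k (x / √v) = hermiteEval (k + 1) (x / √v) +
          k * hermiteEval (k - 1) (x / √v) by rw [h3]; ring, mul_add ((√(k.factorial : ℝ))⁻¹),
          ← mul_assoc ((√(k.factorial : ℝ))⁻¹) (k : ℝ), mul_comm ((√(k.factorial : ℝ))⁻¹) (k : ℝ),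
          ← h2]
        nth_rewrite 1 [← h1]
        ring

/-- The lowering relation. -/
theorem hasDerivAt_hermiteFun (hv : 0 < v) (k : ℕ) (x : ℝ) :
    HasDerivAt (hermiteFun v k)
      (√(k : ℝ) / √v * hermiteFun v (k - 1) x - x / (2 * v) * hermiteFun v k x) x := by
  have hs : √v ≠ 0 := (Real.sqrt_pos.2 hv).ne'
  have h2 := sqrt_mul_inv_sqrt_factorial_pred k
  have e0 : HasDerivAt (fun x : ℝ => x / √v) (1 / √v) x := (hasDerivAt_id x).div_const _
  have e1 : HasDerivAt (fun x => hermiteEval k (x / √v))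
      (k * hermiteEval (k - 1) (x / √v) * (1 / √v)) x :=
    HasDerivAt.comp x (h₂ := hermiteEval k) (hasDerivAt_hermiteEval k (x / √v)) e0
  have e2 : HasDerivAt (fun x : ℝ => Real.exp (-(x ^ 2 / (4 * v))))
      (Real.exp (-(x ^ 2 / (4 * v))) * -(2 * x / (4 * v))) x := by
    have := (((hasDerivAt_pow 2 x).div_const (4 * v)).fun_neg).exp
    simpa using this
  have e3 := ((e1.const_mul ((√(k.factorial : ℝ))⁻¹)).const_mul ((√(√(2 * Real.pi * v)))⁻¹)).mul e2
  refine e3.congr_deriv ?_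
  unfold hermiteFun
  have h3 : √(k : ℝ) / √v * ((√(√(2 * Real.pi * v)))⁻¹ * ((√((k - 1).factorial : ℝ))⁻¹ *
      hermiteEval (k - 1) (x / √v)) * Real.exp (-(x ^ 2 / (4 * v)))) =
      (√(√(2 * Real.pi * v)))⁻¹ * ((√(k : ℝ) * (√((k - 1).factorial : ℝ))⁻¹) *
      hermiteEval (k - 1) (x / √v)) * Real.exp (-(x ^ 2 / (4 * v))) / √v := by ring
  rw [h3, h2]
  field_simp
  ring

/-- The raising relation. -/
theorem hasDerivAt_hermiteFun' (hv : 0 < v) (k : ℕ) (x : ℝ) :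
    HasDerivAt (hermiteFun v k)
      (x / (2 * v) * hermiteFun v k x - √(k + 1 : ℝ) / √v * hermiteFun v (k + 1) x) x := by
  refine (hasDerivAt_hermiteFun hv k x).congr_deriv ?_
  have h := hermiteFun_recurrence hv k x
  have hs : √v ≠ 0 := (Real.sqrt_pos.2 hv).ne'
  have h2 : √v * √v = v := Real.mul_self_sqrt hv.le
  have h3 : x / v * hermiteFun v k x = (√(k + 1 : ℝ) * hermiteFun v (k + 1) x +
      √(k : ℝ) * hermiteFun v (k - 1) x) / √v := by
    rw [div_mul_eq_mul_div, h, div_eq_div_iff hv.ne' hs]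
    linear_combination (√(k + 1 : ℝ) * hermiteFun v (k + 1) x +
      √(k : ℝ) * hermiteFun v (k - 1) x) * h2
  have h4 : x / v * hermiteFun v k x =
      x / (2 * v) * hermiteFun v k x + x / (2 * v) * hermiteFun v k x := by
    field_simp; ring
  have h5 : x / (2 * v) * hermiteFun v k x + x / (2 * v) * hermiteFun v k x =
      √(k + 1 : ℝ) / √v * hermiteFun v (k + 1) x + √(k : ℝ) / √v * hermiteFun v (k - 1) x := by
    rw [← h4, h3]; ring
  linarith

theorem continuous_hermiteFun (hv : 0 < v) (k : ℕ) : Continuous (hermiteFun v k) :=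
  continuous_iff_continuousAt.2 fun x => (hasDerivAt_hermiteFun hv k x).continuousAt

theorem tame_polynomial (p : ℝ[X]) : Tame (fun x : ℝ => x ^ 2) (fun x => p.eval x) := by
  have hX : Tame (fun x : ℝ => x ^ 2) (fun x : ℝ => x) :=
    tame_of_sq_le (fun x => by simp)
  have hC : ∀ a : ℝ, Tame (fun x : ℝ => x ^ 2) (fun _ => a) := Tame.const fun x => sq_nonneg x
  induction p using Polynomial.induction_on with
  | C a => simpa using hC a
  | add p q hp hq => simpa using hp.add hq
  | monomial k a h => simpa [pow_succ, mul_assoc] using h.mul hX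

theorem integrable_polynomial_mul_exp (p : ℝ[X]) {β : ℝ} (hβ : 0 < β) :
    Integrable fun x : ℝ => p.eval x * Real.exp (-(β * x ^ 2)) :=
  (tame_polynomial p).integrable (𝕜 := ℝ) (by fun_prop) (fun x => by simp)
    p.continuous.aestronglyMeasurable hβ

theorem exists_polynomial_hermiteFun (v : ℝ) (k : ℕ) :
    ∃ p : ℝ[X], ∀ x, hermiteFun v k x = p.eval x * Real.exp (-(x ^ 2 / (4 * v))) := by
  refine ⟨C ((√(√(2 * Real.pi * v)))⁻¹ * (√(k.factorial : ℝ))⁻¹) *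
    ((hermite k).map (Int.castRingHom ℝ)).comp (C (√v)⁻¹ * X), fun x => ?_⟩
  rw [hermiteFun, hermiteEval]
  simp only [eval_mul, eval_C, eval_comp, eval_X, eval_map, aeval_def]
  rw [div_eq_inv_mul]
  simp only [algebraMap_int_eq]
  ring

theorem integrable_polynomial_mul_hermiteFun (hv : 0 < v) (p : ℝ[X]) (j k : ℕ) :
    Integrable fun x => p.eval x * (hermiteFun v j x * hermiteFun v k x) := by
  obtain ⟨q, hq⟩ := exists_polynomial_hermiteFun v j
  obtain ⟨r, hr⟩ := exists_polynomial_hermiteFun v k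
  refine (integrable_polynomial_mul_exp (p * (q * r)) (β := 1 / (2 * v)) (by positivity)).congr
    (ae_of_all _ fun x => ?_)
  simp only [hq, hr, eval_mul]
  have : Real.exp (-(1 / (2 * v) * x ^ 2)) =
      Real.exp (-(x ^ 2 / (4 * v))) * Real.exp (-(x ^ 2 / (4 * v))) := by
    rw [← Real.exp_add]; congr 1; field_simp; ring
  rw [this]; ring

theorem integrable_hermiteFun_mul (hv : 0 < v) (j k : ℕ) :
    Integrable fun x => hermiteFun v j x * hermiteFun v k x := by
  simpa using integrable_polynomial_mul_hermiteFun hv 1 j k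

theorem integrable_pow_mul_hermiteFun (hv : 0 < v) (m j k : ℕ) :
    Integrable fun x => x ^ m * (hermiteFun v j x * hermiteFun v k x) := by
  simpa using integrable_polynomial_mul_hermiteFun hv (X ^ m) j k

/-- The integral of the derivative of `φ_j φ_k` vanishes, expressed through the lowering and raising
relations. -/
theorem integral_hermiteFun_step (hv : 0 < v) (j k : ℕ) :
    √(k + 1 : ℝ) * ∫ x, hermiteFun v j x * hermiteFun v (k + 1) x =
      √(j : ℝ) * ∫ x, hermiteFun v (j - 1) x * hermiteFun v k x := by
  have hs : √v ≠ 0 := (Real.sqrt_pos.2 hv).ne'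
  have hd : ∀ x, HasDerivAt (fun x => hermiteFun v j x * hermiteFun v k x)
      ((√v)⁻¹ * (√(j : ℝ) * (hermiteFun v (j - 1) x * hermiteFun v k x) -
        √(k + 1 : ℝ) * (hermiteFun v j x * hermiteFun v (k + 1) x))) x := fun x =>
    ((hasDerivAt_hermiteFun hv j x).mul (hasDerivAt_hermiteFun' hv k x)).congr_deriv (by ring)
  have i1 := (integrable_hermiteFun_mul hv (j - 1) k).const_mul √(j : ℝ)
  have i2 := (integrable_hermiteFun_mul hv j (k + 1)).const_mul √(k + 1 : ℝ)
  have h := integral_eq_zero_of_hasDerivAt_of_integrable hd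
    ((i1.sub i2).const_mul _) (integrable_hermiteFun_mul hv j k)
  rw [integral_const_mul, integral_sub i1 i2, integral_const_mul, integral_const_mul] at h
  have := (mul_eq_zero.1 h).resolve_left (inv_ne_zero hs)
  linarith

theorem integral_hermiteFun_zero (hv : 0 < v) :
    ∫ x, hermiteFun v 0 x * hermiteFun v 0 x = 1 := by
  have h1 : ∀ x, hermiteFun v 0 x * hermiteFun v 0 x =
      (√(2 * Real.pi * v))⁻¹ * Real.exp (-(1 / (2 * v)) * x ^ 2) := by
    intro x
    have : Real.exp (-(1 / (2 * v)) * x ^ 2) =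
        Real.exp (-(x ^ 2 / (4 * v))) * Real.exp (-(x ^ 2 / (4 * v))) := by
      rw [← Real.exp_add]; congr 1; field_simp; ring
    rw [this, hermiteFun, hermiteEval_zero]
    have h2 : (√(√(2 * Real.pi * v)))⁻¹ * (√(√(2 * Real.pi * v)))⁻¹ = (√(2 * Real.pi * v))⁻¹ := by
      rw [← mul_inv, Real.mul_self_sqrt (Real.sqrt_nonneg _)]
    rw [← h2]; simp; ring
  simp only [h1]
  rw [integral_const_mul, integral_gaussian, show Real.pi / (1 / (2 * v)) = 2 * Real.pi * v by
    field_simp]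
  exact inv_mul_cancel₀ (Real.sqrt_pos.2 (by positivity)).ne'

/-- The Hermite functions are orthonormal. -/
theorem integral_hermiteFun_mul (hv : 0 < v) (j k : ℕ) :
    ∫ x, hermiteFun v j x * hermiteFun v k x = if j = k then 1 else 0 := by
  have hpos : ∀ k : ℕ, √(k + 1 : ℝ) ≠ 0 := fun k => (Real.sqrt_pos.2 (by positivity)).ne'
  induction k generalizing j with
  | zero =>
    rcases j with _ | j
    · simpa using integral_hermiteFun_zero hv
    · have h := integral_hermiteFun_step hv 0 j
      simp only [Nat.cast_zero, Real.sqrt_zero, zero_mul] at h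
      have h2 := (mul_eq_zero.1 h).resolve_left (hpos j)
      simp only [mul_comm (hermiteFun v 0 _)] at h2
      simpa using h2
  | succ k ih =>
    have h := integral_hermiteFun_step hv j k
    apply mul_left_cancel₀ (hpos k)
    rw [h, ih]
    rcases j with _ | j
    · simp
    · by_cases hjk : j = k
      · subst hjk; simp
      · simp [hjk]

/-- The Christoffel–Darboux kernel, the projection kernel onto the first `n` Hermite functions. -/
noncomputable def cdKernel (v : ℝ) (n : ℕ) (x y : ℝ) : ℝ :=
  ∑ k ∈ Finset.range n, hermiteFun v k x * hermiteFun v k y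

/-- The Christoffel–Darboux formula. -/
theorem cdKernel_mul_sub (hv : 0 < v) (n : ℕ) (x y : ℝ) :
    (x - y) * cdKernel v n x y = √v * √(n : ℝ) *
      (hermiteFun v n x * hermiteFun v (n - 1) y - hermiteFun v (n - 1) x * hermiteFun v n y) := by
  induction n with
  | zero => simp [cdKernel]
  | succ n ih =>
    have h1 := hermiteFun_recurrence hv n x
    have h2 := hermiteFun_recurrence hv n y
    rw [cdKernel, Finset.sum_range_succ, mul_add, ← cdKernel, ih, Nat.add_sub_cancel]
    push_cast
    linear_combination hermiteFun v n y * h1 - hermiteFun v n x * h2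

/-- The Christoffel–Darboux kernel on the diagonal. -/
theorem cdKernel_self (hv : 0 < v) (n : ℕ) (x : ℝ) :
    cdKernel v n x x = n * (hermiteFun v (n - 1) x ^ 2 + hermiteFun v n x ^ 2) -
      x / √v * √(n : ℝ) * (hermiteFun v n x * hermiteFun v (n - 1) x) := by
  have hs : √v ≠ 0 := (Real.sqrt_pos.2 hv).ne'
  induction n with
  | zero => simp [cdKernel]
  | succ n ih =>
    have h1 : √(n + 1 : ℝ) * hermiteFun v (n + 1) x =
        x / √v * hermiteFun v n x - √(n : ℝ) * hermiteFun v (n - 1) x := by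
      have := hermiteFun_recurrence hv n x
      field_simp
      linarith
    have h2 : √(n + 1 : ℝ) ^ 2 = n + 1 := Real.sq_sqrt (by positivity)
    have h3 : √(n : ℝ) ^ 2 = n := Real.sq_sqrt (by positivity)
    rw [cdKernel, Finset.sum_range_succ, ← cdKernel, ih, Nat.add_sub_cancel]
    push_cast
    set u := hermiteFun v n x
    set w := hermiteFun v (n - 1) x
    set z := hermiteFun v (n + 1) x
    set s := x / √v
    have e1 : ((n : ℝ) + 1) * (u ^ 2 + z ^ 2) - s * √(n + 1 : ℝ) * (z * u) =
        (n + 1) * u ^ 2 + (√(n + 1 : ℝ) * z) ^ 2 - s * u * (√(n + 1 : ℝ) * z) := by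
      rw [mul_pow, h2]; ring
    have e2 : (n : ℝ) * (w ^ 2 + u ^ 2) - s * √(n : ℝ) * (u * w) =
        n * u ^ 2 + (√(n : ℝ) * w) ^ 2 - s * u * (√(n : ℝ) * w) := by
      rw [mul_pow, h3]; ring
    rw [e1, e2, h1]; ring

theorem cdKernel_comm (v : ℝ) (n : ℕ) (x y : ℝ) : cdKernel v n x y = cdKernel v n y x :=
  Finset.sum_congr rfl fun _ _ => mul_comm _ _

end Hermite

/-! ### The determinantal structure of the eigenvalues -/

section Determinant

variable {n : ℕ}

/-- A permutation that fixes everything off `{a, b}` is the identity or the transposition of `a` and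
`b`. -/
theorem perm_eq_one_or_swap {ι : Type*} [DecidableEq ι] {a b : ι} {τ : Equiv.Perm ι}
    (h : ∀ i, i ≠ a → i ≠ b → τ i = i) : τ = 1 ∨ τ = Equiv.swap a b := by
  have key : ∀ i, i = a ∨ i = b → τ i = a ∨ τ i = b := by
    intro i hi
    by_contra hc
    rw [not_or] at hc
    have := τ.injective (h (τ i) hc.1 hc.2)
    rw [this] at hc
    tauto
  rcases eq_or_ne a b with rfl | hab
  · left
    ext i
    by_cases hi : i = a
    · subst hi; simpa using key i (Or.inl rfl)
    · simpa using h i hi hi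
  rcases key a (Or.inl rfl) with ha | ha
  · left
    ext i
    by_cases hi : i = a
    · subst hi; simpa using ha
    by_cases hi' : i = b
    · subst hi'
      rcases key i (Or.inr rfl) with hb | hb
      · exact absurd (τ.injective (hb.trans ha.symm)) (Ne.symm hab)
      · simpa using hb
    · simpa using h i hi hi'
  · right
    ext i
    by_cases hi : i = a
    · subst hi; simpa using ha
    by_cases hi' : i = b
    · subst hi'
      rcases key i (Or.inr rfl) with hb | hb
      · simpa using hb
      · exact absurd (τ.injective (hb.trans ha.symm)) (Ne.symm hab)
    · rw [h i hi hi', Equiv.swap_apply_of_ne_of_ne hi hi']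

/-- The determinant of a matrix whose rows off `{a, b}` are those of the identity. -/
theorem det_of_two_rows {ι : Type*} [Fintype ι] [DecidableEq ι] (G : Matrix ι ι ℝ) {a b : ι}
    (hab : a ≠ b) (hG : ∀ i j, i ≠ a → i ≠ b → G i j = if i = j then 1 else 0) :
    G.det = G a a * G b b - G a b * G b a := by
  rw [← Matrix.det_transpose, Matrix.det_apply']
  rw [← Finset.sum_subset (Finset.subset_univ {1, Equiv.swap a b})]
  · have hne : (1 : Equiv.Perm ι) ≠ Equiv.swap a b := by
      intro h
      have := congrArg (fun τ => τ a) h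
      simp at this
      exact hab this
    rw [Finset.sum_pair hne, Finset.prod_eq_mul a b hab, Finset.prod_eq_mul a b hab]
    · simp [Equiv.Perm.sign_swap hab]; ring
    · rintro c _ ⟨h1, h2⟩
      simp [Matrix.transpose_apply, Equiv.swap_apply_of_ne_of_ne h1 h2, hG c c h1 h2]
    · simp
    · simp
    · rintro c _ ⟨h1, h2⟩
      simp [Matrix.transpose_apply, hG c c h1 h2]
    · simp
    · simp
  · intro τ _ hτ
    have : ¬ ∀ i, i ≠ a → i ≠ b → τ i = i := by
      intro h
      rcases perm_eq_one_or_swap h with rfl | rfl <;> simp at hτ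
    push Not at this
    obtain ⟨i, h1, h2, h3⟩ := this
    rw [Finset.prod_eq_zero (Finset.mem_univ i), mul_zero]
    rw [Matrix.transpose_apply, hG _ _ h1 h2, if_neg (Ne.symm h3)]

/-- The determinant of a matrix whose rows except the row `a` are those of the identity. -/
theorem det_of_one_row {ι : Type*} [Fintype ι] [DecidableEq ι] (G : Matrix ι ι ℝ) (a : ι)
    (hG : ∀ i j, i ≠ a → G i j = if i = j then 1 else 0) : G.det = G a a := by
  rw [← Matrix.det_transpose, Matrix.det_apply']
  rw [Finset.sum_eq_single 1]
  · rw [Finset.prod_eq_single a]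
    · simp
    · intro c _ hc
      simp [Matrix.transpose_apply, hG c c hc]
    · simp
  · intro τ _ hτ
    have : ¬ ∀ i, i ≠ a → i ≠ a → τ i = i := by
      intro h
      rcases perm_eq_one_or_swap h with rfl | rfl <;> simp [Equiv.Perm.one_def] at hτ
    push Not at this
    obtain ⟨i, h1, _, h3⟩ := this
    rw [Finset.prod_eq_zero (Finset.mem_univ i), mul_zero]
    rw [Matrix.transpose_apply, hG _ _ h1, if_neg (Ne.symm h3)]
  · simp

/-- The Slater determinant `det (φ_j (l_i))` of functions `φ_j`. -/
noncomputable def slater (φ : Fin n → ℝ → ℝ) (l : Fin n → ℝ) : ℝ :=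
  (Matrix.of fun i j => φ j (l i)).det

theorem slater_comp_perm (φ : Fin n → ℝ → ℝ) (σ : Equiv.Perm (Fin n)) (l : Fin n → ℝ) :
    slater φ (fun i => l (σ i)) = Equiv.Perm.sign σ * slater φ l :=
  Matrix.det_permute σ (Matrix.of fun i j => φ j (l i))

theorem slater_eq_sum (φ : Fin n → ℝ → ℝ) (l : Fin n → ℝ) :
    slater φ l = ∑ τ : Equiv.Perm (Fin n), (Equiv.Perm.sign τ : ℝ) * ∏ i, φ (τ i) (l i) := by
  rw [slater, ← Matrix.det_transpose, Matrix.det_apply']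
  rfl

theorem slater_eq_sum' (φ : Fin n → ℝ → ℝ) (l : Fin n → ℝ) :
    slater φ l = ∑ τ : Equiv.Perm (Fin n), (Equiv.Perm.sign τ : ℝ) * ∏ i, φ i (l (τ i)) := by
  rw [slater, Matrix.det_apply']
  rfl

theorem integral_comp_perm (σ : Equiv.Perm (Fin n)) (F : (Fin n → ℝ) → ℝ) :
    ∫ l : Fin n → ℝ, F (fun i => l (σ i)) = ∫ l, F l := by
  have h := volume_measurePreserving_piCongrLeft (fun _ : Fin n => ℝ) σ.symm
  have e : ∀ l : Fin n → ℝ, MeasurableEquiv.piCongrLeft (fun _ : Fin n => ℝ) σ.symm l =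
      fun i => l (σ i) := by
    intro l; ext i
    have := MeasurableEquiv.piCongrLeft_apply_apply (β := fun _ : Fin n => ℝ) σ.symm l (σ i)
    simpa using this
  rw [← h.integral_comp' F]
  simp only [e]

theorem integrable_comp_perm (σ : Equiv.Perm (Fin n)) {F : (Fin n → ℝ) → ℝ} (hF : Integrable F) :
    Integrable fun l : Fin n → ℝ => F (fun i => l (σ i)) := by
  have h := volume_measurePreserving_piCongrLeft (fun _ : Fin n => ℝ) σ.symm
  have e : ∀ l : Fin n → ℝ, MeasurableEquiv.piCongrLeft (fun _ : Fin n => ℝ) σ.symm l =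
      fun i => l (σ i) := by
    intro l; ext i
    have := MeasurableEquiv.piCongrLeft_apply_apply (β := fun _ : Fin n => ℝ) σ.symm l (σ i)
    simpa using this
  have := (h.integrable_comp_emb (MeasurableEquiv.measurableEmbedding _)).2 hF
  simpa only [Function.comp_def, e] using this

section Orthonormal

variable {φ : Fin n → ℝ → ℝ}

/-- Expanding one Slater determinant in an integral of a product of one-variable functions. -/
theorem integral_prod_mul_slater
    {F : Fin n → ℝ → ℝ} (hF : ∀ i j k, Integrable fun x => φ i x * φ j x * F k x) :
    Integrable (fun l : Fin n → ℝ => (∏ i, φ i (l i)) * slater φ l * ∏ i, F i (l i)) ∧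
    ∫ l : Fin n → ℝ, (∏ i, φ i (l i)) * slater φ l * ∏ i, F i (l i) =
      (Matrix.of fun i j => ∫ x, φ i x * φ j x * F i x).det := by
  have e : ∀ l : Fin n → ℝ, (∏ i, φ i (l i)) * slater φ l * ∏ i, F i (l i) =
      ∑ τ : Equiv.Perm (Fin n), (Equiv.Perm.sign τ : ℝ) *
        ∏ i, (φ i (l i) * φ (τ i) (l i) * F i (l i)) := by
    intro l
    rw [slater_eq_sum, Finset.mul_sum, Finset.sum_mul]
    refine Finset.sum_congr rfl fun τ _ => ?_
    rw [Finset.prod_mul_distrib, Finset.prod_mul_distrib]; ring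
  have hi : ∀ τ : Equiv.Perm (Fin n), Integrable fun l : Fin n → ℝ =>
      ∏ i, (φ i (l i) * φ (τ i) (l i) * F i (l i)) := fun τ =>
    Integrable.fintype_prod (f := fun i x => φ i x * φ (τ i) x * F i x) fun i => hF i (τ i) i
  simp only [e]
  refine ⟨integrable_finsetSum _ fun τ _ => (hi τ).const_mul _, ?_⟩
  rw [integral_finsetSum _ fun τ _ => (hi τ).const_mul _, ← Matrix.det_transpose,
    Matrix.det_apply']
  refine Finset.sum_congr rfl fun τ _ => ?_
  rw [integral_const_mul]
  congr 1
  exact integral_fintype_prod_volume_eq_prod (fun i x => φ i x * φ (τ i) x * F i x)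

/-- Integrals of symmetric functions against the square of a Slater determinant: all `n!` terms in
the expansion of one of the two factors contribute the same. -/
theorem integral_slater_sq {F : (Fin n → ℝ) → ℝ} (hsymm : ∀ (σ : Equiv.Perm (Fin n)) l,
      F (fun i => l (σ i)) = F l)
    (hF : Integrable fun l : Fin n → ℝ => (∏ i, φ i (l i)) * slater φ l * F l) :
    Integrable (fun l => slater φ l ^ 2 * F l) ∧
    ∫ l, slater φ l ^ 2 * F l =
      n.factorial * ∫ l : Fin n → ℝ, (∏ i, φ i (l i)) * slater φ l * F l := by
  set H : (Fin n → ℝ) → ℝ := fun l => (∏ i, φ i (l i)) * slater φ l * F l with hH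
  have e : ∀ l : Fin n → ℝ, slater φ l ^ 2 * F l =
      ∑ σ : Equiv.Perm (Fin n), H (fun i => l (σ i)) := by
    intro l
    have : slater φ l ^ 2 * F l = slater φ l * (slater φ l * F l) := by ring
    rw [this]
    nth_rewrite 1 [slater_eq_sum']
    rw [Finset.sum_mul]
    refine Finset.sum_congr rfl fun σ _ => ?_
    simp only [hH]
    rw [slater_comp_perm, hsymm]; ring
  simp only [e]
  refine ⟨integrable_finsetSum _ fun σ _ => integrable_comp_perm σ hF, ?_⟩
  rw [integral_finsetSum _ fun σ _ => integrable_comp_perm σ hF]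
  simp only [integral_comp_perm, Finset.sum_const, Finset.card_univ, Fintype.card_perm,
    Fintype.card_fin, nsmul_eq_mul]

/-- The second moment formula of a determinantal process. Only the determinants of matrices that
differ from the identity in at most two rows enter, by orthonormality. -/
theorem integral_slater_sq_sum_mul_sum
    (hφi : ∀ i j, Integrable fun x => φ i x * φ j x)
    (hφ : ∀ i j, ∫ x, φ i x * φ j x = if i = j then 1 else 0)
    {f h : ℝ → ℝ} (hf : Measurable f) (hh : Measurable h) (hfb : ∀ x, ‖f x‖ ≤ 1)
    (hhb : ∀ x, ‖h x‖ ≤ 1) :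
    Integrable (fun l => slater φ l ^ 2 * ((∑ i, f (l i)) * ∑ i, h (l i))) ∧
    ∫ l, slater φ l ^ 2 * ((∑ i, f (l i)) * ∑ i, h (l i)) =
      n.factorial * ((∑ i, ∫ x, φ i x * φ i x * (f x * h x)) +
        ((∑ i, ∫ x, φ i x * φ i x * f x) * (∑ i, ∫ x, φ i x * φ i x * h x) -
          ∑ i, ∑ j, (∫ x, φ i x * φ j x * f x) * ∫ x, φ i x * φ j x * h x)) := by
  -- The product over `i` of `F a b i (l i)` is `f (l a) * h (l b)`, also for `a = b`.
  set F : Fin n → Fin n → Fin n → ℝ → ℝ := fun a b i x =>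
    (if i = a then f x else 1) * (if i = b then h x else 1) with hFdef
  have hFm : ∀ a b i, Measurable (F a b i) := by
    intro a b i
    refine Measurable.mul ?_ ?_ <;> split_ifs <;> first | assumption | exact measurable_const
  have hFb : ∀ a b i x, ‖F a b i x‖ ≤ 1 := by
    intro a b i x
    rw [hFdef, norm_mul]
    have h1 : ‖if i = a then f x else 1‖ ≤ 1 := by split_ifs <;> simp_all
    have h2 : ‖if i = b then h x else 1‖ ≤ 1 := by split_ifs <;> simp_all
    exact mul_le_one₀ h1 (norm_nonneg _) h2
  have hFi : ∀ a b i j k, Integrable fun x => φ i x * φ j x * F a b k x := fun a b i j k =>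
    (hφi i j).mul_bdd (c := 1) (hFm a b k).aestronglyMeasurable (ae_of_all _ (hFb a b k))
  have hprod : ∀ a b (l : Fin n → ℝ), ∏ i, F a b i (l i) = f (l a) * h (l b) := by
    intro a b l
    simp only [hFdef, Finset.prod_mul_distrib, Finset.prod_ite_eq', Finset.mem_univ, if_true]
  have hint : ∀ a b, Integrable (fun l : Fin n → ℝ =>
      (∏ i, φ i (l i)) * slater φ l * (f (l a) * h (l b))) := fun a b => by
    have := (integral_prod_mul_slater (hFi a b)).1
    simpa only [hprod] using this
  -- the determinant attached to the pair of particles `a`, `b`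
  have hval : ∀ a b, ∫ l : Fin n → ℝ, (∏ i, φ i (l i)) * slater φ l * (f (l a) * h (l b)) =
      (if a = b then ∫ x, φ a x * φ a x * (f x * h x) else 0) +
        ((∫ x, φ a x * φ a x * f x) * (∫ x, φ b x * φ b x * h x) -
          (∫ x, φ a x * φ b x * f x) * ∫ x, φ a x * φ b x * h x) := by
    intro a b
    have h1 := (integral_prod_mul_slater (hFi a b)).2
    simp only [hprod] at h1
    rw [h1]
    rcases eq_or_ne a b with rfl | hab
    · rw [det_of_one_row _ a]
      · simp [hFdef]
      · intro i j hi
        simp [hFdef, hi, hφ]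
    · rw [det_of_two_rows _ hab]
      · simp only [hFdef, Matrix.of_apply, if_neg hab, if_neg (Ne.symm hab), if_true, mul_one,
          one_mul, mul_comm (φ b _) (φ a _)]
        ring
      · intro i j hi hi'
        simp [hFdef, hi, hi', hφ]
  have hsum : ∀ l : Fin n → ℝ, (∏ i, φ i (l i)) * slater φ l *
      ((∑ i, f (l i)) * ∑ i, h (l i)) =
      ∑ a, ∑ b, (∏ i, φ i (l i)) * slater φ l * (f (l a) * h (l b)) := by
    intro l
    rw [Finset.sum_mul_sum, Finset.mul_sum]
    simp only [Finset.mul_sum]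
  have hI : Integrable (fun l : Fin n → ℝ => (∏ i, φ i (l i)) * slater φ l *
      ((∑ i, f (l i)) * ∑ i, h (l i))) := by
    simp only [hsum]
    exact integrable_finsetSum _ fun a _ => integrable_finsetSum _ fun b _ => hint a b
  obtain ⟨h1, h2⟩ := integral_slater_sq (F := fun l => (∑ i, f (l i)) * ∑ i, h (l i))
    (fun σ l => by
      simp only
      rw [Equiv.sum_comp σ fun i => f (l i), Equiv.sum_comp σ fun i => h (l i)]) hI
  refine ⟨h1, h2.trans ?_⟩
  congr 1
  simp only [hsum]
  rw [integral_finsetSum _ fun a _ => integrable_finsetSum _ fun b _ => hint a b]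
  simp only [integral_finsetSum _ fun b _ => hint _ b, hval, Finset.sum_add_distrib,
    Finset.sum_sub_distrib, Finset.sum_ite_eq, Finset.mem_univ, if_true, ← Finset.sum_mul_sum]

end Orthonormal

end Determinant

/-! ### The covariance of counting functions through the Christoffel–Darboux kernel -/

section Covariance

open Polynomial

variable {n : ℕ} {v : ℝ}

/-- Up to a constant, the Slater determinant of the Hermite functions is the Vandermonde product
times a Gaussian. -/
theorem exists_slater_hermiteFun (v : ℝ) (n : ℕ) : ∃ C : ℝ, ∀ l : Fin n → ℝ,
    slater (fun j => hermiteFun v j) l =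
      C * vandermondeReal l * Real.exp (-(∑ i, l i ^ 2 / (4 * v))) := by
  set c : ℕ → ℝ := fun k => (√(√(2 * Real.pi * v)))⁻¹ * (√(k.factorial : ℝ))⁻¹ with hc
  refine ⟨(∏ j : Fin n, c j) * ∏ i : Fin n, ∏ _j ∈ Finset.Ioi i, (√v)⁻¹, fun l => ?_⟩
  have h1 : (Matrix.of fun i j : Fin n => hermiteFun v j (l i)) =
      Matrix.of fun i j : Fin n => c j * (Matrix.of fun i j : Fin n =>
        Real.exp (-(l i ^ 2 / (4 * v))) * (Matrix.of fun i j : Fin n =>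
          ((hermite j).map (Int.castRingHom ℝ)).eval (l i / √v)) i j) i j := by
    ext i j
    simp only [Matrix.of_apply, hermiteFun, hermiteEval, hc, aeval_def, eval_map,
      algebraMap_int_eq]
    ring
  have h2 : (Matrix.of fun i j : Fin n =>
      ((hermite j).map (Int.castRingHom ℝ)).eval (l i / √v)).det =
      ∏ i : Fin n, ∏ j ∈ Finset.Ioi i, (l j / √v - l i / √v) := by
    rw [← Matrix.det_vandermonde]
    refine (Matrix.det_eval_matrixOfPolynomials_eq_det_vandermonde _ _ (fun i => ?_)
      fun i => ?_).symm
    · rw [(hermite_monic _).natDegree_map, natDegree_hermite]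
    · exact (hermite_monic _).map _
  rw [slater, h1, Matrix.det_mul_row, Matrix.det_mul_column, h2, vandermondeReal,
    ← Real.exp_sum, Finset.sum_neg_distrib]
  have h3 : ∏ i : Fin n, ∏ j ∈ Finset.Ioi i, (l j / √v - l i / √v) =
      (∏ i : Fin n, ∏ _j ∈ Finset.Ioi i, (√v)⁻¹) * ∏ i, ∏ j ∈ Finset.Ioi i, (l j - l i) := by
    rw [← Finset.prod_mul_distrib]
    refine Finset.prod_congr rfl fun i _ => ?_
    rw [← Finset.prod_mul_distrib]
    exact Finset.prod_congr rfl fun j _ => by ring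
  rw [h3]; ring

/-- The square of the Slater determinant of the Hermite functions has total mass `n!`. -/
theorem integral_slater_hermiteFun_sq (hv : 0 < v) (n : ℕ) :
    Integrable (fun l : Fin n → ℝ => slater (fun j => hermiteFun v j) l ^ 2) ∧
    ∫ l : Fin n → ℝ, slater (fun j => hermiteFun v j) l ^ 2 = n.factorial := by
  obtain ⟨h1, h2⟩ := integral_prod_mul_slater (φ := fun j : Fin n => hermiteFun v j)
    (F := fun _ _ => 1) (fun i j k => by simpa using integrable_hermiteFun_mul hv i j)
  simp only [Finset.prod_const_one] at h1 h2
  obtain ⟨h3, h4⟩ := integral_slater_sq (φ := fun j : Fin n => hermiteFun v j)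
    (F := fun _ => 1) (fun _ _ => rfl) h1
  have h5 : (Matrix.of fun i j : Fin n => ∫ x, hermiteFun v i x * hermiteFun v j x * 1) = 1 := by
    ext i j
    simp [integral_hermiteFun_mul hv, Matrix.one_apply, Fin.ext_iff]
  rw [h2, h5, Matrix.det_one, mul_one] at h4
  simp only [mul_one] at h3 h4
  exact ⟨h3, h4⟩

theorem tame_vandermondeReal :
    Tame (fun l : Fin n → ℝ => ∑ i, l i ^ 2) (vandermondeReal (n := n)) := by
  refine (tame_eval (fun l => Finset.sum_nonneg fun _ _ => sq_nonneg _) (realPoints n)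
    norm_realPoints_sq_le (vandermondeProd n)).mono fun l => ?_
  rw [eval_vandermondeProd, Complex.norm_real]

theorem continuous_vandermondeReal : Continuous (vandermondeReal (n := n)) := by
  unfold vandermondeReal; fun_prop

/-- The eigenvalue density has exponential moments. -/
theorem integrable_vandermondeReal_mul_exp {α : ℝ} (hα : 0 < α) (a : ℝ) (i : Fin n) :
    Integrable fun l : Fin n → ℝ => (vandermondeReal l * vandermondeReal l) *
      Real.exp (a * |l i|) * Real.exp (-(α * ∑ i, l i ^ 2)) := by
  have hle : ∀ l : Fin n → ℝ, l i ^ 2 ≤ ∑ i, l i ^ 2 := fun l =>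
    Finset.single_le_sum (f := fun i => l i ^ 2) (fun _ _ => sq_nonneg _) (Finset.mem_univ i)
  have ht := (tame_vandermondeReal.mul tame_vandermondeReal).mul (tame_exp_of_sq_le hle a)
  have hcont := continuous_vandermondeReal (n := n)
  exact ht.integrable (μ := volume) (𝕜 := ℝ) (by fun_prop) norm_sq_le_sum_sq
    (by fun_prop) hα

/-- The second moments of the eigenvalue counting functions of a GUE matrix. -/
theorem integral_count_mul_count {g : ℝ} (hg : 0 < g) (hn : 0 < n) {A B : Set ℝ}
    (hA : MeasurableSet A) (hB : MeasurableSet B) :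
    ∫ x, count n A x * count n B x ∂(law g n) =
      (∑ i ∈ Finset.range n, ∫ x in A ∩ B, hermiteFun (g / n) i x * hermiteFun (g / n) i x) +
      ((∑ i ∈ Finset.range n, ∫ x in A, hermiteFun (g / n) i x * hermiteFun (g / n) i x) *
        (∑ i ∈ Finset.range n, ∫ x in B, hermiteFun (g / n) i x * hermiteFun (g / n) i x) -
        ∑ i ∈ Finset.range n, ∑ j ∈ Finset.range n,
          (∫ x in A, hermiteFun (g / n) i x * hermiteFun (g / n) j x) *
            ∫ x in B, hermiteFun (g / n) i x * hermiteFun (g / n) j x) := by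
  have hn' : (0 : ℝ) < n := Nat.cast_pos.2 hn
  have hv : 0 < g / n := div_pos hg hn'
  set v := g / n with hvdef
  have hα : 0 < (n : ℝ) / (2 * g) := by positivity
  have hP := isProbabilityMeasure_law (n := n) hg hn
  obtain ⟨C, hC⟩ := exists_slater_hermiteFun v n
  obtain ⟨hSi, hS⟩ := integral_slater_hermiteFun_sq hv n
  set S : (Fin n → ℝ) → ℝ := slater (fun j : Fin n => hermiteFun v j) with hSdef
  have hfac : (n.factorial : ℝ) ≠ 0 := by positivity
  have hSsq : ∀ l, S l ^ 2 = C ^ 2 * (vandermondeReal l ^ 2 *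
      Real.exp (-(n / (2 * g) * ∑ i, l i ^ 2))) := by
    intro l
    have : Real.exp (-(n / (2 * g) * ∑ i, l i ^ 2)) =
        Real.exp (-(∑ i, l i ^ 2 / (4 * v))) ^ 2 := by
      rw [← Real.exp_nat_mul]
      congr 1
      rw [← Finset.sum_div, hvdef]
      push_cast; field_simp; ring
    rw [hC, this]; ring
  set c := C ^ 2 / n.factorial with hcdef
  have hdens : ∀ l, S l ^ 2 / n.factorial = c * (vandermondeReal l ^ 2 *
      Real.exp (-(n / (2 * g) * ∑ i, l i ^ 2))) := fun l => by rw [hSsq, hcdef]; ring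
  have hc1 : c * ∫ l : Fin n → ℝ,
      vandermondeReal l ^ 2 * Real.exp (-(n / (2 * g) * ∑ i, l i ^ 2)) = 1 := by
    rw [← integral_const_mul]
    simp only [← hdens]
    rw [integral_div, hS, div_self hfac]
  -- the law of the eigenvalues
  set P : Measure (Fin n → ℝ) := volume.withDensity fun l =>
    ENNReal.ofReal (S l ^ 2 / n.factorial) with hPdef
  have hSm : Measurable fun l => S l ^ 2 / n.factorial := by
    simp only [hdens]
    exact ((continuous_vandermondeReal.pow 2).mul (by fun_prop)).measurable.const_mul c
  have hS0 : ∀ l, 0 ≤ S l ^ 2 / n.factorial := fun l => by positivity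
  have hPint : ∀ f : (Fin n → ℝ) → ℝ, ∫ l, f l ∂P = ∫ l, S l ^ 2 / n.factorial * f l := by
    intro f
    rw [hPdef, integral_withDensity_eq_integral_toReal_smul hSm.ennreal_ofReal
      (ae_of_all _ fun _ => ENNReal.ofReal_lt_top)]
    simp only [ENNReal.toReal_ofReal (hS0 _), smul_eq_mul]
  have hPfin : IsFiniteMeasure P :=
    isFiniteMeasure_withDensity_ofReal (hSi.div_const _).2
  have hexp : ∀ (a : ℝ) (i : Fin n), Integrable (fun l : Fin n → ℝ => Real.exp (a * |l i|)) P := by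
    intro a i
    rw [hPdef, integrable_withDensity_iff_integrable_smul' hSm.ennreal_ofReal
      (ae_of_all _ fun _ => ENNReal.ofReal_lt_top)]
    have := (integrable_vandermondeReal_mul_exp hα a i).const_mul c
    refine this.congr (ae_of_all _ fun l => ?_)
    beta_reduce
    rw [ENNReal.toReal_ofReal (hS0 _), smul_eq_mul, hdens]
    ring
  have hmom : ∀ a b : ℕ, ∫ x, (∑ i, eig x i ^ a) * (∑ i, eig x i ^ b) ∂(law g n) =
      ∫ l : Fin n → ℝ, (∑ i, l i ^ a) * (∑ i, l i ^ b) ∂P := by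
    intro a b
    rw [integral_law_powerSum_mul hg hn hc1, hPint, ← integral_const_mul]
    congr 1; ext l
    rw [hdens]; ring
  have key := integral_count_mul_eq_of_moments (P := law g n) (P' := P)
    (X := fun i x => eig x i) (Y := fun i l => l i) measurable_eig
    (fun i => measurable_pi_apply i) (fun c i => integrable_exp_eig hg hn c i) hexp hmom hA hB
  simp only [← count_eq_sum] at key
  rw [key, hPint]
  have hb : ∀ (D : Set ℝ) (x : ℝ), ‖D.indicator (fun _ => (1 : ℝ)) x‖ ≤ 1 := by
    intro D x
    by_cases h : x ∈ D <;> simp [h]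
  have h2 := (integral_slater_sq_sum_mul_sum (φ := fun j : Fin n => hermiteFun v j)
    (fun i j => integrable_hermiteFun_mul hv i j)
    (fun i j => by simp [integral_hermiteFun_mul hv, Fin.ext_iff])
    (measurable_const.indicator hA) (measurable_const.indicator hB) (hb A) (hb B)).2
  have h3 : ∀ l : Fin n → ℝ, S l ^ 2 / n.factorial *
      ((∑ i, A.indicator (fun _ => (1 : ℝ)) (l i)) * ∑ i, B.indicator (fun _ => (1 : ℝ)) (l i)) =
      (n.factorial : ℝ)⁻¹ * (S l ^ 2 *
      ((∑ i, A.indicator (fun _ => (1 : ℝ)) (l i)) * ∑ i, B.indicator (fun _ => (1 : ℝ)) (l i))) :=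
    fun l => by ring
  simp only [h3]
  rw [integral_const_mul, h2, ← mul_assoc, inv_mul_cancel₀ hfac, one_mul]
  have h4 : ∀ (D : Set ℝ), MeasurableSet D → ∀ f : ℝ → ℝ,
      ∫ x, f x * D.indicator (fun _ => (1 : ℝ)) x = ∫ x in D, f x := by
    intro D hD f
    rw [← integral_indicator hD]
    congr 1; ext x
    by_cases h : x ∈ D <;> simp [h]
  have h5 : ∀ x, A.indicator (fun _ => (1 : ℝ)) x * B.indicator (fun _ => (1 : ℝ)) x =
      (A ∩ B).indicator (fun _ => (1 : ℝ)) x := by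
    intro x
    by_cases h : x ∈ A <;> by_cases h' : x ∈ B <;> simp [h, h']
  simp only [h5, h4 _ hA, h4 _ hB, h4 _ (hA.inter hB), Finset.sum_range]

/-- The mass that the square of the Christoffel–Darboux kernel gives to a set in the plane. -/
noncomputable def pairMass (v : ℝ) (n : ℕ) (S : Set (ℝ × ℝ)) : ℝ :=
  ∫ p in S, cdKernel v n p.1 p.2 ^ 2

theorem cdKernel_sq (v : ℝ) (n : ℕ) (x y : ℝ) : cdKernel v n x y ^ 2 =
    ∑ i ∈ Finset.range n, ∑ j ∈ Finset.range n,
      (hermiteFun v i x * hermiteFun v j x) * (hermiteFun v i y * hermiteFun v j y) := by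
  rw [cdKernel, pow_two, Finset.sum_mul_sum]
  exact Finset.sum_congr rfl fun i _ => Finset.sum_congr rfl fun j _ => by ring

theorem integrable_cdKernel_sq (hv : 0 < v) (n : ℕ) :
    Integrable fun p : ℝ × ℝ => cdKernel v n p.1 p.2 ^ 2 := by
  simp only [cdKernel_sq]
  exact integrable_finsetSum _ fun i _ => integrable_finsetSum _ fun j _ =>
    (integrable_hermiteFun_mul hv i j).mul_prod (integrable_hermiteFun_mul hv i j)

/-- The mass of a product set, through the Gram matrices of the two factors. -/
theorem pairMass_prod (hv : 0 < v) (n : ℕ) (A B : Set ℝ) :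
    pairMass v n (A ×ˢ B) = ∑ i ∈ Finset.range n, ∑ j ∈ Finset.range n,
      (∫ x in A, hermiteFun v i x * hermiteFun v j x) *
        ∫ x in B, hermiteFun v i x * hermiteFun v j x := by
  have hi : ∀ i j : ℕ, IntegrableOn (fun p : ℝ × ℝ => (hermiteFun v i p.1 * hermiteFun v j p.1) *
      (hermiteFun v i p.2 * hermiteFun v j p.2)) (A ×ˢ B) := fun i j =>
    ((integrable_hermiteFun_mul hv i j).mul_prod (integrable_hermiteFun_mul hv i j)).integrableOn
  simp only [pairMass, cdKernel_sq]
  rw [integral_finsetSum _ fun i _ => integrable_finsetSum _ fun j _ => hi i j]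
  refine Finset.sum_congr rfl fun i _ => ?_
  rw [integral_finsetSum _ fun j _ => hi i j]
  refine Finset.sum_congr rfl fun j _ => ?_
  exact setIntegral_prod_mul (μ := volume) (ν := volume)
    (fun x => hermiteFun v i x * hermiteFun v j x)
    (fun x => hermiteFun v i x * hermiteFun v j x) A B

/-- The reproducing property of the projection kernel. -/
theorem pairMass_prod_univ (hv : 0 < v) (n : ℕ) (A : Set ℝ) :
    pairMass v n (A ×ˢ Set.univ) =
      ∑ i ∈ Finset.range n, ∫ x in A, hermiteFun v i x * hermiteFun v i x := by
  rw [pairMass_prod hv]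
  refine Finset.sum_congr rfl fun i hi => ?_
  simp only [setIntegral_univ, integral_hermiteFun_mul hv, mul_ite, mul_one, mul_zero]
  rw [Finset.sum_ite_eq, if_pos hi]

theorem pairMass_union (hv : 0 < v) {S T : Set (ℝ × ℝ)} (hST : Disjoint S T)
    (hT : MeasurableSet T) : pairMass v n (S ∪ T) = pairMass v n S + pairMass v n T :=
  setIntegral_union hST hT (integrable_cdKernel_sq hv n).integrableOn
    (integrable_cdKernel_sq hv n).integrableOn

theorem pairMass_swap (v : ℝ) (n : ℕ) (A B : Set ℝ) :
    pairMass v n (A ×ˢ B) = pairMass v n (B ×ˢ A) := by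
  rw [pairMass, pairMass, Measure.volume_eq_prod, ← setIntegral_prod_swap]
  simp only [Prod.fst_swap, Prod.snd_swap, cdKernel_comm v n]

theorem pairMass_nonneg (v : ℝ) (n : ℕ) (S : Set (ℝ × ℝ)) : 0 ≤ pairMass v n S :=
  integral_nonneg fun _ => sq_nonneg _

theorem pairMass_mono (hv : 0 < v) {S T : Set (ℝ × ℝ)} (hST : S ⊆ T) :
    pairMass v n S ≤ pairMass v n T :=
  setIntegral_mono_set (integrable_cdKernel_sq hv n).integrableOn
    (ae_of_all _ fun _ => sq_nonneg _) hST.eventuallyLE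

theorem memLp_count {g : ℝ} (hg : 0 < g) (hn : 0 < n) {A : Set ℝ} (hA : MeasurableSet A) :
    MemLp (count n A) 2 (law g n) := by
  have := isProbabilityMeasure_law (n := n) hg hn
  refine MemLp.of_bound (measurable_count hA).aestronglyMeasurable n (ae_of_all _ fun x => ?_)
  rw [count, Real.norm_natCast]
  exact_mod_cast (Finset.card_le_univ _).trans (by simp)

/-- The covariance of two counting functions of a projection determinantal process. -/
theorem covariance_count {g : ℝ} (hg : 0 < g) (hn : 0 < n) {A B : Set ℝ}
    (hA : MeasurableSet A) (hB : MeasurableSet B) :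
    cov[count n A, count n B; law g n] =
      pairMass (g / n) n ((A ∩ B) ×ˢ Set.univ) - pairMass (g / n) n (A ×ˢ B) := by
  have hn' : (0 : ℝ) < n := Nat.cast_pos.2 hn
  have hv : 0 < g / n := div_pos hg hn'
  have hP := isProbabilityMeasure_law (n := n) hg hn
  -- The first moment is a second moment as well, because the count of `ℝ` is the constant `n`.
  have hmean : ∀ {D : Set ℝ}, MeasurableSet D → ∫ x, count n D x ∂(law g n) =
      ∑ i ∈ Finset.range n, ∫ x in D, hermiteFun (g / n) i x * hermiteFun (g / n) i x := by
    intro D hD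
    have h := integral_count_mul_count hg hn hD MeasurableSet.univ
    rw [← pairMass_prod hv, pairMass_prod_univ hv, Set.inter_univ] at h
    have h1 : ∀ x, count n Set.univ x = n := fun x => by simp [count]
    simp only [h1, integral_mul_const, setIntegral_univ, integral_hermiteFun_mul hv, if_true,
      Finset.sum_const, Finset.card_range, nsmul_eq_mul, mul_one] at h
    have : (∫ x, count n D x ∂(law g n)) * n = (∑ i ∈ Finset.range n,
      ∫ x in D, hermiteFun (g / n) i x * hermiteFun (g / n) i x) * n := by linarith
    exact mul_right_cancel₀ hn'.ne' this
  rw [covariance_eq_sub (memLp_count hg hn hA) (memLp_count hg hn hB)]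
  simp only [Pi.mul_apply]
  rw [integral_count_mul_count hg hn hA hB, hmean hA, hmean hB, pairMass_prod_univ hv,
    pairMass_prod hv]
  ring

end Covariance

/-! ### Weak convergence of products of Hermite functions -/

section Weak

open Polynomial

/-- The limit of `∫ F φ_a φ_b` when `a - b = d` and `a, b ∼ n`: the integral of `F` against the
pushforward of `π⁻¹ cos (d θ) dθ` on `(0, π)` under `θ ↦ 2 √g cos θ`. -/
noncomputable def limitFunctional (g : ℝ) (d : ℤ) (F : ℝ → ℝ) : ℝ :=
  Real.pi⁻¹ * ∫ θ in (0 : ℝ)..Real.pi, F (2 * √g * Real.cos θ) * Real.cos (d * θ)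

theorem limitFunctional_one (g : ℝ) (d : ℤ) :
    limitFunctional g d (fun _ => 1) = if d = 0 then 1 else 0 := by
  rw [limitFunctional]
  simp only [one_mul]
  split_ifs with h
  · subst h
    simp [Real.pi_ne_zero]
  · have hd : (d : ℝ) ≠ 0 := by exact_mod_cast h
    rw [intervalIntegral.integral_comp_mul_left (fun x => Real.cos x) hd]
    simp [Real.sin_int_mul_pi]

/-- The limits of the moments satisfy the limit of the three-term recurrence, by the addition
theorem for the cosine. -/
theorem limitFunctional_pow_succ (g : ℝ) (d : ℤ) (m : ℕ) :
    limitFunctional g d (fun x => x ^ (m + 1)) =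
      √g * (limitFunctional g (d - 1) (fun x => x ^ m) +
        limitFunctional g (d + 1) (fun x => x ^ m)) := by
  simp only [limitFunctional]
  rw [← mul_add, ← intervalIntegral.integral_add (by apply Continuous.intervalIntegrable; fun_prop)
    (by apply Continuous.intervalIntegrable; fun_prop), mul_left_comm,
    ← intervalIntegral.integral_const_mul √g]
  congr 1
  refine intervalIntegral.integral_congr fun θ _ => ?_
  have h1 : Real.cos (((d - 1 : ℤ) : ℝ) * θ) + Real.cos (((d + 1 : ℤ) : ℝ) * θ) =
      2 * Real.cos θ * Real.cos (d * θ) := by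
    push_cast
    rw [sub_mul, add_mul, one_mul, Real.cos_sub, Real.cos_add]; ring
  rw [← mul_add, h1]; ring

variable {g : ℝ} {a b : ℕ → ℕ} {d : ℤ}

/-- Convergence of the moments, by the three-term recurrence. Its coefficients tend to `√g` when the
indices are asymptotic to `n`. -/
theorem tendsto_moment (hg : 0 < g) (m : ℕ)
    (hd : ∀ᶠ n in atTop, (a n : ℤ) - b n = d)
    (hb : Tendsto (fun n => (b n : ℝ) / n) atTop (𝓝 1)) :
    Tendsto (fun n : ℕ => ∫ x, x ^ m * (hermiteFun (g / n) (a n) x * hermiteFun (g / n) (b n) x))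
      atTop (𝓝 (limitFunctional g d (fun x => x ^ m))) := by
  have hvpos : ∀ᶠ n : ℕ in atTop, 0 < g / n := by
    filter_upwards [eventually_gt_atTop 0] with n hn
    exact div_pos hg (Nat.cast_pos.2 hn)
  induction m generalizing b d with
  | zero =>
    simp only [pow_zero, limitFunctional_one]
    refine tendsto_const_nhds.congr' ?_
    filter_upwards [hd, hvpos] with n hn hv
    simp only [one_mul, integral_hermiteFun_mul hv]
    congr 1
    rw [eq_iff_iff]; omega
  | succ m ih =>
    have hinv : Tendsto (fun n : ℕ => (1 : ℝ) / n) atTop (𝓝 0) :=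
      tendsto_one_div_atTop_nhds_zero_nat
    have hbpos : ∀ᶠ n in atTop, 1 ≤ b n := by
      filter_upwards [hb.eventually (lt_mem_nhds one_pos)] with n hn
      by_contra h
      have : b n = 0 := by omega
      simp [this] at hn
    have hb1 : Tendsto (fun n => ((b n + 1 : ℕ) : ℝ) / n) atTop (𝓝 1) := by
      have := hb.add hinv
      rw [add_zero] at this
      refine this.congr fun n => ?_
      push_cast; ring
    have hb2 : Tendsto (fun n => ((b n - 1 : ℕ) : ℝ) / n) atTop (𝓝 1) := by
      have := hb.sub hinv
      rw [sub_zero] at this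
      refine this.congr' ?_
      filter_upwards [hbpos] with n hn
      rw [Nat.cast_sub hn]; push_cast; ring
    have h1 := ih (d := d - 1) (b := fun n => b n + 1)
      (by filter_upwards [hd] with n hn; push_cast; omega) hb1
    have h2 := ih (d := d + 1) (b := fun n => b n - 1)
      (by filter_upwards [hd, hbpos] with n hn hn'; rw [Nat.cast_sub hn']; push_cast; omega) hb2
    have c1 : Tendsto (fun n => √(g * (((b n + 1 : ℕ) : ℝ) / n))) atTop (𝓝 √g) := by
      have := (hb1.const_mul g).sqrt
      rwa [mul_one] at this
    have c2 : Tendsto (fun n => √(g * ((b n : ℝ) / n))) atTop (𝓝 √g) := by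
      have := (hb.const_mul g).sqrt
      rwa [mul_one] at this
    have h := (c1.mul h1).add (c2.mul h2)
    rw [← mul_add, ← limitFunctional_pow_succ] at h
    refine h.congr' ?_
    filter_upwards [hvpos] with n hv
    have e1 : √(g * (((b n + 1 : ℕ) : ℝ) / n)) = √(g / n) * √(b n + 1 : ℝ) := by
      rw [← Real.sqrt_mul hv.le]; congr 1; push_cast; ring
    have e2 : √(g * ((b n : ℝ) / n)) = √(g / n) * √(b n : ℝ) := by
      rw [← Real.sqrt_mul hv.le]; congr 1; ring
    rw [e1, e2, ← integral_const_mul, ← integral_const_mul, ← integral_add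
      ((integrable_pow_mul_hermiteFun hv m _ _).const_mul _)
      ((integrable_pow_mul_hermiteFun hv m _ _).const_mul _)]
    congr 1; ext x
    have := hermiteFun_recurrence hv (b n) x
    rw [pow_succ]
    linear_combination (-(x ^ m * hermiteFun (g / n) (a n) x)) * this

theorem limitFunctional_polynomial (g : ℝ) (d : ℤ) (q : ℝ[X]) :
    limitFunctional g d (fun x => q.eval x) =
      ∑ k ∈ Finset.range (q.natDegree + 1), q.coeff k * limitFunctional g d (fun x => x ^ k) := by
  simp only [limitFunctional, eval_eq_sum_range, mul_left_comm _ Real.pi⁻¹, ← Finset.mul_sum]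
  congr 1
  simp only [Finset.sum_mul, ← intervalIntegral.integral_const_mul]
  rw [intervalIntegral.integral_finsetSum]
  · refine Finset.sum_congr rfl fun k _ => ?_
    congr 1; ext θ; ring
  · intro k _
    apply Continuous.intervalIntegrable; fun_prop

theorem tendsto_polynomial (hg : 0 < g) (q : ℝ[X])
    (hd : ∀ᶠ n in atTop, (a n : ℤ) - b n = d)
    (hb : Tendsto (fun n => (b n : ℝ) / n) atTop (𝓝 1)) :
    Tendsto (fun n : ℕ => ∫ x, q.eval x *
        (hermiteFun (g / n) (a n) x * hermiteFun (g / n) (b n) x))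
      atTop (𝓝 (limitFunctional g d (fun x => q.eval x))) := by
  rw [limitFunctional_polynomial]
  have h : Tendsto (fun n : ℕ => ∑ k ∈ Finset.range (q.natDegree + 1), q.coeff k *
      ∫ x, x ^ k * (hermiteFun (g / n) (a n) x * hermiteFun (g / n) (b n) x)) atTop
      (𝓝 (∑ k ∈ Finset.range (q.natDegree + 1), q.coeff k *
        limitFunctional g d (fun x => x ^ k))) :=
    tendsto_finsetSum _ fun k _ => (tendsto_moment hg k hd hb).const_mul _
  refine h.congr' ?_
  filter_upwards [eventually_gt_atTop 0] with n hn
  have hv : 0 < g / n := div_pos hg (Nat.cast_pos.2 hn)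
  simp only [← integral_const_mul]
  rw [← integral_finsetSum _ fun k _ => (integrable_pow_mul_hermiteFun hv k _ _).const_mul _]
  congr 1; ext x
  rw [eval_eq_sum_range, Finset.sum_mul]
  exact Finset.sum_congr rfl fun k _ => by ring

/-- A sequence that is approximated, up to convergent errors with small limits, by convergent
sequences. -/
theorem tendsto_of_approx {u : ℕ → ℝ} {l : ℝ}
    (h : ∀ ε > 0, ∃ (w z : ℕ → ℝ) (l' z₀ : ℝ), Tendsto w atTop (𝓝 l') ∧ Tendsto z atTop (𝓝 z₀) ∧
      z₀ ≤ ε ∧ |l - l'| ≤ ε ∧ ∀ᶠ n in atTop, |u n - w n| ≤ z n) :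
    Tendsto u atTop (𝓝 l) := by
  rw [Metric.tendsto_nhds]
  intro ε hε
  obtain ⟨w, z, l', z₀, hw, hz, hz₀, hl, hu⟩ := h (ε / 5) (by positivity)
  filter_upwards [hu, (Metric.tendsto_nhds.1 hw) (ε / 5) (by positivity),
    (Metric.tendsto_nhds.1 hz) (ε / 5) (by positivity)] with n h1 h2 h3
  rw [Real.dist_eq, abs_lt] at *
  rw [abs_le] at h1 hl
  constructor <;> linarith [h1.1, h1.2, h2.1, h2.2, h3.1, h3.2, hl.1, hl.2]

theorem abs_limitFunctional_sub_le {F q s : ℝ → ℝ}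
    (hF : IntervalIntegrable (fun θ => F (2 * √g * Real.cos θ)) volume 0 Real.pi)
    (hq : IntervalIntegrable (fun θ => q (2 * √g * Real.cos θ)) volume 0 Real.pi)
    (hs : IntervalIntegrable (fun θ => s (2 * √g * Real.cos θ)) volume 0 Real.pi)
    (h : ∀ x, |F x - q x| ≤ s x) :
    |limitFunctional g d F - limitFunctional g d q| ≤ limitFunctional g 0 s := by
  have hc : ContinuousOn (fun θ : ℝ => Real.cos (d * θ)) (Set.uIcc 0 Real.pi) := by fun_prop
  simp only [limitFunctional, ← mul_sub]
  rw [← intervalIntegral.integral_sub (hF.mul_continuousOn hc) (hq.mul_continuousOn hc), abs_mul,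
    abs_of_pos (inv_pos.2 Real.pi_pos)]
  refine mul_le_mul_of_nonneg_left ?_ (inv_pos.2 Real.pi_pos).le
  simp only [Int.cast_zero, zero_mul, Real.cos_zero, mul_one]
  refine (intervalIntegral.abs_integral_le_integral_abs Real.pi_pos.le).trans ?_
  refine intervalIntegral.integral_mono_on Real.pi_pos.le
    ((hF.mul_continuousOn hc).sub (hq.mul_continuousOn hc)).abs hs fun θ _ => ?_
  rw [← sub_mul, abs_mul]
  exact (mul_le_of_le_one_right (abs_nonneg _) (Real.abs_cos_le_one _)).trans (h _)

/-- If `F` is approximated by functions `q` up to errors dominated by functions `s` of small mass,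
and convergence is known for `q` and `s`, then it holds for `F`. -/
theorem tendsto_of_sandwich (hg : 0 < g) {F : ℝ → ℝ}
    (hF : IntervalIntegrable (fun θ => F (2 * √g * Real.cos θ)) volume 0 Real.pi)
    (hFi : ∀ v > 0, ∀ j k, Integrable fun x => F x * (hermiteFun v j x * hermiteFun v k x))
    (h : ∀ ε > 0, ∃ q s : ℝ → ℝ,
      IntervalIntegrable (fun θ => q (2 * √g * Real.cos θ)) volume 0 Real.pi ∧
      IntervalIntegrable (fun θ => s (2 * √g * Real.cos θ)) volume 0 Real.pi ∧
      (∀ v > 0, ∀ j k, Integrable fun x => q x * (hermiteFun v j x * hermiteFun v k x)) ∧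
      (∀ v > 0, ∀ j k, Integrable fun x => s x * (hermiteFun v j x * hermiteFun v k x)) ∧
      (∀ x, |F x - q x| ≤ s x) ∧ limitFunctional g 0 s ≤ ε ∧
      Tendsto (fun n : ℕ => ∫ x, q x * (hermiteFun (g / n) (a n) x * hermiteFun (g / n) (b n) x))
        atTop (𝓝 (limitFunctional g d q)) ∧
      Tendsto (fun n : ℕ => ∫ x, s x * (hermiteFun (g / n) (a n) x * hermiteFun (g / n) (a n) x))
        atTop (𝓝 (limitFunctional g 0 s)) ∧
      Tendsto (fun n : ℕ => ∫ x, s x * (hermiteFun (g / n) (b n) x * hermiteFun (g / n) (b n) x))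
        atTop (𝓝 (limitFunctional g 0 s))) :
    Tendsto (fun n : ℕ => ∫ x, F x * (hermiteFun (g / n) (a n) x * hermiteFun (g / n) (b n) x))
      atTop (𝓝 (limitFunctional g d F)) := by
  refine tendsto_of_approx fun ε hε => ?_
  obtain ⟨q, s, hq, hs, hqi, hsi, hFq, hsε, hqt, hsa, hsb⟩ := h ε hε
  refine ⟨_, fun n : ℕ =>
    (1 / 2) * (∫ x, s x * (hermiteFun (g / n) (a n) x * hermiteFun (g / n) (a n) x)) +
    (1 / 2) * ∫ x, s x * (hermiteFun (g / n) (b n) x * hermiteFun (g / n) (b n) x),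
    _, limitFunctional g 0 s, hqt, ?_, hsε,
    (abs_limitFunctional_sub_le hF hq hs hFq).trans hsε, ?_⟩
  · have := (hsa.const_mul (1 / 2)).add (hsb.const_mul (1 / 2))
    convert this using 2; ring
  filter_upwards [eventually_gt_atTop 0] with n hn
  have hv : 0 < g / n := div_pos hg (Nat.cast_pos.2 hn)
  rw [← integral_sub (hFi _ hv _ _) (hqi _ hv _ _), ← integral_const_mul, ← integral_const_mul,
    ← integral_add ((hsi _ hv _ _).const_mul _) ((hsi _ hv _ _).const_mul _)]
  refine (abs_integral_le_integral_abs).trans (integral_mono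
    ((hFi _ hv _ _).sub (hqi _ hv _ _)).abs
    (((hsi _ hv _ _).const_mul _).add ((hsi _ hv _ _).const_mul _)) fun x => ?_)
  set A := hermiteFun (g / n) (a n) x
  set B := hermiteFun (g / n) (b n) x
  have h0 : 0 ≤ s x := (abs_nonneg _).trans (hFq x)
  have h1 : |A * B| ≤ 1 / 2 * (A * A) + 1 / 2 * (B * B) := by
    rw [abs_le]; constructor <;> nlinarith [sq_nonneg (A + B), sq_nonneg (A - B)]
  calc |F x * (A * B) - q x * (A * B)| = |F x - q x| * |A * B| := by rw [← sub_mul, abs_mul]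
    _ ≤ s x * (1 / 2 * (A * A) + 1 / 2 * (B * B)) := mul_le_mul (hFq x) h1 (abs_nonneg _) h0
    _ = 1 / 2 * (s x * (A * A)) + 1 / 2 * (s x * (B * B)) := by ring

theorem limitFunctional_zero_le {s : ℝ → ℝ} {B : ℝ}
    (hs : IntervalIntegrable (fun θ => s (2 * √g * Real.cos θ)) volume 0 Real.pi)
    (h : ∀ x, |x| ≤ 2 * √g → s x ≤ B) : limitFunctional g 0 s ≤ B := by
  simp only [limitFunctional, Int.cast_zero, zero_mul, Real.cos_zero, mul_one]
  rw [inv_mul_le_iff₀ Real.pi_pos]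
  calc _ ≤ ∫ _ in (0 : ℝ)..Real.pi, B :=
        intervalIntegral.integral_mono_on Real.pi_pos.le hs (by simp) fun θ _ => h _ (by
          rw [abs_mul, abs_of_nonneg (by positivity : 0 ≤ 2 * √g)]
          exact mul_le_of_le_one_right (by positivity) (Real.abs_cos_le_one θ))
    _ = _ := by simp

theorem integrable_bounded_mul_hermiteFun {F : ℝ → ℝ} (hF : Measurable F) {C : ℝ}
    (hC : ∀ x, |F x| ≤ C) {v : ℝ} (hv : 0 < v) (j k : ℕ) :
    Integrable fun x => F x * (hermiteFun v j x * hermiteFun v k x) :=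
  (integrable_hermiteFun_mul hv j k).bdd_mul (c := C) hF.aestronglyMeasurable (ae_of_all _ hC)

theorem intervalIntegrable_bounded_comp {F : ℝ → ℝ} (hF : Measurable F) {C : ℝ}
    (hC : ∀ x, |F x| ≤ C) :
    IntervalIntegrable (fun θ => F (2 * √g * Real.cos θ)) volume 0 Real.pi := by
  rw [intervalIntegrable_iff]
  exact Measure.integrableOn_of_bounded (M := C) (by simp)
    (hF.comp (by fun_prop)).aestronglyMeasurable (ae_of_all _ fun θ => hC _)

/-- Weak convergence against bounded continuous functions: Weierstrass approximation inside
`[-R, R]`, and a high power of `x / R` outside. -/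
theorem tendsto_continuous (hg : 0 < g) {F : ℝ → ℝ} (hF : Continuous F) {M : ℝ}
    (hM : ∀ x, |F x| ≤ M) (hd : ∀ᶠ n in atTop, (a n : ℤ) - b n = d)
    (ha : Tendsto (fun n => (a n : ℝ) / n) atTop (𝓝 1))
    (hb : Tendsto (fun n => (b n : ℝ) / n) atTop (𝓝 1)) :
    Tendsto (fun n : ℕ => ∫ x, F x * (hermiteFun (g / n) (a n) x * hermiteFun (g / n) (b n) x))
      atTop (𝓝 (limitFunctional g d F)) := by
  have hpc : ∀ q : ℝ[X], IntervalIntegrable (fun θ => q.eval (2 * √g * Real.cos θ)) volume 0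
      Real.pi := fun q => by apply Continuous.intervalIntegrable; fun_prop
  refine tendsto_of_sandwich hg (by apply Continuous.intervalIntegrable; fun_prop)
    (fun v hv j k => integrable_bounded_mul_hermiteFun hF.measurable hM hv j k) fun ε hε => ?_
  have hM0 : 0 ≤ M := (abs_nonneg _).trans (hM 0)
  set c := 2 * √g with hc
  have hc0 : 0 < c := by positivity
  set R := c + 1 with hRdef
  have hR : 0 < R := by positivity
  obtain ⟨q, hq⟩ := exists_polynomial_near_of_continuousOn (-R) R F hF.continuousOn (ε / 2)
    (by positivity)
  set r : ℝ[X] := C (M + 1) + q ^ 2 with hr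
  have hr0 : ∀ x, r.eval x = M + 1 + q.eval x ^ 2 := fun x => by simp [hr]
  obtain ⟨B, hB⟩ := (isCompact_Icc (a := -c) (b := c)).bddAbove_image r.continuous.continuousOn
  have hB' : ∀ x, |x| ≤ c → r.eval x ≤ B := fun x hx => hB ⟨x, abs_le.1 hx, rfl⟩
  have hB0 : 0 ≤ B := by
    have h1 := hB' 0 (by simpa using hc0.le)
    rw [hr0] at h1
    nlinarith [sq_nonneg (q.eval 0)]
  obtain ⟨N, hN⟩ : ∃ N : ℕ, B * ((c / R) ^ 2) ^ N ≤ ε / 2 := by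
    have h1 : (c / R) ^ 2 < 1 := by
      have : c / R < 1 := by rw [div_lt_one hR]; linarith
      exact pow_lt_one₀ (by positivity) this two_ne_zero
    have h2 := (tendsto_pow_atTop_nhds_zero_of_lt_one (sq_nonneg (c / R)) h1).const_mul B
    rw [mul_zero] at h2
    exact (h2.eventually (ge_mem_nhds (by positivity))).exists
  -- On `[-R, R]` the error of the approximation is at most `ε / 2`. Outside it is at most `r`, and
  -- `(x / R) ^ (2 N)` is at least `1` there, but small on the limiting support `[-c, c]`.
  set s : ℝ[X] := C (ε / 2) + r * ((C R⁻¹ * X) ^ 2) ^ N with hs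
  have hs0 : ∀ x, s.eval x = ε / 2 + r.eval x * ((x / R) ^ 2) ^ N := fun x => by
    simp [hs]; left; ring
  have hrpos : ∀ x, 0 ≤ r.eval x := fun x => by rw [hr0]; positivity
  refine ⟨fun x => q.eval x, fun x => s.eval x, hpc q, hpc s,
    fun v hv j k => integrable_polynomial_mul_hermiteFun hv q j k,
    fun v hv j k => integrable_polynomial_mul_hermiteFun hv s j k, fun x => ?_,
    limitFunctional_zero_le (hpc s) fun x hx => ?_, tendsto_polynomial hg q hd hb,
    tendsto_polynomial hg s (by simp) ha, tendsto_polynomial hg s (by simp) hb⟩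
  · beta_reduce
    rw [hs0]
    rcases le_or_gt |x| R with hx | hx
    · rw [abs_sub_comm]
      have h1 := hq x (abs_le.1 hx)
      have h2 : 0 ≤ r.eval x * ((x / R) ^ 2) ^ N := mul_nonneg (hrpos x) (by positivity)
      linarith
    · have h1 : 1 ≤ ((x / R) ^ 2) ^ N := by
        apply one_le_pow₀
        rw [div_pow, ← sq_abs x, ← div_pow]
        apply one_le_pow₀
        rw [one_le_div hR]; exact hx.le
      have h2 : |F x - q.eval x| ≤ r.eval x := by
        rw [hr0]
        have h3 : |q.eval x| ≤ 1 + q.eval x ^ 2 := by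
          rw [← sq_abs]; nlinarith [sq_nonneg (|q.eval x| - 1), abs_nonneg (q.eval x)]
        calc |F x - q.eval x| ≤ |F x| + |q.eval x| := abs_sub _ _
          _ ≤ _ := by linarith [hM x]
      have h3 := le_mul_of_one_le_right (hrpos x) h1
      linarith
  · rw [hs0]
    have h1 : (x / R) ^ 2 ≤ (c / R) ^ 2 := by
      rw [div_pow, div_pow, ← sq_abs x]; gcongr
    calc ε / 2 + r.eval x * ((x / R) ^ 2) ^ N ≤ ε / 2 + B * ((c / R) ^ 2) ^ N := by
          gcongr
          exact hB' x hx
      _ ≤ ε := by linarith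

/-- The tent function of width `δ` at `s`. -/
noncomputable def tent (δ s x : ℝ) : ℝ := max 0 (1 - |x - s| / δ)

theorem continuous_tent (δ s : ℝ) : Continuous (tent δ s) := by
  unfold tent; fun_prop

theorem tent_nonneg (δ s x : ℝ) : 0 ≤ tent δ s x := le_max_left _ _

theorem tent_le_one {δ : ℝ} (hδ : 0 < δ) (s x : ℝ) : tent δ s x ≤ 1 :=
  max_le zero_le_one (by linarith [div_nonneg (abs_nonneg (x - s)) hδ.le])

/-- The limiting measure has no atoms. -/
theorem tendsto_limitFunctional_tent (hg : 0 < g) (s : ℝ) :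
    Tendsto (fun k : ℕ => limitFunctional g 0 (tent (1 / ((k : ℝ) + 1)) s)) atTop (𝓝 0) := by
  have h (k : ℕ) : limitFunctional g 0 (tent (1 / ((k : ℝ) + 1)) s) =
      Real.pi⁻¹ * ∫ θ in (0 : ℝ)..Real.pi, tent (1 / ((k : ℝ) + 1)) s (2 * √g * Real.cos θ) := by
    simp [limitFunctional]
  refine Tendsto.congr (fun k => (h k).symm) ?_
  rw [← mul_zero Real.pi⁻¹]
  refine Tendsto.const_mul _ ?_
  suffices h0 : Tendsto (fun k : ℕ => ∫ θ in (0 : ℝ)..Real.pi,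
      tent (1 / ((k : ℝ) + 1)) s (2 * √g * Real.cos θ)) atTop
      (𝓝 (∫ _ in (0 : ℝ)..Real.pi, (0 : ℝ))) by simpa using h0
  refine intervalIntegral.tendsto_integral_filter_of_dominated_convergence (fun _ => 1) ?_ ?_
    ?_ ?_
  · exact Eventually.of_forall fun k =>
      ((continuous_tent _ s).comp (by fun_prop)).aestronglyMeasurable
  · refine Eventually.of_forall fun k => ae_of_all _ fun θ _ => ?_
    rw [Real.norm_of_nonneg (tent_nonneg _ _ _)]
    exact tent_le_one (by positivity) _ _
  · exact intervalIntegrable_const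
  · have hnull : volume {θ | θ ∈ Set.Ioc 0 Real.pi ∧ 2 * √g * Real.cos θ = s} = 0 := by
      refine Set.Subsingleton.measure_zero (fun x hx y hy => ?_) _
      have h1 : Real.cos x = Real.cos y := by
        have h2 := hx.2.trans hy.2.symm
        exact mul_left_cancel₀ (by positivity) h2
      exact Real.injOn_cos ⟨hx.1.1.le, hx.1.2⟩ ⟨hy.1.1.le, hy.1.2⟩ h1
    rw [Set.uIoc_of_le Real.pi_pos.le]
    filter_upwards [measure_eq_zero_iff_ae_notMem.1 hnull] with θ hθ hθ'
    have hne : 2 * √g * Real.cos θ - s ≠ 0 := fun h => hθ ⟨hθ', sub_eq_zero.1 h⟩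
    refine tendsto_const_nhds.congr' ?_
    obtain ⟨K, hK⟩ := exists_nat_ge |2 * √g * Real.cos θ - s|⁻¹
    filter_upwards [eventually_ge_atTop K] with k hk
    rw [tent, max_eq_left]
    have h1 : |2 * √g * Real.cos θ - s|⁻¹ ≤ (k : ℝ) + 1 := by
      have : (K : ℝ) ≤ k := by exact_mod_cast hk
      linarith
    have h2 : 1 ≤ |2 * √g * Real.cos θ - s| / (1 / ((k : ℝ) + 1)) := by
      rw [div_div_eq_mul_div, div_one]
      calc (1 : ℝ) = |2 * √g * Real.cos θ - s| * |2 * √g * Real.cos θ - s|⁻¹ :=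
            (mul_inv_cancel₀ (abs_pos.2 hne).ne').symm
        _ ≤ _ := by gcongr
    linarith

/-- Weak convergence against bounded functions with finitely many discontinuities. -/
theorem tendsto_piecewise_continuous (hg : 0 < g) {F : ℝ → ℝ} (hF : Measurable F) {M : ℝ}
    (hM : ∀ x, |F x| ≤ M) (S : Finset ℝ) (hS : ∀ x ∉ S, ContinuousAt F x)
    (hd : ∀ᶠ n in atTop, (a n : ℤ) - b n = d)
    (ha : Tendsto (fun n => (a n : ℝ) / n) atTop (𝓝 1))
    (hb : Tendsto (fun n => (b n : ℝ) / n) atTop (𝓝 1)) :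
    Tendsto (fun n : ℕ => ∫ x, F x * (hermiteFun (g / n) (a n) x * hermiteFun (g / n) (b n) x))
      atTop (𝓝 (limitFunctional g d F)) := by
  refine tendsto_of_sandwich hg (intervalIntegrable_bounded_comp hF hM)
    (fun v hv j k => integrable_bounded_mul_hermiteFun hF hM hv j k) fun ε hε => ?_
  have hM0 : 0 ≤ M := (abs_nonneg _).trans (hM 0)
  have hlin : ∀ δ, limitFunctional g 0 (fun x => M * ∑ s ∈ S, tent δ s x) =
      M * ∑ s ∈ S, limitFunctional g 0 (tent δ s) := by
    intro δ
    simp only [limitFunctional, mul_assoc, ← Finset.mul_sum]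
    rw [intervalIntegral.integral_const_mul, mul_left_comm]
    congr 2
    simp only [Finset.sum_mul]
    rw [intervalIntegral.integral_finsetSum]
    intro s _
    exact (((continuous_tent δ s).comp (by fun_prop)).mul (by fun_prop)).intervalIntegrable _ _
  obtain ⟨δ, hδ, hδε⟩ : ∃ δ : ℝ, 0 < δ ∧
      limitFunctional g 0 (fun x => M * ∑ s ∈ S, tent δ s x) ≤ ε := by
    have h1 : Tendsto (fun k : ℕ => M * ∑ s ∈ S, limitFunctional g 0 (tent (1 / ((k : ℝ) + 1)) s))
        atTop (𝓝 (M * ∑ s ∈ S, 0)) :=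
      (tendsto_finsetSum _ fun s _ => tendsto_limitFunctional_tent hg s).const_mul M
    simp only [Finset.sum_const_zero, mul_zero, ← hlin] at h1
    obtain ⟨k, hk⟩ := (h1.eventually (ge_mem_nhds hε)).exists
    exact ⟨1 / ((k : ℝ) + 1), by positivity, hk⟩
  set η : ℝ → ℝ := fun x => ∑ s ∈ S, tent δ s x with hη
  have hηc : Continuous η := continuous_finsetSum _ fun s _ => continuous_tent δ s
  have hη0 : ∀ x, 0 ≤ η x := fun x => Finset.sum_nonneg fun s _ => tent_nonneg δ s x
  have hηS : ∀ x ∈ S, 1 ≤ η x := fun x hx => by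
    have : tent δ x x = 1 := by simp [tent]
    rw [← this]
    exact Finset.single_le_sum (f := fun s => tent δ s x) (fun s _ => tent_nonneg δ s x) hx
  -- The cut-off `ψ` vanishes on `S`, so that `F * ψ` is continuous, and `F * (1 - ψ)` is at most
  -- `M * η`.
  set ψ : ℝ → ℝ := fun x => max 0 (1 - η x) with hψ
  have hψc : Continuous ψ := by fun_prop
  have hψ0 : ∀ x, 0 ≤ ψ x := fun x => le_max_left _ _
  have hψ1 : ∀ x, ψ x ≤ 1 := fun x => max_le zero_le_one (by linarith [hη0 x])
  have hqc : Continuous fun x => F x * ψ x := by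
    rw [continuous_iff_continuousAt]
    intro x
    by_cases hx : x ∈ S
    · have h1 : ψ x = 0 := max_eq_left (by linarith [hηS x hx])
      rw [ContinuousAt, h1, mul_zero]
      refine squeeze_zero_norm (a := fun y => M * ψ y) (fun y => ?_) ?_
      · rw [norm_mul, Real.norm_of_nonneg (hψ0 y)]
        exact mul_le_mul_of_nonneg_right (hM y) (hψ0 y)
      · have := (hψc.tendsto x).const_mul M
        rwa [h1, mul_zero] at this
    · exact (hS x hx).mul hψc.continuousAt
  have hqM : ∀ x, |F x * ψ x| ≤ M := fun x => by
    rw [abs_mul, abs_of_nonneg (hψ0 x)]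
    exact (mul_le_of_le_one_right (abs_nonneg _) (hψ1 x)).trans (hM x)
  have hsc : Continuous fun x => M * η x := by fun_prop
  have hsM : ∀ x, |M * η x| ≤ M * S.card := fun x => by
    rw [abs_of_nonneg (mul_nonneg hM0 (hη0 x))]
    refine mul_le_mul_of_nonneg_left ?_ hM0
    have := Finset.sum_le_card_nsmul S (fun s => tent δ s x) 1 fun s _ => tent_le_one hδ s x
    simpa using this
  refine ⟨fun x => F x * ψ x, fun x => M * η x, intervalIntegrable_bounded_comp hqc.measurable hqM,
    intervalIntegrable_bounded_comp hsc.measurable hsM,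
    fun v hv j k => integrable_bounded_mul_hermiteFun hqc.measurable hqM hv j k,
    fun v hv j k => integrable_bounded_mul_hermiteFun hsc.measurable hsM hv j k, fun x => ?_, hδε,
    tendsto_continuous hg hqc hqM hd ha hb, tendsto_continuous hg hsc hsM (by simp) ha ha,
    tendsto_continuous hg hsc hsM (by simp) hb hb⟩
  have h1 : F x - F x * ψ x = F x * (1 - ψ x) := by ring
  rw [h1, abs_mul, abs_of_nonneg (by linarith [hψ1 x] : 0 ≤ 1 - ψ x)]
  refine mul_le_mul (hM x) ?_ (by linarith [hψ1 x]) hM0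
  linarith [le_max_right 0 (1 - η x)]

end Weak

/-! ### The arcsine law -/

section Arcsine

/-- The density of the arcsine law on `[-2√g, 2√g]`. It vanishes outside since there the square
root of the negative number `4 * g - x ^ 2` is `0`. -/
noncomputable def arcsine (g x : ℝ) : ℝ := (Real.pi * √(4 * g - x ^ 2))⁻¹

variable {g : ℝ}

/-- The substitution `x = 2 √g cos θ`. -/
theorem image_cos (hg : 0 < g) : (fun θ => 2 * √g * Real.cos θ) '' Set.Ioo 0 Real.pi =
    Set.Ioo (-(2 * √g)) (2 * √g) := by
  have hc : 0 < 2 * √g := by positivity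
  ext x
  constructor
  · rintro ⟨θ, ⟨h0, h1⟩, rfl⟩
    have h2 : Real.cos θ < 1 := by
      rw [← Real.cos_zero]
      exact Real.cos_lt_cos_of_nonneg_of_le_pi le_rfl h1.le h0
    have h3 : -1 < Real.cos θ := by
      rw [← Real.cos_pi]
      exact Real.cos_lt_cos_of_nonneg_of_le_pi h0.le le_rfl h1
    constructor <;> dsimp only <;> nlinarith
  · rintro ⟨h1, h2⟩
    refine ⟨Real.arccos (x / (2 * √g)), ⟨Real.arccos_pos.2 ((div_lt_one hc).2 h2), ?_⟩, ?_⟩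
    · rw [← Real.arccos_neg_one]
      refine Real.strictAntiOn_arccos (by simp) ⟨?_, ?_⟩ ?_
      · rw [le_div_iff₀ hc]; linarith
      · rw [div_le_one hc]; linarith
      · rw [lt_div_iff₀ hc]; linarith
    · dsimp only
      rw [Real.cos_arccos]
      · field_simp
      · rw [le_div_iff₀ hc]; linarith
      · rw [div_le_one hc]; linarith

theorem sqrt_four_mul_sub_cos (hg : 0 < g) {θ : ℝ} (hθ : θ ∈ Set.Ioo 0 Real.pi) :
    √(4 * g - (2 * √g * Real.cos θ) ^ 2) = 2 * √g * Real.sin θ := by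
  have h1 : √g ^ 2 = g := Real.sq_sqrt hg.le
  have h2 : 4 * g - (2 * √g * Real.cos θ) ^ 2 = (2 * √g * Real.sin θ) ^ 2 := by
    rw [mul_pow, mul_pow, mul_pow, mul_pow, h1, Real.sin_sq]; ring
  rw [h2, Real.sqrt_sq (mul_nonneg (by positivity) (Real.sin_pos_of_mem_Ioo hθ).le)]

theorem arcsine_eq_zero {x : ℝ} (hg : 0 < g) (hx : x ∉ Set.Ioo (-(2 * √g)) (2 * √g)) :
    arcsine g x = 0 := by
  have h1 : √g ^ 2 = g := Real.sq_sqrt hg.le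
  have : 4 * g - x ^ 2 ≤ 0 := by
    rw [Set.mem_Ioo, not_and_or, not_lt, not_lt] at hx
    have h0 := Real.sqrt_nonneg g
    rcases hx with hx | hx <;> nlinarith
  rw [arcsine, Real.sqrt_eq_zero'.2 this, mul_zero, inv_zero]

theorem measurable_arcsine (g : ℝ) : Measurable (arcsine g) := by
  unfold arcsine; fun_prop

theorem deriv_two_sqrt_cos (θ : ℝ) : HasDerivWithinAt (fun θ => 2 * √g * Real.cos θ)
    (2 * √g * -Real.sin θ) (Set.Ioo 0 Real.pi) θ :=
  ((Real.hasDerivAt_cos θ).const_mul _).hasDerivWithinAt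

theorem injOn_two_sqrt_cos (hg : 0 < g) :
    Set.InjOn (fun θ => 2 * √g * Real.cos θ) (Set.Ioo 0 Real.pi) := by
  intro x hx y hy h
  exact Real.injOn_cos (Set.Ioo_subset_Icc_self hx) (Set.Ioo_subset_Icc_self hy)
    (mul_left_cancel₀ (by positivity) h)

theorem abs_deriv_mul_arcsine (hg : 0 < g) (h : ℝ → ℝ) {θ : ℝ} (hθ : θ ∈ Set.Ioo 0 Real.pi) :
    |2 * √g * -Real.sin θ| • (h (2 * √g * Real.cos θ) * arcsine g (2 * √g * Real.cos θ)) =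
      Real.pi⁻¹ * h (2 * √g * Real.cos θ) := by
  have hs := Real.sin_pos_of_mem_Ioo hθ
  have hc : 0 < √g := by positivity
  rw [arcsine, sqrt_four_mul_sub_cos hg hθ, mul_neg, abs_neg, abs_of_pos (by positivity),
    smul_eq_mul]
  have := Real.pi_ne_zero
  field_simp

/-- The arcsine law is the law of `2 √g cos θ` for `θ` uniform in `(0, π)`. The identity needs no
integrability of `h`. -/
theorem integral_mul_arcsine (hg : 0 < g) (h : ℝ → ℝ) :
    ∫ x, h x * arcsine g x =
      Real.pi⁻¹ * ∫ θ in (0 : ℝ)..Real.pi, h (2 * √g * Real.cos θ) := by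
  have h1 : ∫ x, h x * arcsine g x = ∫ x in Set.Ioo (-(2 * √g)) (2 * √g), h x * arcsine g x := by
    rw [setIntegral_eq_integral_of_forall_compl_eq_zero]
    intro x hx
    rw [arcsine_eq_zero hg hx, mul_zero]
  rw [h1, ← image_cos hg, integral_image_eq_integral_abs_deriv_smul measurableSet_Ioo
    (fun θ _ => deriv_two_sqrt_cos θ) (injOn_two_sqrt_cos hg),
    setIntegral_congr_fun measurableSet_Ioo fun θ hθ => abs_deriv_mul_arcsine hg h hθ,
    integral_const_mul, intervalIntegral.integral_of_le Real.pi_pos.le,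
    integral_Ioc_eq_integral_Ioo]

theorem integrable_arcsine (hg : 0 < g) : Integrable (arcsine g) := by
  have h1 : IntegrableOn (fun x => 1 * arcsine g x) (Set.Ioo (-(2 * √g)) (2 * √g)) := by
    rw [← image_cos hg, integrableOn_image_iff_integrableOn_abs_deriv_smul measurableSet_Ioo
      (fun θ _ => deriv_two_sqrt_cos θ) (injOn_two_sqrt_cos hg)]
    refine IntegrableOn.congr_fun (f := fun _ => Real.pi⁻¹ * 1) ?_
      (fun θ hθ => (abs_deriv_mul_arcsine hg (fun _ => 1) hθ).symm) measurableSet_Ioo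
    exact integrableOn_const (by simp)
  simp only [one_mul] at h1
  refine (integrableOn_iff_integrable_of_support_subset fun x hx => ?_).1 h1
  by_contra h
  exact hx (arcsine_eq_zero hg h)

/-- The weak limit of `φ_n ^ 2` is the arcsine law. -/
theorem limitFunctional_zero_eq (hg : 0 < g) (F : ℝ → ℝ) :
    limitFunctional g 0 F = ∫ x, F x * arcsine g x := by
  rw [integral_mul_arcsine hg]
  simp [limitFunctional]

/-- The weak limit of `φ_n φ_{n-1}` has the density `x / (2 √g)` with respect to the arcsine law. -/
theorem limitFunctional_one_eq (hg : 0 < g) (F : ℝ → ℝ) :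
    limitFunctional g 1 F = ∫ x, F x * (x / (2 * √g) * arcsine g x) := by
  simp only [← mul_assoc]
  rw [integral_mul_arcsine hg, limitFunctional]
  congr 2; ext θ
  have : √g ≠ 0 := by positivity
  simp; left; field_simp

end Arcsine

/-! ### Separated sets -/

section Separated

variable {A B : Set ℝ} {c c' g : ℝ}

theorem integrableOn_mul_exp {d : ℝ} (hd : 0 < d) :
    IntegrableOn (fun t : ℝ => t * Real.exp (-(t * d))) (Set.Ioi 0) := by
  refine (integrableOn_rpow_mul_exp_neg_mul_rpow (s := 1) (p := 1) (b := d) (by norm_num)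
    one_pos hd).congr_fun (fun t _ => ?_) measurableSet_Ioi
  simp only [Real.rpow_one]
  ring_nf

theorem integral_mul_exp {d : ℝ} (hd : 0 < d) :
    ∫ t in Set.Ioi (0 : ℝ), t * Real.exp (-(t * d)) = (d ^ 2)⁻¹ := by
  have h := Real.integral_rpow_mul_exp_neg_mul_Ioi (a := 2) two_pos hd
  rw [show (2 : ℝ) - 1 = 1 by norm_num, Real.Gamma_two, mul_one] at h
  simp only [Real.rpow_one] at h
  have h2 : (1 / d) ^ (2 : ℝ) = (d ^ 2)⁻¹ := by
    rw [Real.rpow_two, one_div, inv_pow]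
  rw [← h2, ← h]
  simp only [mul_comm d]

/-- On separated sets, `1 / (x - y) ^ 2` is a superposition of products of functions of `x` and of
functions of `y`, because `1 / s ^ 2 = ∫₀^∞ t exp (-t s) dt`. -/
theorem setIntegral_div_sub_sq (hA : MeasurableSet A) (hB : MeasurableSet B) (hAc : A ⊆ Set.Iic c)
    (hBc : B ⊆ Set.Ici c') (hc : c < c') {f h : ℝ → ℝ} (hf : Integrable f) (hh : Integrable h) :
    IntegrableOn (fun p : ℝ × ℝ => f p.1 * h p.2 / (p.1 - p.2) ^ 2) (A ×ˢ B) ∧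
    ∫ p in A ×ˢ B, f p.1 * h p.2 / (p.1 - p.2) ^ 2 =
      ∫ t in Set.Ioi (0 : ℝ), t * Real.exp (-(t * (c' - c))) *
        ((∫ x in A, Real.exp (-(t * (c - x))) * f x) *
          ∫ y in B, Real.exp (-(t * (y - c'))) * h y) ∧
    IntegrableOn (fun t => t * Real.exp (-(t * (c' - c))) *
        ((∫ x in A, Real.exp (-(t * (c - x))) * f x) *
          ∫ y in B, Real.exp (-(t * (y - c'))) * h y)) (Set.Ioi 0) := by
  have hfA : Integrable f (volume.restrict A) := hf.restrict
  have hhB : Integrable h (volume.restrict B) := hh.restrict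
  have hfh : Integrable (fun p : ℝ × ℝ => f p.1 * h p.2)
      ((volume.restrict A).prod (volume.restrict B)) := hfA.mul_prod hhB
  have hmem : ∀ᵐ p ∂((volume.restrict A).prod (volume.restrict B)), p ∈ A ×ˢ B := by
    rw [Measure.prod_restrict]
    exact ae_restrict_mem (hA.prod hB)
  have hd : 0 < c' - c := sub_pos.2 hc
  have hsep : ∀ p ∈ A ×ˢ B, c' - c ≤ p.2 - p.1 := fun p hp => by
    have h1 : p.1 ≤ c := hAc hp.1
    have h2 : c' ≤ p.2 := hBc hp.2
    linarith
  have hint : Integrable (Function.uncurry fun (p : ℝ × ℝ) (t : ℝ) =>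
      f p.1 * h p.2 * (t * Real.exp (-(t * (p.2 - p.1)))))
      (((volume.restrict A).prod (volume.restrict B)).prod (volume.restrict (Set.Ioi 0))) := by
    refine (hfh.mul_prod (integrableOn_mul_exp hd)).mono ?_ ?_
    · refine hfh.aestronglyMeasurable.comp_fst.mul (Continuous.aestronglyMeasurable ?_)
      fun_prop
    · have h1 : ∀ᵐ q ∂(((volume.restrict A).prod (volume.restrict B)).prod
          (volume.restrict (Set.Ioi (0 : ℝ)))), q.1 ∈ A ×ˢ B :=
        Measure.quasiMeasurePreserving_fst.ae hmem
      have h2 : ∀ᵐ q ∂(((volume.restrict A).prod (volume.restrict B)).prod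
          (volume.restrict (Set.Ioi (0 : ℝ)))), q.2 ∈ Set.Ioi (0 : ℝ) :=
        Measure.quasiMeasurePreserving_snd.ae (ae_restrict_mem measurableSet_Ioi)
      filter_upwards [h1, h2] with q hq1 hq2
      have hq2' : (0 : ℝ) < q.2 := hq2
      simp only [Function.uncurry, norm_mul, Real.norm_of_nonneg (Real.exp_pos _).le]
      have h3 := mul_le_mul_of_nonneg_left (hsep _ hq1) hq2'.le
      gcongr
  have hinner : ∀ p ∈ A ×ˢ B, ∫ t in Set.Ioi (0 : ℝ),
      f p.1 * h p.2 * (t * Real.exp (-(t * (p.2 - p.1)))) = f p.1 * h p.2 / (p.1 - p.2) ^ 2 := by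
    intro p hp
    rw [integral_const_mul, integral_mul_exp (hd.trans_le (hsep p hp)), ← div_eq_mul_inv,
      ← neg_sub p.1, neg_sq]
  rw [Measure.volume_eq_prod, IntegrableOn, ← Measure.prod_restrict]
  have hright : ∀ t : ℝ, ∫ p, f p.1 * h p.2 * (t * Real.exp (-(t * (p.2 - p.1))))
      ∂((volume.restrict A).prod (volume.restrict B)) = t * Real.exp (-(t * (c' - c))) *
        ((∫ x in A, Real.exp (-(t * (c - x))) * f x) *
          ∫ y in B, Real.exp (-(t * (y - c'))) * h y) := ?_
  · refine ⟨hint.integral_prod_left.congr (hmem.mono hinner), ?_,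
      hint.integral_prod_right.congr (ae_of_all _ hright)⟩
    rw [← integral_congr_ae (hmem.mono hinner), integral_integral_swap hint]
    exact integral_congr_ae (ae_of_all _ hright)
  intro t
  rw [← integral_prod_mul, ← integral_const_mul]
  refine integral_congr_ae (ae_of_all _ fun p => ?_)
  beta_reduce
  have h1 : Real.exp (-(t * (p.2 - p.1))) = Real.exp (-(t * (c' - c))) *
      Real.exp (-(t * (c - p.1))) * Real.exp (-(t * (p.2 - c'))) := by
    rw [← Real.exp_add, ← Real.exp_add]; congr 1; ring
  rw [h1]; ring

theorem integral_abs_hermiteFun_mul_le {v : ℝ} (hv : 0 < v) (j k : ℕ) :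
    ∫ x, |hermiteFun v j x * hermiteFun v k x| ≤ 1 := by
  have h1 := integral_hermiteFun_mul hv j j
  have h2 := integral_hermiteFun_mul hv k k
  rw [if_pos rfl] at h1 h2
  have h3 : ∫ x, (1 / 2 : ℝ) * (hermiteFun v j x * hermiteFun v j x +
      hermiteFun v k x * hermiteFun v k x) = 1 := by
    rw [integral_const_mul, integral_add (integrable_hermiteFun_mul hv j j)
      (integrable_hermiteFun_mul hv k k), h1, h2]
    norm_num
  rw [← h3]
  refine integral_mono (integrable_hermiteFun_mul hv j k).abs
    (((integrable_hermiteFun_mul hv j j).add (integrable_hermiteFun_mul hv k k)).const_mul _)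
    fun x => ?_
  beta_reduce
  rw [abs_le]
  constructor <;> nlinarith [sq_nonneg (hermiteFun v j x - hermiteFun v k x),
    sq_nonneg (hermiteFun v j x + hermiteFun v k x)]

/-- Integrals of products of Hermite functions with a bounded weight are bounded. -/
theorem abs_setIntegral_mul_hermiteFun_le {v : ℝ} (hv : 0 < v) (hA : MeasurableSet A) (j k : ℕ)
    {w : ℝ → ℝ} (hw : ∀ x ∈ A, |w x| ≤ 1) :
    |∫ x in A, w x * (hermiteFun v j x * hermiteFun v k x)| ≤ 1 := by
  refine le_trans ?_ (integral_abs_hermiteFun_mul_le hv j k)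
  refine le_trans ?_ (setIntegral_le_integral (s := A) (integrable_hermiteFun_mul hv j k).abs
    (ae_of_all _ fun x => abs_nonneg _))
  rw [← Real.norm_eq_abs]
  refine norm_integral_le_of_norm_le (integrable_hermiteFun_mul hv j k).abs.integrableOn ?_
  filter_upwards [ae_restrict_mem hA] with x hx
  rw [norm_mul, Real.norm_eq_abs]
  exact mul_le_of_le_one_left (abs_nonneg _) (hw x hx)

theorem continuousAt_indicator_of_notMem_frontier {w : ℝ → ℝ} (hw : Continuous w) {x : ℝ}
    (hx : x ∉ frontier A) : ContinuousAt (A.indicator w) x := by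
  rw [frontier_eq_closure_inter_closure, Set.mem_inter_iff, not_and_or, ← Set.mem_compl_iff,
    ← Set.mem_compl_iff, ← interior_compl, ← interior_compl, compl_compl] at hx
  rcases hx with hx | hx
  · refine (continuousAt_const (y := (0 : ℝ))).congr ?_
    filter_upwards [mem_interior_iff_mem_nhds.1 hx] with y hy
    rw [Set.indicator_of_notMem hy]
  · refine hw.continuousAt.congr ?_
    filter_upwards [mem_interior_iff_mem_nhds.1 hx] with y hy
    rw [Set.indicator_of_mem hy]

variable {a b : ℕ → ℕ} {d : ℤ}

/-- Weak convergence for integrals over sets with finite boundary. -/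
theorem tendsto_setIntegral_hermiteFun (hg : 0 < g) (hA : MeasurableSet A)
    (hfA : (frontier A).Finite) {w : ℝ → ℝ} (hw : Continuous w) (hw1 : ∀ x ∈ A, |w x| ≤ 1)
    (hd : ∀ᶠ n in atTop, (a n : ℤ) - b n = d)
    (ha : Tendsto (fun n => (a n : ℝ) / n) atTop (𝓝 1))
    (hb : Tendsto (fun n => (b n : ℝ) / n) atTop (𝓝 1)) :
    Tendsto (fun n : ℕ => ∫ x in A, w x * (hermiteFun (g / n) (a n) x * hermiteFun (g / n) (b n) x))
      atTop (𝓝 (limitFunctional g d (A.indicator w))) := by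
  have h1 : ∀ x, |A.indicator w x| ≤ 1 := fun x => by
    by_cases hx : x ∈ A
    · rw [Set.indicator_of_mem hx]; exact hw1 x hx
    · rw [Set.indicator_of_notMem hx]; simp
  refine (tendsto_piecewise_continuous hg (hw.measurable.indicator hA) h1 hfA.toFinset
    (fun x hx => continuousAt_indicator_of_notMem_frontier hw (by simpa using hx)) hd ha hb).congr
    fun n => ?_
  rw [← integral_indicator hA]
  refine integral_congr_ae (ae_of_all _ fun x => ?_)
  by_cases hx : x ∈ A <;> simp [hx]

theorem integral_indicator_mul_arcsine (hA : MeasurableSet A) (w r : ℝ → ℝ) :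
    ∫ x, A.indicator w x * r x = ∫ x in A, w x * r x := by
  rw [← integral_indicator hA]
  refine integral_congr_ae (ae_of_all _ fun x => ?_)
  by_cases hx : x ∈ A <;> simp [hx]

/-- Weak convergence of the double integrals against `1 / (x - y) ^ 2`. -/
theorem tendsto_setIntegral_div_sub_sq (hg : 0 < g) (hA : MeasurableSet A) (hB : MeasurableSet B)
    (hfA : (frontier A).Finite) (hfB : (frontier B).Finite) (hAc : A ⊆ Set.Iic c)
    (hBc : B ⊆ Set.Ici c') (hc : c < c') {a b a' b' : ℕ → ℕ} {r : ℝ → ℝ} (hr : Integrable r)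
    (hlim : ∀ F, limitFunctional g d F = ∫ x, F x * r x)
    (hd : ∀ᶠ n in atTop, (a n : ℤ) - b n = d) (hd' : ∀ᶠ n in atTop, (a' n : ℤ) - b' n = d)
    (ha : Tendsto (fun n => (a n : ℝ) / n) atTop (𝓝 1))
    (hb : Tendsto (fun n => (b n : ℝ) / n) atTop (𝓝 1))
    (ha' : Tendsto (fun n => (a' n : ℝ) / n) atTop (𝓝 1))
    (hb' : Tendsto (fun n => (b' n : ℝ) / n) atTop (𝓝 1)) :
    Tendsto (fun n : ℕ => ∫ p in A ×ˢ B,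
      (hermiteFun (g / n) (a n) p.1 * hermiteFun (g / n) (b n) p.1) *
      (hermiteFun (g / n) (a' n) p.2 * hermiteFun (g / n) (b' n) p.2) / (p.1 - p.2) ^ 2)
      atTop (𝓝 (∫ p in A ×ˢ B, r p.1 * r p.2 / (p.1 - p.2) ^ 2)) := by
  have hvpos : ∀ᶠ n : ℕ in atTop, 0 < g / n := by
    filter_upwards [eventually_gt_atTop 0] with n hn
    exact div_pos hg (Nat.cast_pos.2 hn)
  have hwA : ∀ t ∈ Set.Ioi (0 : ℝ), ∀ x ∈ A, |Real.exp (-(t * (c - x)))| ≤ 1 := by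
    intro t ht x hx
    have h1 : x ≤ c := hAc hx
    rw [abs_of_pos (Real.exp_pos _), Real.exp_le_one_iff]
    have := mul_nonneg (le_of_lt ht) (sub_nonneg.2 h1)
    linarith
  have hwB : ∀ t ∈ Set.Ioi (0 : ℝ), ∀ x ∈ B, |Real.exp (-(t * (x - c')))| ≤ 1 := by
    intro t ht x hx
    have h1 : c' ≤ x := hBc hx
    rw [abs_of_pos (Real.exp_pos _), Real.exp_le_one_iff]
    have := mul_nonneg (le_of_lt ht) (sub_nonneg.2 h1)
    linarith
  rw [(setIntegral_div_sub_sq hA hB hAc hBc hc hr hr).2.1]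
  have heq : ∀ᶠ n : ℕ in atTop, _ = _ := hvpos.mono fun n hv =>
    (setIntegral_div_sub_sq hA hB hAc hBc hc (integrable_hermiteFun_mul hv (a n) (b n))
      (integrable_hermiteFun_mul hv (a' n) (b' n))).2.1.symm
  refine Tendsto.congr' heq ?_
  -- Both one-dimensional integrals are at most `1`, as `∫ |φ_j φ_k| ≤ 1`.
  refine tendsto_integral_filter_of_dominated_convergence
    (fun t => t * Real.exp (-(t * (c' - c)))) ?_ ?_ (integrableOn_mul_exp (sub_pos.2 hc)) ?_
  · filter_upwards [hvpos] with n hv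
    have hcont : ∀ {C : Set ℝ} {u : ℝ → ℝ → ℝ} (j k : ℕ), MeasurableSet C →
        Continuous (Function.uncurry u) → AEStronglyMeasurable (fun t => ∫ x in C, u t x *
          (hermiteFun (g / n) j x * hermiteFun (g / n) k x)) (volume.restrict (Set.Ioi 0)) := by
      intro C u j k _ hu
      have h1 : StronglyMeasurable (Function.uncurry fun t x => u t x *
          (hermiteFun (g / n) j x * hermiteFun (g / n) k x)) := by
        refine Continuous.stronglyMeasurable (hu.mul ?_)
        exact ((continuous_hermiteFun hv j).mul (continuous_hermiteFun hv k)).comp continuous_snd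
      exact h1.integral_prod_right.aestronglyMeasurable
    refine AEStronglyMeasurable.mul (by fun_prop) (AEStronglyMeasurable.mul ?_ ?_)
    · exact hcont (u := fun t x => Real.exp (-(t * (c - x)))) _ _ hA
        (by unfold Function.uncurry; fun_prop)
    · exact hcont (u := fun t x => Real.exp (-(t * (x - c')))) _ _ hB
        (by unfold Function.uncurry; fun_prop)
  · filter_upwards [hvpos] with n hv
    filter_upwards [ae_restrict_mem measurableSet_Ioi] with t ht
    have ht0 : 0 ≤ t := le_of_lt ht
    rw [norm_mul, Real.norm_of_nonneg (by positivity), norm_mul]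
    refine mul_le_of_le_one_right (by positivity) (mul_le_one₀ ?_ (norm_nonneg _) ?_)
    · exact abs_setIntegral_mul_hermiteFun_le hv hA _ _ (hwA t ht)
    · exact abs_setIntegral_mul_hermiteFun_le hv hB _ _ (hwB t ht)
  · filter_upwards [ae_restrict_mem measurableSet_Ioi] with t ht
    refine Tendsto.const_mul _ (Tendsto.mul ?_ ?_)
    · have := tendsto_setIntegral_hermiteFun hg hA hfA
        (w := fun x => Real.exp (-(t * (c - x)))) (by fun_prop) (hwA t ht) hd ha hb
      rwa [hlim, integral_indicator_mul_arcsine hA] at this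
    · have := tendsto_setIntegral_hermiteFun hg hB hfB
        (w := fun x => Real.exp (-(t * (x - c')))) (by fun_prop) (hwB t ht) hd' ha' hb'
      rwa [hlim, integral_indicator_mul_arcsine hB] at this

/-- The limiting kernel in terms of the arcsine density. Both sides vanish off the limiting support.
-/
theorem covKernel_eq (g x y : ℝ) : 1 / (2 * Real.pi ^ 2) * covKernel g x y =
    (4 * g - x * y) / 2 * (arcsine g x * arcsine g y) / (x - y) ^ 2 := by
  have := Real.pi_ne_zero
  rw [covKernel, arcsine, arcsine]
  simp only [div_eq_mul_inv, mul_inv]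
  field_simp

theorem tendsto_sub_one_div : Tendsto (fun n : ℕ => ((n - 1 : ℕ) : ℝ) / n) atTop (𝓝 1) := by
  have h : Tendsto (fun n : ℕ => 1 - (1 : ℝ) / n) atTop (𝓝 (1 - 0)) :=
    tendsto_const_nhds.sub tendsto_one_div_atTop_nhds_zero_nat
  rw [sub_zero] at h
  refine h.congr' ?_
  filter_upwards [eventually_gt_atTop 0] with n hn
  have : (n : ℝ) ≠ 0 := by positivity
  rw [Nat.cast_sub hn]; field_simp; push_cast; ring

theorem tendsto_self_div : Tendsto (fun n : ℕ => (n : ℝ) / n) atTop (𝓝 1) := by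
  refine tendsto_const_nhds.congr' ?_
  filter_upwards [eventually_gt_atTop 0] with n hn
  have : (n : ℝ) ≠ 0 := by positivity
  rw [div_self this]

theorem integrable_arcsine_one (hg : 0 < g) :
    Integrable (fun x => x / (2 * √g) * arcsine g x) := by
  refine (integrable_arcsine hg).mono (by have := measurable_arcsine g; fun_prop)
    (ae_of_all _ fun x => ?_)
  by_cases hx : x ∈ Set.Ioo (-(2 * √g)) (2 * √g)
  · rw [norm_mul]
    refine mul_le_of_le_one_left (norm_nonneg _) ?_
    have : 0 < 2 * √g := by positivity
    rw [Real.norm_eq_abs, abs_div, abs_of_pos this, div_le_one this, abs_le]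
    exact ⟨hx.1.le, hx.2.le⟩
  · simp [arcsine_eq_zero hg hx]

/-- On separated sets the limiting kernel is integrable, and splits into products of functions of
one variable in the same way as the square of the Christoffel–Darboux kernel. -/
theorem integrableOn_covKernel (hg : 0 < g) (hA : MeasurableSet A) (hB : MeasurableSet B)
    (hAc : A ⊆ Set.Iic c) (hBc : B ⊆ Set.Ici c') (hc : c < c') :
    IntegrableOn (fun p : ℝ × ℝ => covKernel g p.1 p.2) (A ×ˢ B) ∧
    1 / (2 * Real.pi ^ 2) * ∫ p in A ×ˢ B, covKernel g p.1 p.2 =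
      g * (2 * (∫ p in A ×ˢ B, arcsine g p.1 * arcsine g p.2 / (p.1 - p.2) ^ 2) -
        2 * ∫ p in A ×ˢ B, (p.1 / (2 * √g) * arcsine g p.1) * (p.2 / (2 * √g) * arcsine g p.2) /
          (p.1 - p.2) ^ 2) := by
  have h0 := (setIntegral_div_sub_sq hA hB hAc hBc hc (integrable_arcsine hg)
    (integrable_arcsine hg)).1
  have h1 := (setIntegral_div_sub_sq hA hB hAc hBc hc (integrable_arcsine_one hg)
    (integrable_arcsine_one hg)).1
  have hs : √g ^ 2 = g := Real.sq_sqrt hg.le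
  have hs0 : √g ≠ 0 := by positivity
  have heq : ∀ p : ℝ × ℝ, 1 / (2 * Real.pi ^ 2) * covKernel g p.1 p.2 =
      g * (2 * (arcsine g p.1 * arcsine g p.2 / (p.1 - p.2) ^ 2) -
      2 * ((p.1 / (2 * √g) * arcsine g p.1) * (p.2 / (2 * √g) * arcsine g p.2) /
          (p.1 - p.2) ^ 2)) := by
    intro p
    have h2 : g * (2 - 2 * (p.1 * p.2) / (4 * √g ^ 2)) = (4 * g - p.1 * p.2) / 2 := by
      rw [hs]; field_simp; ring
    rw [covKernel_eq, ← h2]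
    field_simp
    ring
  have hint := ((h0.const_mul 2).sub (h1.const_mul 2)).const_mul g
  refine ⟨?_, ?_⟩
  · refine (hint.const_mul (2 * Real.pi ^ 2)).congr (ae_of_all _ fun p => ?_)
    have := Real.pi_ne_zero
    have h3 := heq p
    simp only [Pi.sub_apply]
    rw [← h3]; field_simp
  · rw [← integral_const_mul]
    simp only [heq]
    rw [integral_const_mul, integral_sub (h0.const_mul 2) (h1.const_mul 2), integral_const_mul,
      integral_const_mul]

/-- The Christoffel–Darboux formula turns the mass of separated sets into integrals of
`1 / (x - y) ^ 2` against products. -/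
theorem pairMass_of_separated (hg : 0 < g) {n : ℕ} (hn : 0 < n) (hA : MeasurableSet A)
    (hB : MeasurableSet B) (hAc : A ⊆ Set.Iic c) (hBc : B ⊆ Set.Ici c') (hc : c < c') :
    pairMass (g / n) n (A ×ˢ B) = g * ((∫ p in A ×ˢ B,
      (hermiteFun (g / n) n p.1 * hermiteFun (g / n) n p.1) *
      (hermiteFun (g / n) (n - 1) p.2 * hermiteFun (g / n) (n - 1) p.2) / (p.1 - p.2) ^ 2) +
      (∫ p in A ×ˢ B, (hermiteFun (g / n) (n - 1) p.1 * hermiteFun (g / n) (n - 1) p.1) *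
      (hermiteFun (g / n) n p.2 * hermiteFun (g / n) n p.2) / (p.1 - p.2) ^ 2) -
      2 * ∫ p in A ×ˢ B, (hermiteFun (g / n) n p.1 * hermiteFun (g / n) (n - 1) p.1) *
      (hermiteFun (g / n) n p.2 * hermiteFun (g / n) (n - 1) p.2) / (p.1 - p.2) ^ 2) := by
  have hn' : (0 : ℝ) < n := Nat.cast_pos.2 hn
  have hv : 0 < g / n := div_pos hg hn'
  have i1 := (setIntegral_div_sub_sq hA hB hAc hBc hc (integrable_hermiteFun_mul hv n n)
    (integrable_hermiteFun_mul hv (n - 1) (n - 1))).1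
  have i2 := (setIntegral_div_sub_sq hA hB hAc hBc hc (integrable_hermiteFun_mul hv (n - 1) (n - 1))
    (integrable_hermiteFun_mul hv n n)).1
  have i3 := (setIntegral_div_sub_sq hA hB hAc hBc hc (integrable_hermiteFun_mul hv n (n - 1))
    (integrable_hermiteFun_mul hv n (n - 1))).1
  rw [pairMass]
  symm
  rw [← integral_add i1 i2, ← integral_const_mul 2, ← integral_sub (by exact i1.add i2)
    (i3.const_mul 2), ← integral_const_mul]
  refine setIntegral_congr_fun (hA.prod hB) fun p hp => ?_
  have hne : p.1 - p.2 ≠ 0 := by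
    have h1 : p.1 ≤ c := hAc hp.1
    have h2 : c' ≤ p.2 := hBc hp.2
    intro h; linarith
  have hcd := cdKernel_mul_sub hv n p.1 p.2
  have hs : (√(g / n) * √(n : ℝ)) ^ 2 = g := by
    rw [mul_pow, Real.sq_sqrt hv.le, Real.sq_sqrt hn'.le]; field_simp
  have hK : cdKernel (g / n) n p.1 p.2 ^ 2 = g * (hermiteFun (g / n) n p.1 *
      hermiteFun (g / n) (n - 1) p.2 - hermiteFun (g / n) (n - 1) p.1 *
      hermiteFun (g / n) n p.2) ^ 2 / (p.1 - p.2) ^ 2 := by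
    rw [eq_div_iff (pow_ne_zero 2 hne), mul_comm, ← mul_pow, hcd, mul_pow, hs]
  rw [hK]
  ring

/-- The limit of the mass of separated sets. -/
theorem tendsto_pairMass_separated (hg : 0 < g) (hA : MeasurableSet A) (hB : MeasurableSet B)
    (hfA : (frontier A).Finite) (hfB : (frontier B).Finite) (hAc : A ⊆ Set.Iic c)
    (hBc : B ⊆ Set.Ici c') (hc : c < c') :
    Tendsto (fun n : ℕ => pairMass (g / n) n (A ×ˢ B)) atTop
      (𝓝 (1 / (2 * Real.pi ^ 2) * ∫ p in A ×ˢ B, covKernel g p.1 p.2)) := by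
  rw [(integrableOn_covKernel hg hA hB hAc hBc hc).2]
  have hd0 : ∀ᶠ n : ℕ in atTop, (n : ℤ) - n = 0 := Eventually.of_forall fun n => sub_self _
  have hd0' : ∀ᶠ n : ℕ in atTop, ((n - 1 : ℕ) : ℤ) - ((n - 1 : ℕ) : ℤ) = 0 :=
    Eventually.of_forall fun n => sub_self _
  have hd1 : ∀ᶠ n : ℕ in atTop, (n : ℤ) - ((n - 1 : ℕ) : ℤ) = 1 := by
    filter_upwards [eventually_gt_atTop 0] with n hn
    omega
  have t1 := tendsto_setIntegral_div_sub_sq hg hA hB hfA hfB hAc hBc hc (integrable_arcsine hg)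
    (limitFunctional_zero_eq hg) hd0 hd0' tendsto_self_div tendsto_self_div tendsto_sub_one_div
    tendsto_sub_one_div
  have t2 := tendsto_setIntegral_div_sub_sq hg hA hB hfA hfB hAc hBc hc (integrable_arcsine hg)
    (limitFunctional_zero_eq hg) hd0' hd0 tendsto_sub_one_div
    tendsto_sub_one_div tendsto_self_div tendsto_self_div
  have t3 := tendsto_setIntegral_div_sub_sq hg hA hB hfA hfB hAc hBc hc (integrable_arcsine_one hg)
    (limitFunctional_one_eq hg) hd1 hd1 tendsto_self_div tendsto_sub_one_div tendsto_self_div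
    tendsto_sub_one_div
  have t := ((t1.add t2).sub (t3.const_mul 2)).const_mul g
  rw [← two_mul] at t
  refine t.congr' ?_
  filter_upwards [eventually_gt_atTop 0] with n hn
  exact (pairMass_of_separated hg hn hA hB hAc hBc hc).symm

end Separated

/-! ### Oscillation of the Hermite functions in the bulk -/

section Oscillation

variable {g a δ : ℝ} {n : ℕ}

/-- The rescaled derivative `φ' / n` of the Hermite function `φ = φ_n`, in terms of `φ_n` and
`φ_{n-1}`. -/
noncomputable def hermiteSlope (g : ℝ) (n : ℕ) (x : ℝ) : ℝ :=
  hermiteFun (g / n) (n - 1) x / √g - x / (2 * g) * hermiteFun (g / n) n x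

/-- The coefficient `q` in the differential equation `φ'' = - n ^ 2 q φ` of `φ = φ_n`. -/
noncomputable def phaseCoeff (g : ℝ) (n : ℕ) (x : ℝ) : ℝ :=
  (4 * g * (1 + 1 / (2 * n)) - x ^ 2) / (4 * g ^ 2)

/-- The energy `(φ' / n) ^ 2 + q φ ^ 2` of the oscillator `φ'' = - n ^ 2 q φ`. -/
noncomputable def hermiteEnergy (g : ℝ) (n : ℕ) (x : ℝ) : ℝ :=
  hermiteSlope g n x ^ 2 + phaseCoeff g n x * hermiteFun (g / n) n x ^ 2

theorem sqrt_div_sqrt_div (hg : 0 < g) (n : ℕ) : √(n : ℝ) / √(g / n) = n / √g := by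
  have h1 : √(n : ℝ) * √(n : ℝ) = n := Real.mul_self_sqrt (Nat.cast_nonneg n)
  rw [Real.sqrt_div hg.le, div_div_eq_mul_div, h1]

/-- The first equation `φ' = n χ` of the first-order system for `φ = φ_n` and its rescaled
derivative `χ`. -/
theorem hasDerivAt_hermiteFun_slope (hg : 0 < g) (hn : 0 < n) (x : ℝ) :
    HasDerivAt (hermiteFun (g / n) n) (n * hermiteSlope g n x) x := by
  have hn' : (0 : ℝ) < n := Nat.cast_pos.2 hn
  refine (hasDerivAt_hermiteFun (div_pos hg hn') n x).congr_deriv ?_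
  have hs : √g ≠ 0 := by positivity
  rw [sqrt_div_sqrt_div hg n, hermiteSlope]
  field_simp

/-- The function `φ_{n-1}` is a combination of `φ_n` and its rescaled derivative. -/
theorem hermiteFun_pred_eq (hg : 0 < g) (n : ℕ) (x : ℝ) : hermiteFun (g / n) (n - 1) x =
    √g * hermiteSlope g n x + x / (2 * √g) * hermiteFun (g / n) n x := by
  have hs : √g ≠ 0 := by positivity
  have h1 : √g ^ 2 = g := Real.sq_sqrt hg.le
  rw [hermiteSlope]
  field_simp
  linear_combination (x * hermiteFun (g / n) n x) * h1

/-- The second equation `χ' = - n q φ` of the first-order system. -/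
theorem hasDerivAt_hermiteSlope (hg : 0 < g) (hn : 0 < n) (x : ℝ) :
    HasDerivAt (hermiteSlope g n) (-(n * (phaseCoeff g n x * hermiteFun (g / n) n x))) x := by
  have hn' : (0 : ℝ) < n := Nat.cast_pos.2 hn
  have hs : √g ≠ 0 := by positivity
  have hs2 : √g ^ 2 = g := Real.sq_sqrt hg.le
  have h1 := hasDerivAt_hermiteFun' (div_pos hg hn') (n - 1) x
  have h2 : ((n - 1 : ℕ) : ℝ) + 1 = n := by rw [Nat.cast_sub hn]; push_cast; ring
  rw [h2, Nat.sub_add_cancel hn, sqrt_div_sqrt_div hg n, hermiteFun_pred_eq hg] at h1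
  have h3 := (h1.div_const √g).sub
    (((hasDerivAt_id x).div_const (2 * g)).mul (hasDerivAt_hermiteFun_slope hg hn x))
  refine h3.congr_deriv ?_
  simp only [phaseCoeff, id]
  generalize hermiteSlope g n x = c
  generalize hermiteFun (g / n) n x = p
  clear h1 h3
  generalize √g = s at *
  subst hs2
  field_simp
  ring

theorem hasDerivAt_phaseCoeff (g : ℝ) (n : ℕ) (x : ℝ) :
    HasDerivAt (phaseCoeff g n) (-(x / (2 * g ^ 2))) x := by
  have h := ((((hasDerivAt_id x).pow 2).const_sub (4 * g * (1 + 1 / (2 * (n : ℝ)))))).div_const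
    (4 * g ^ 2)
  refine h.congr_deriv ?_
  simp only [id]; push_cast; ring

/-- The energy varies slowly: the factors `n` cancel out in its derivative `q' φ ^ 2`. -/
theorem hasDerivAt_hermiteEnergy (hg : 0 < g) (hn : 0 < n) (x : ℝ) :
    HasDerivAt (hermiteEnergy g n) (-(x / (2 * g ^ 2)) * hermiteFun (g / n) n x ^ 2) x := by
  have h := ((hasDerivAt_hermiteSlope hg hn x).pow 2).add ((hasDerivAt_phaseCoeff g n x).mul
    ((hasDerivAt_hermiteFun_slope hg hn x).pow 2))
  refine h.congr_deriv ?_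
  simp only [Pi.pow_apply]
  push_cast; ring

/-- The derivative of `φ χ` is `n (χ ^ 2 - q φ ^ 2)`: the two parts of the energy agree on average.
-/
theorem hasDerivAt_hermiteFun_mul_slope (hg : 0 < g) (hn : 0 < n) (x : ℝ) :
    HasDerivAt (fun x => hermiteFun (g / n) n x * hermiteSlope g n x)
      (n * (hermiteSlope g n x ^ 2 - phaseCoeff g n x * hermiteFun (g / n) n x ^ 2)) x := by
  refine ((hasDerivAt_hermiteFun_slope hg hn x).mul
    (hasDerivAt_hermiteSlope hg hn x)).congr_deriv ?_
  ring

theorem continuous_hermiteEnergy (hg : 0 < g) (hn : 0 < n) : Continuous (hermiteEnergy g n) :=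
  continuous_iff_continuousAt.2 fun x => (hasDerivAt_hermiteEnergy hg hn x).continuousAt

theorem abs_le_of_mem {x : ℝ} (hx : x ∈ Set.Icc (a - δ) (a + δ)) : |x| ≤ |a| + δ := by
  have h1 := neg_abs_le a
  have h2 := le_abs_self a
  rw [abs_le]
  constructor <;> linarith [hx.1, hx.2]

/-- Inside the limiting support the energy is bounded by `φ_n ^ 2` and `φ_{n-1} ^ 2`, which have
mass `1`. -/
theorem hermiteEnergy_le (hg : 0 < g) (hn : 0 < n) {x : ℝ} (hx : x ^ 2 ≤ 4 * g) :
    hermiteEnergy g n x ≤ 2 / g * hermiteFun (g / n) (n - 1) x ^ 2 +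
      4 / g * hermiteFun (g / n) n x ^ 2 := by
  have hn' : (1 : ℝ) ≤ n := by exact_mod_cast hn
  have hs : √g ≠ 0 := by positivity
  have hs2 : √g ^ 2 = g := Real.sq_sqrt hg.le
  have hq : phaseCoeff g n x ≤ 2 / g := by
    rw [phaseCoeff, div_le_div_iff₀ (by positivity) hg]
    have : 1 / (2 * (n : ℝ)) ≤ 1 := by
      rw [div_le_one (by positivity)]; linarith
    have h3 : 4 * g * (1 + 1 / (2 * (n : ℝ))) - x ^ 2 ≤ 8 * g := by nlinarith [sq_nonneg x]
    nlinarith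
  have h1 : (hermiteFun (g / n) (n - 1) x / √g) ^ 2 = hermiteFun (g / n) (n - 1) x ^ 2 / g := by
    rw [div_pow, hs2]
  have h2 : (x / (2 * g) * hermiteFun (g / n) n x) ^ 2 ≤ 1 / g * hermiteFun (g / n) n x ^ 2 := by
    rw [mul_pow]
    refine mul_le_mul_of_nonneg_right ?_ (sq_nonneg _)
    rw [div_pow, div_le_div_iff₀ (by positivity) hg]
    nlinarith
  have h3 : hermiteSlope g n x ^ 2 ≤ 2 * (hermiteFun (g / n) (n - 1) x / √g) ^ 2 +
      2 * (x / (2 * g) * hermiteFun (g / n) n x) ^ 2 := by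
    rw [hermiteSlope]
    nlinarith [sq_nonneg (hermiteFun (g / n) (n - 1) x / √g +
      x / (2 * g) * hermiteFun (g / n) n x)]
  have h4 := mul_le_mul_of_nonneg_right hq (sq_nonneg (hermiteFun (g / n) n x))
  rw [hermiteEnergy]
  have h5 : 2 * (hermiteFun (g / n) (n - 1) x ^ 2 / g) + 2 * (1 / g * hermiteFun (g / n) n x ^ 2) +
      2 / g * hermiteFun (g / n) n x ^ 2 = 2 / g * hermiteFun (g / n) (n - 1) x ^ 2 +
      4 / g * hermiteFun (g / n) n x ^ 2 := by ring
  linarith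

theorem setIntegral_hermiteFun_sq_le {v : ℝ} (hv : 0 < v) (k : ℕ) (s : Set ℝ) :
    ∫ x in s, hermiteFun v k x ^ 2 ≤ 1 := by
  have h1 := integral_hermiteFun_mul hv k k
  rw [if_pos rfl] at h1
  simp only [← pow_two] at h1
  rw [← h1]
  refine setIntegral_le_integral ?_ (ae_of_all _ fun x => sq_nonneg _)
  simpa only [← pow_two] using integrable_hermiteFun_mul hv k k

theorem integrable_hermiteFun_sq {v : ℝ} (hv : 0 < v) (k : ℕ) :
    Integrable fun x => hermiteFun v k x ^ 2 := by
  simpa only [← pow_two] using integrable_hermiteFun_mul hv k k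

/-- The energy is bounded in the bulk, uniformly in `n`: its oscillation is controlled by
`∫ φ ^ 2 = 1`, and so is its mean. -/
theorem exists_hermiteEnergy_le (hg : 0 < g) (hδ : 0 < δ) (hR : |a| + δ < 2 * √g) :
    ∃ M, ∀ n : ℕ, 0 < n → ∀ x ∈ Set.Icc (a - δ) (a + δ), hermiteEnergy g n x ≤ M := by
  have hs2 : √g ^ 2 = g := Real.sq_sqrt hg.le
  set L : ℝ := 2 * √g / (2 * g ^ 2) with hL
  have hxle : ∀ x ∈ Set.Icc (a - δ) (a + δ), |x| ≤ 2 * √g := fun x hx =>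
    (abs_le_of_mem hx).trans hR.le
  refine ⟨6 / g / (2 * δ) + L, fun n hn x hx => ?_⟩
  have hn' : (0 : ℝ) < n := Nat.cast_pos.2 hn
  have hv : 0 < g / n := div_pos hg hn'
  have hosc : ∀ y ∈ Set.Icc (a - δ) (a + δ), hermiteEnergy g n x ≤ hermiteEnergy g n y + L := by
    intro y hy
    have hsub : Set.uIcc y x ⊆ Set.Icc (a - δ) (a + δ) := Set.ordConnected_Icc.uIcc_subset hy hx
    have hc : Continuous fun x => -(x / (2 * g ^ 2)) * hermiteFun (g / n) n x ^ 2 := by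
      have := continuous_hermiteFun hv n
      fun_prop
    have h1 := intervalIntegral.integral_eq_sub_of_hasDerivAt
      (fun z _ => hasDerivAt_hermiteEnergy hg hn z) (hc.intervalIntegrable y x)
    have h2 : ‖∫ z in y..x, -(z / (2 * g ^ 2)) * hermiteFun (g / n) n z ^ 2‖ ≤
        ∫ z in Set.uIoc y x, L * hermiteFun (g / n) n z ^ 2 := by
      refine (intervalIntegral.norm_integral_le_integral_norm_uIoc).trans ?_
      refine setIntegral_mono_on hc.norm.integrableOn_uIoc
        ((integrable_hermiteFun_sq hv n).const_mul L).integrableOn measurableSet_uIoc fun z hz => ?_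
      rw [norm_mul, norm_neg, Real.norm_of_nonneg (sq_nonneg _), Real.norm_eq_abs, abs_div,
        abs_of_pos (by positivity : 0 < 2 * g ^ 2)]
      have := hxle z (hsub (Set.uIoc_subset_uIcc hz))
      rw [hL]
      gcongr
    rw [integral_const_mul, h1] at h2
    have h3 := mul_le_mul_of_nonneg_left (setIntegral_hermiteFun_sq_le hv n (Set.uIoc y x))
      (by positivity : 0 ≤ L)
    have h4 := (le_abs_self _).trans h2
    linarith
  have hE := continuous_hermiteEnergy hg hn
  have h1 : ∫ y in Set.Icc (a - δ) (a + δ), (hermiteEnergy g n x - L) ≤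
      ∫ y in Set.Icc (a - δ) (a + δ), (2 / g * hermiteFun (g / n) (n - 1) y ^ 2 +
      4 / g * hermiteFun (g / n) n y ^ 2) := by
    refine setIntegral_mono_on (integrableOn_const (by simp)) (Integrable.integrableOn
      (((integrable_hermiteFun_sq hv _).const_mul _).add
      ((integrable_hermiteFun_sq hv _).const_mul _))) measurableSet_Icc fun y hy => ?_
    have h2 : y ^ 2 ≤ 4 * g := by
      rw [← sq_abs]
      have := hxle y hy
      nlinarith [abs_nonneg y]
    linarith [hosc y hy, hermiteEnergy_le hg hn h2]
  rw [integral_add ((integrable_hermiteFun_sq hv _).const_mul _).integrableOn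
    ((integrable_hermiteFun_sq hv _).const_mul _).integrableOn, integral_const_mul,
    integral_const_mul, setIntegral_const, Measure.real, Real.volume_Icc,
    ENNReal.toReal_ofReal (by linarith), smul_eq_mul] at h1
  have h2 := mul_le_mul_of_nonneg_left
    (setIntegral_hermiteFun_sq_le hv (n - 1) (Set.Icc (a - δ) (a + δ)))
    (by positivity : 0 ≤ 2 / g)
  have h3 := mul_le_mul_of_nonneg_left
    (setIntegral_hermiteFun_sq_le hv n (Set.Icc (a - δ) (a + δ)))
    (by positivity : 0 ≤ 4 / g)
  have h4 : (hermiteEnergy g n x - L) * (2 * δ) ≤ 6 / g := by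
    have : 6 / g = 2 / g * 1 + 4 / g * 1 := by ring
    rw [this]; linarith
  rw [← le_div_iff₀ (by positivity)] at h4
  linarith

end Oscillation

/-! ### Local averages of oscillating sequences -/

section LocalAverage

variable {g a δ : ℝ}

/-- Near `a` the functions `f n` are, up to `O(|x - a| + 1 / n)`, the sum of a bounded constant
`κ n` and of `1 / n` times the derivative of a bounded function: the mean of `f n` over an interval
with endpoint `a` is close to `κ n`. -/
def OscillatesAround (a δ : ℝ) (f : ℕ → ℝ → ℝ) : Prop :=
  ∃ (C : ℝ) (κ : ℕ → ℝ), ∀ᶠ n : ℕ in atTop, |κ n| ≤ C ∧ ∃ P P' : ℝ → ℝ,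
    ∀ x ∈ Set.Icc (a - δ) (a + δ), HasDerivAt P (P' x) x ∧ |P x| ≤ C ∧
      |f n x - κ n - P' x / n| ≤ C * (|x - a| + 1 / n)

variable {f f' : ℕ → ℝ → ℝ}

theorem OscillatesAround.congr (h : OscillatesAround a δ f) (hff' : ∀ᶠ n in atTop, f n = f' n) :
    OscillatesAround a δ f' := by
  obtain ⟨C, κ, h⟩ := h
  refine ⟨C, κ, ?_⟩
  filter_upwards [h, hff'] with n h1 h2
  rwa [← h2]

theorem OscillatesAround.add (h : OscillatesAround a δ f) (h' : OscillatesAround a δ f') :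
    OscillatesAround a δ fun n x => f n x + f' n x := by
  obtain ⟨C, κ, h⟩ := h
  obtain ⟨C', κ', h'⟩ := h'
  refine ⟨C + C', fun n => κ n + κ' n, ?_⟩
  filter_upwards [h, h'] with n ⟨h1, P, P', h2⟩ ⟨h1', Q, Q', h2'⟩
  refine ⟨(abs_add_le _ _).trans (add_le_add h1 h1'), fun x => P x + Q x, fun x => P' x + Q' x,
    fun x hx => ⟨(h2 x hx).1.add (h2' x hx).1,
      (abs_add_le _ _).trans (add_le_add (h2 x hx).2.1 (h2' x hx).2.1), ?_⟩⟩
  have h3 : f n x + f' n x - (κ n + κ' n) - (P' x + Q' x) / n =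
      (f n x - κ n - P' x / n) + (f' n x - κ' n - Q' x / n) := by ring
  rw [h3, add_mul]
  exact (abs_add_le _ _).trans (add_le_add (h2 x hx).2.2 (h2' x hx).2.2)

theorem OscillatesAround.const_mul (h : OscillatesAround a δ f) (c : ℝ) :
    OscillatesAround a δ fun n x => c * f n x := by
  obtain ⟨C, κ, h⟩ := h
  refine ⟨|c| * C, fun n => c * κ n, ?_⟩
  filter_upwards [h] with n ⟨h1, P, P', h2⟩
  refine ⟨?_, fun x => c * P x, fun x => c * P' x, fun x hx => ⟨(h2 x hx).1.const_mul c, ?_, ?_⟩⟩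
  · rw [abs_mul]; gcongr
  · rw [abs_mul]; gcongr; exact (h2 x hx).2.1
  · have h3 : c * f n x - c * κ n - c * P' x / n = c * (f n x - κ n - P' x / n) := by ring
    rw [h3, abs_mul, mul_assoc]
    gcongr; exact (h2 x hx).2.2

/-- The factor `x` may be replaced by `a`, and `x P'` is the derivative of `x P` up to a bounded
term. -/
theorem OscillatesAround.id_mul (h : OscillatesAround a δ f) :
    OscillatesAround a δ fun n x => x * f n x := by
  obtain ⟨C, κ, h⟩ := h
  set R := |a| + |δ| with hR
  have hR0 : 0 ≤ R := by positivity
  refine ⟨(R + 1) * C, fun n => a * κ n, ?_⟩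
  filter_upwards [h, eventually_gt_atTop 0] with n ⟨h1, P, P', h2⟩ hn
  have hC : 0 ≤ C := (abs_nonneg _).trans h1
  have hn' : (0 : ℝ) < n := Nat.cast_pos.2 hn
  have hxR : ∀ x ∈ Set.Icc (a - δ) (a + δ), |x| ≤ R := fun x hx =>
    (abs_le_of_mem hx).trans (by linarith [le_abs_self δ])
  refine ⟨?_, fun x => x * P x, fun x => P x + x * P' x, fun x hx => ⟨?_, ?_, ?_⟩⟩
  · rw [abs_mul]
    have : |a| ≤ R + 1 := by linarith [abs_nonneg δ]
    gcongr
  · refine ((hasDerivAt_id x).mul (h2 x hx).1).congr_deriv ?_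
    simp
  · rw [abs_mul]
    have := (h2 x hx).2.1
    have h3 : |x| ≤ R + 1 := by linarith [hxR x hx]
    gcongr
  · have h3 : x * f n x - a * κ n - (P x + x * P' x) / n =
        x * (f n x - κ n - P' x / n) + (x - a) * κ n - P x / n := by ring
    have h4 : |x * (f n x - κ n - P' x / n)| ≤ R * (C * (|x - a| + 1 / n)) := by
      rw [abs_mul]
      exact mul_le_mul (hxR x hx) (h2 x hx).2.2 (abs_nonneg _) hR0
    have h5 : |(x - a) * κ n| ≤ C * |x - a| := by
      rw [abs_mul, mul_comm]; gcongr
    have h6 : |P x / n| ≤ C * (1 / n) := by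
      rw [abs_div, Nat.abs_cast, mul_one_div]
      gcongr; exact (h2 x hx).2.1
    rw [h3]
    calc _ ≤ |x * (f n x - κ n - P' x / n) + (x - a) * κ n| + |P x / n| := abs_sub _ _
      _ ≤ |x * (f n x - κ n - P' x / n)| + |(x - a) * κ n| + |P x / n| := by
          gcongr; exact abs_add_le _ _
      _ ≤ R * (C * (|x - a| + 1 / n)) + C * |x - a| + C * (1 / n) := by gcongr
      _ = _ := by ring

/-- The means of an oscillating sequence over intervals having an endpoint near `a`. -/
theorem OscillatesAround.abs_integral_sub_le (h : OscillatesAround a δ f)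
    (hf : ∀ᶠ n in atTop, Continuous (f n)) :
    ∃ (C : ℝ) (κ : ℕ → ℝ), ∀ᶠ n : ℕ in atTop, |κ n| ≤ C ∧
      ∀ x ∈ Set.Icc (a - δ) (a + δ), ∀ y ∈ Set.Icc (a - δ) (a + δ), x ≤ y →
        (|x - a| ≤ 1 / n ∨ |y - a| ≤ 1 / n) →
        |(∫ u in x..y, f n u) - κ n * (y - x)| ≤ C * ((y - x) ^ 2 + 1 / n) := by
  obtain ⟨C, κ, h⟩ := h
  refine ⟨(2 + 4 * |δ|) * C + C, κ, ?_⟩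
  filter_upwards [h, hf, eventually_gt_atTop 0] with n ⟨h1, P, P', h2⟩ hfn hn
  have hC : 0 ≤ C := (abs_nonneg _).trans h1
  have hn' : (0 : ℝ) < n := Nat.cast_pos.2 hn
  refine ⟨h1.trans (by linarith [mul_nonneg (by positivity : 0 ≤ 2 + 4 * |δ|) hC]), ?_⟩
  intro x hx y hy hxy hnear
  have hδ : y - x ≤ 2 * |δ| := by linarith [hx.1, hy.2, le_abs_self δ]
  have hsub : Set.Icc x y ⊆ Set.Icc (a - δ) (a + δ) := Set.Icc_subset_Icc hx.1 hy.2
  have hdist : ∀ u ∈ Set.Icc x y, |u - a| ≤ (y - x) + 1 / n := by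
    intro u hu
    rcases hnear with h3 | h3 <;> rw [abs_le] at h3 ⊢ <;>
      constructor <;> linarith [hu.1, hu.2, h3.1, h3.2]
  -- Mean value inequality for the primitive of `f n - κ n - P' / n`.
  have hder : ∀ u ∈ Set.Icc x y, HasDerivWithinAt
      (fun z => (∫ u in x..z, f n u) - κ n * z - P z / n) (f n u - κ n - P' u / n)
      (Set.Icc x y) u := by
    intro u hu
    have d1 := intervalIntegral.integral_hasDerivAt_right (hfn.intervalIntegrable x u)
      (hfn.stronglyMeasurableAtFilter _ _) hfn.continuousAt
    have d2 := ((d1.sub ((hasDerivAt_id u).const_mul (κ n))).sub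
      ((h2 u (hsub hu)).1.div_const (n : ℝ)))
    refine (d2.congr_deriv ?_).hasDerivWithinAt
    simp
  have hbd : ∀ u ∈ Set.Icc x y, ‖f n u - κ n - P' u / n‖ ≤ C * ((y - x) + 2 / n) := by
    intro u hu
    refine (h2 u (hsub hu)).2.2.trans ?_
    have : |u - a| + 1 / n ≤ (y - x) + 2 / n := by
      have h4 : (2 : ℝ) / n = 1 / n + 1 / n := by ring
      linarith [hdist u hu]
    gcongr
  have hmv := (convex_Icc x y).norm_image_sub_le_of_norm_hasDerivWithin_le hder hbd
    (Set.left_mem_Icc.2 hxy) (Set.right_mem_Icc.2 hxy)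
  rw [intervalIntegral.integral_same, Real.norm_of_nonneg (sub_nonneg.2 hxy)] at hmv
  have h5 : |(P y - P x) / n| ≤ 2 * C / n := by
    rw [abs_div, Nat.abs_cast]
    gcongr
    have := abs_sub (P y) (P x)
    linarith [(h2 y hy).2.1, (h2 x hx).2.1]
  have h6 : (∫ u in x..y, f n u) - κ n * (y - x) =
      ((∫ u in x..y, f n u) - κ n * y - P y / n - (0 - κ n * x - P x / n)) +
      (P y - P x) / n := by ring
  rw [h6]
  calc _ ≤ _ := abs_add_le _ _
    _ ≤ C * ((y - x) + 2 / n) * (y - x) + 2 * C / n := add_le_add hmv h5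
    _ = C * (y - x) ^ 2 + (2 + 2 * (y - x)) * C * (1 / n) := by ring
    _ ≤ C * (y - x) ^ 2 + (2 + 4 * |δ|) * C * (1 / n) := by
        have h7 : 2 + 2 * (y - x) ≤ 2 + 4 * |δ| := by linarith
        have h8 := mul_le_mul_of_nonneg_right (mul_le_mul_of_nonneg_right h7 hC)
          (by positivity : 0 ≤ 1 / (n : ℝ))
        linarith
    _ ≤ _ := by
        have h7 : 0 ≤ (2 + 4 * |δ|) * C * (y - x) ^ 2 := by positivity
        have h8 : 0 ≤ C * (1 / (n : ℝ)) := by positivity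
        nlinarith

/-- Identification of the local averages through weak convergence: `κ n s` is close to `∫ f n` over
an interval of length `s`, hence to `∫ r`, hence to `r a * s`. -/
theorem tendsto_of_abs_integral_sub_le {κ : ℕ → ℝ} {r : ℝ → ℝ} {C : ℝ} (hδ : 0 < δ)
    (h : ∀ᶠ n : ℕ in atTop, ∀ s ∈ Set.Ioc 0 δ,
      |(∫ u in a..(a + s), f n u) - κ n * s| ≤ C * (s ^ 2 + 1 / n))
    (hlim : ∀ s ∈ Set.Ioc 0 δ, Tendsto (fun n => ∫ u in a..(a + s), f n u) atTop
      (𝓝 (∫ u in a..(a + s), r u)))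
    (hr : ContinuousAt r a) (hri : Integrable r) : Tendsto κ atTop (𝓝 (r a)) := by
  rw [Metric.tendsto_atTop']
  intro ε hε
  obtain ⟨η, hη, hηr⟩ := Metric.continuousAt_iff.1 hr (ε / 4) (by positivity)
  -- The length `s` is fixed before `n` tends to infinity, so that the error `C / n` is negligible.
  obtain ⟨s, hs0, hsδ, hsη, hsC⟩ : ∃ s, 0 < s ∧ s ≤ δ ∧ s < η ∧ C * s ≤ ε / 4 := by
    refine ⟨min δ (min (η / 2) (ε / 4 / (|C| + 1))), by positivity, min_le_left _ _, ?_, ?_⟩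
    · have : min δ (min (η / 2) (ε / 4 / (|C| + 1))) ≤ η / 2 :=
        (min_le_right _ _).trans (min_le_left _ _)
      linarith
    · have h1 : min δ (min (η / 2) (ε / 4 / (|C| + 1))) ≤ ε / 4 / (|C| + 1) :=
        (min_le_right _ _).trans (min_le_right _ _)
      rw [le_div_iff₀ (by positivity)] at h1
      have h2 : 0 ≤ min δ (min (η / 2) (ε / 4 / (|C| + 1))) := by positivity
      nlinarith [le_abs_self C]
  have hrs : |(∫ u in a..(a + s), r u) - r a * s| ≤ ε / 4 * s := by
    have h1 : r a * s = ∫ _ in a..(a + s), r a := by simp [mul_comm]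
    rw [h1, ← intervalIntegral.integral_sub hri.intervalIntegrable intervalIntegrable_const]
    have h2 := intervalIntegral.norm_integral_le_of_norm_le_const (a := a) (b := a + s)
      (f := fun u => r u - r a) (C := ε / 4) fun u hu => by
        rw [Set.uIoc_of_le (by linarith)] at hu
        refine (hηr ?_).le
        rw [Real.dist_eq, abs_lt]
        constructor <;> linarith [hu.1, hu.2]
    rwa [add_sub_cancel_left, abs_of_pos hs0] at h2
  have h1 : Tendsto (fun n : ℕ => |(∫ u in a..(a + s), f n u) - ∫ u in a..(a + s), r u| +
      C * (1 / (n : ℝ))) atTop (𝓝 (|(∫ u in a..(a + s), r u) - ∫ u in a..(a + s), r u| + C * 0)) :=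
    ((hlim s ⟨hs0, hsδ⟩).sub_const _).abs.add
      (tendsto_one_div_atTop_nhds_zero_nat.const_mul C)
  rw [sub_self, abs_zero, mul_zero, add_zero] at h1
  obtain ⟨N, hN⟩ := eventually_atTop.1 (h.and (h1.eventually
    (gt_mem_nhds (by positivity : 0 < ε / 4 * s))))
  refine ⟨N, fun n hn => ?_⟩
  obtain ⟨h2, h3⟩ := hN n hn.le
  have h4 := h2 s ⟨hs0, hsδ⟩
  rw [Real.dist_eq]
  have h5 : |κ n - r a| * s = |-((∫ u in a..(a + s), f n u) - κ n * s) +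
      ((∫ u in a..(a + s), f n u) - ∫ u in a..(a + s), r u) +
      ((∫ u in a..(a + s), r u) - r a * s)| := by
    rw [← abs_of_pos hs0, ← abs_mul, abs_of_pos hs0]
    congr 1; ring
  have h6 : |κ n - r a| * s < ε * s := by
    rw [h5]
    have h7 := abs_add_three (-((∫ u in a..(a + s), f n u) - κ n * s))
      ((∫ u in a..(a + s), f n u) - ∫ u in a..(a + s), r u)
      ((∫ u in a..(a + s), r u) - r a * s)
    rw [abs_neg] at h7
    have h8 : C * s ^ 2 ≤ ε / 4 * s := by nlinarith
    linarith [mul_add C (s ^ 2) (1 / (n : ℝ)), mul_pos hε hs0]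
  exact lt_of_mul_lt_mul_right h6 hs0.le

end LocalAverage

section HermiteAverage

variable {g a δ : ℝ}

/-- Bounds in the bulk that are uniform in `n`; in particular the coefficient `q` is bounded away
from `0`. -/
theorem exists_bulk_bounds (hg : 0 < g) (hδ : 0 < δ) (hR : |a| + δ < 2 * √g) :
    ∃ M q₀ : ℝ, 0 < q₀ ∧ 1 ≤ M ∧ ∀ n : ℕ, 0 < n → ∀ x ∈ Set.Icc (a - δ) (a + δ),
      q₀ ≤ phaseCoeff g n x ∧ hermiteEnergy g n x ≤ M ∧ hermiteFun (g / n) n x ^ 2 ≤ M ∧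
      hermiteSlope g n x ^ 2 ≤ M ∧ |x / (2 * g ^ 2)| ≤ M := by
  obtain ⟨M, hM⟩ := exists_hermiteEnergy_le hg hδ hR
  have hs2 : √g ^ 2 = g := Real.sq_sqrt hg.le
  set q₀ := (4 * g - (|a| + δ) ^ 2) / (4 * g ^ 2) with hq₀
  have hq₀pos : 0 < q₀ := by
    have h1 : (|a| + δ) ^ 2 < (2 * √g) ^ 2 := by
      have := abs_nonneg a
      gcongr
    have h2 : 0 < 4 * g - (|a| + δ) ^ 2 := by nlinarith
    positivity
  refine ⟨1 + |M| + |M| / q₀ + (|a| + δ) / (2 * g ^ 2), q₀, hq₀pos, ?_, ?_⟩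
  · have := abs_nonneg a
    have : 0 ≤ |M| + |M| / q₀ + (|a| + δ) / (2 * g ^ 2) := by positivity
    linarith
  intro n hn x hx
  have hn' : (0 : ℝ) < n := Nat.cast_pos.2 hn
  have hxR := abs_le_of_mem hx
  have ha := abs_nonneg a
  have e1 : 0 ≤ |M| / q₀ := by positivity
  have e2 : 0 ≤ (|a| + δ) / (2 * g ^ 2) := by positivity
  have e3 := abs_nonneg M
  have hq : q₀ ≤ phaseCoeff g n x := by
    rw [hq₀, phaseCoeff]
    have h1 : x ^ 2 ≤ (|a| + δ) ^ 2 := by rw [← sq_abs x]; gcongr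
    have h2 : 0 ≤ 1 / (2 * (n : ℝ)) := by positivity
    refine div_le_div_of_nonneg_right ?_ (by positivity)
    nlinarith [mul_nonneg hg.le h2]
  have hE := (hM n hn x hx).trans (le_abs_self M)
  have hφ : q₀ * hermiteFun (g / n) n x ^ 2 ≤ |M| := by
    have h1 := mul_le_mul_of_nonneg_right hq (sq_nonneg (hermiteFun (g / n) n x))
    rw [hermiteEnergy] at hE
    nlinarith [sq_nonneg (hermiteSlope g n x)]
  have hχ : hermiteSlope g n x ^ 2 ≤ |M| := by
    rw [hermiteEnergy] at hE
    have := mul_nonneg (hq₀pos.le.trans hq) (sq_nonneg (hermiteFun (g / n) n x))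
    linarith
  refine ⟨hq, by linarith, ?_, by linarith, ?_⟩
  · have : hermiteFun (g / n) n x ^ 2 ≤ |M| / q₀ := by
      rw [le_div_iff₀ hq₀pos]; linarith
    linarith
  · have : |x / (2 * g ^ 2)| ≤ (|a| + δ) / (2 * g ^ 2) := by
      rw [abs_div, abs_of_pos (by positivity : 0 < 2 * g ^ 2)]
      gcongr
    linarith

theorem abs_mul_le_of_sq_le {p c M : ℝ} (hp : p ^ 2 ≤ M) (hc : c ^ 2 ≤ M) : |p * c| ≤ M := by
  rw [abs_le]
  constructor <;> nlinarith [sq_nonneg (p + c), sq_nonneg (p - c)]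

/-- The energy is Lipschitz near `a`, uniformly in `n`. -/
theorem abs_energy_sub_le (hg : 0 < g) {M : ℝ} {n : ℕ} (hn : 0 < n) (hδ : 0 < δ)
    (hM : ∀ x ∈ Set.Icc (a - δ) (a + δ), hermiteFun (g / n) n x ^ 2 ≤ M ∧ |x / (2 * g ^ 2)| ≤ M)
    {x : ℝ} (hx : x ∈ Set.Icc (a - δ) (a + δ)) :
    |hermiteEnergy g n x - hermiteEnergy g n a| ≤ M * M * |x - a| := by
  have ha : a ∈ Set.Icc (a - δ) (a + δ) := ⟨by linarith, by linarith⟩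
  refine (convex_Icc (a - δ) (a + δ)).norm_image_sub_le_of_norm_hasDerivWithin_le
    (fun y _ => (hasDerivAt_hermiteEnergy hg hn y).hasDerivWithinAt) (fun y hy => ?_) ha hx
  rw [norm_mul, norm_neg, Real.norm_of_nonneg (sq_nonneg _)]
  exact mul_le_mul (hM y hy).2 (hM y hy).1 (sq_nonneg _) ((abs_nonneg _).trans (hM y hy).2)

/-- `φ χ` is `1 / n` times the derivative of `φ ^ 2 / 2`. -/
theorem oscillatesAround_hermiteFun_mul_slope (hg : 0 < g) (hδ : 0 < δ) (hR : |a| + δ < 2 * √g) :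
    OscillatesAround a δ fun n x => hermiteFun (g / n) n x * hermiteSlope g n x := by
  obtain ⟨M, q₀, -, hM1, hM⟩ := exists_bulk_bounds hg hδ hR
  refine ⟨M, fun _ => 0, ?_⟩
  filter_upwards [eventually_gt_atTop 0] with n hn
  have hn' : (0 : ℝ) < n := Nat.cast_pos.2 hn
  refine ⟨by simp; linarith, fun x => hermiteFun (g / n) n x ^ 2 / 2, fun x =>
    n * (hermiteFun (g / n) n x * hermiteSlope g n x), fun x hx => ⟨?_, ?_, ?_⟩⟩
  · refine (((hasDerivAt_hermiteFun_slope hg hn x).pow 2).div_const 2).congr_deriv ?_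
    push_cast; ring
  · rw [abs_of_nonneg (by positivity)]
    linarith [(hM n hn x hx).2.2.1]
  · rw [sub_zero, mul_div_cancel_left₀ _ hn'.ne', sub_self, abs_zero]
    positivity

/-- `χ ^ 2 = E / 2 + (φ χ)' / (2 n)` with the slowly varying energy `E`. -/
theorem oscillatesAround_slope_sq (hg : 0 < g) (hδ : 0 < δ) (hR : |a| + δ < 2 * √g) :
    OscillatesAround a δ fun n x => hermiteSlope g n x ^ 2 := by
  obtain ⟨M, q₀, hq₀, hM1, hM⟩ := exists_bulk_bounds hg hδ hR
  refine ⟨M * M, fun n => hermiteEnergy g n a / 2, ?_⟩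
  filter_upwards [eventually_gt_atTop 0] with n hn
  have hn' : (0 : ℝ) < n := Nat.cast_pos.2 hn
  have ha : a ∈ Set.Icc (a - δ) (a + δ) := ⟨by linarith, by linarith⟩
  refine ⟨?_, fun x => hermiteFun (g / n) n x * hermiteSlope g n x / 2, fun x =>
    n * (hermiteSlope g n x ^ 2 - phaseCoeff g n x * hermiteFun (g / n) n x ^ 2) / 2,
    fun x hx => ⟨?_, ?_, ?_⟩⟩
  · obtain ⟨h1, h2, -⟩ := hM n hn a ha
    rw [abs_of_nonneg]
    · nlinarith
    · rw [hermiteEnergy]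
      have := hq₀.le.trans h1
      positivity
  · exact (hasDerivAt_hermiteFun_mul_slope hg hn x).div_const 2
  · obtain ⟨-, -, h1, h2, -⟩ := hM n hn x hx
    rw [abs_div, abs_two]
    have := abs_mul_le_of_sq_le h1 h2
    nlinarith
  · have h1 := abs_energy_sub_le hg hn hδ (fun x hx => ⟨(hM n hn x hx).2.2.1,
      (hM n hn x hx).2.2.2.2⟩) hx
    have h2 : hermiteSlope g n x ^ 2 - hermiteEnergy g n a / 2 -
        n * (hermiteSlope g n x ^ 2 - phaseCoeff g n x * hermiteFun (g / n) n x ^ 2) / 2 / n =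
        (hermiteEnergy g n x - hermiteEnergy g n a) / 2 := by
      rw [hermiteEnergy, hermiteEnergy]
      field_simp; ring
    rw [h2, abs_div, abs_two]
    have h3 : 0 ≤ M * M * (1 / (n : ℝ)) := by positivity
    have h4 : 0 ≤ M * M * |x - a| := by positivity
    linarith [mul_add (M * M) |x - a| (1 / (n : ℝ))]

/-- The derivative of `- φ χ / (2 q)`. -/
theorem hasDerivAt_hermiteFun_mul_slope_div (hg : 0 < g) {n : ℕ} (hn : 0 < n) {x : ℝ}
    (hq : phaseCoeff g n x ≠ 0) :
    HasDerivAt (fun x => -(hermiteFun (g / n) n x * hermiteSlope g n x) / (2 * phaseCoeff g n x))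
      (-(n * (hermiteSlope g n x ^ 2 - phaseCoeff g n x * hermiteFun (g / n) n x ^ 2)) /
        (2 * phaseCoeff g n x) - hermiteFun (g / n) n x * hermiteSlope g n x * (x / (2 * g ^ 2)) /
        (2 * phaseCoeff g n x ^ 2)) x := by
  refine ((hasDerivAt_hermiteFun_mul_slope hg hn x).fun_neg.div
    ((hasDerivAt_phaseCoeff g n x).const_mul 2) (mul_ne_zero two_ne_zero hq)).congr_deriv ?_
  field_simp

/-- `φ ^ 2 = E / (2 q) - (φ χ)' / (2 n q)` with the slowly varying energy `E`; moving `q` under the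
derivative costs `O(1 / n)`. -/
theorem oscillatesAround_hermiteFun_sq (hg : 0 < g) (hδ : 0 < δ) (hR : |a| + δ < 2 * √g) :
    OscillatesAround a δ fun n x => hermiteFun (g / n) n x ^ 2 := by
  obtain ⟨M, q₀, hq₀, hM1, hM⟩ := exists_bulk_bounds hg hδ hR
  -- `D` bounds `E / (2 q)`, its derivative, and `φ χ` times the derivative of `1 / (2 q)`.
  set D := M * M / q₀ + M * M / q₀ ^ 2 with hD
  have hMM : M ≤ M * M := by nlinarith
  have e1 : 0 ≤ M * M / q₀ := by positivity
  have e2 : 0 ≤ M * M / q₀ ^ 2 := by positivity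
  refine ⟨D, fun n => hermiteEnergy g n a / (2 * phaseCoeff g n a), ?_⟩
  filter_upwards [eventually_gt_atTop 0] with n hn
  have hn' : (0 : ℝ) < n := Nat.cast_pos.2 hn
  have ha : a ∈ Set.Icc (a - δ) (a + δ) := ⟨by linarith, by linarith⟩
  have hqpos : ∀ x ∈ Set.Icc (a - δ) (a + δ), 0 < phaseCoeff g n x := fun x hx =>
    hq₀.trans_le (hM n hn x hx).1
  have hE0 : ∀ x ∈ Set.Icc (a - δ) (a + δ), 0 ≤ hermiteEnergy g n x := fun x hx => by
    have := hqpos x hx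
    rw [hermiteEnergy]; positivity
  refine ⟨?_, _, _, fun x hx => ⟨hasDerivAt_hermiteFun_mul_slope_div hg hn (hqpos x hx).ne',
    ?_, ?_⟩⟩
  · obtain ⟨h1, h2, -⟩ := hM n hn a ha
    have h0 := hE0 a ha
    rw [abs_of_nonneg (div_nonneg h0 (by linarith))]
    have : hermiteEnergy g n a / (2 * phaseCoeff g n a) ≤ M * M / q₀ := by
      apply div_le_div₀ <;> linarith
    linarith
  · obtain ⟨h1, -, h2, h3, -⟩ := hM n hn x hx
    have := abs_mul_le_of_sq_le h2 h3
    rw [abs_div, abs_neg, abs_of_pos (by linarith [hqpos x hx] : 0 < 2 * phaseCoeff g n x)]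
    have : |hermiteFun (g / n) n x * hermiteSlope g n x| / (2 * phaseCoeff g n x) ≤ M * M / q₀ := by
      apply div_le_div₀ <;> linarith
    linarith
  · have hqx := (hqpos x hx).ne'
    have h0 : hermiteFun (g / n) n x ^ 2 - hermiteEnergy g n a / (2 * phaseCoeff g n a) -
        (-(n * (hermiteSlope g n x ^ 2 - phaseCoeff g n x * hermiteFun (g / n) n x ^ 2)) /
        (2 * phaseCoeff g n x) - hermiteFun (g / n) n x * hermiteSlope g n x * (x / (2 * g ^ 2)) /
        (2 * phaseCoeff g n x ^ 2)) / n =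
        (hermiteEnergy g n x / (2 * phaseCoeff g n x) -
          hermiteEnergy g n a / (2 * phaseCoeff g n a)) +
        hermiteFun (g / n) n x * hermiteSlope g n x * (x / (2 * g ^ 2)) /
        (2 * phaseCoeff g n x ^ 2) * (1 / n) := by
      rw [show hermiteEnergy g n x = hermiteSlope g n x ^ 2 +
        phaseCoeff g n x * hermiteFun (g / n) n x ^ 2 from rfl]
      generalize hermiteEnergy g n a / (2 * phaseCoeff g n a) = k
      field_simp
      ring
    have hb : ∀ y ∈ Set.Icc (a - δ) (a + δ), ∀ z, |z| ≤ M →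
        |z * (y / (2 * g ^ 2)) / (2 * phaseCoeff g n y ^ 2)| ≤ M * M / q₀ ^ 2 := by
      intro y hy z hz
      have h1 := hqpos y hy
      have h2 := (hM n hn y hy).1
      rw [abs_div, abs_of_pos (by positivity : 0 < 2 * phaseCoeff g n y ^ 2), abs_mul]
      have h3 : q₀ ^ 2 ≤ phaseCoeff g n y ^ 2 := by gcongr
      apply div_le_div₀ (by positivity) _ (by positivity)
      · nlinarith
      · exact mul_le_mul hz (hM n hn y hy).2.2.2.2 (abs_nonneg _) (by linarith)
    have hlip : |hermiteEnergy g n x / (2 * phaseCoeff g n x) -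
          hermiteEnergy g n a / (2 * phaseCoeff g n a)| ≤ D * |x - a| := by
      refine (convex_Icc (a - δ) (a + δ)).norm_image_sub_le_of_norm_hasDerivWithin_le
        (f := fun y => hermiteEnergy g n y / (2 * phaseCoeff g n y))
        (f' := fun y => -(hermiteFun (g / n) n y ^ 2 * (y / (2 * g ^ 2)) /
          (2 * phaseCoeff g n y)) +
          hermiteEnergy g n y * (y / (2 * g ^ 2)) / (2 * phaseCoeff g n y ^ 2))
        (fun y hy => ?_) (fun y hy => ?_) ha hx
      · have hqy := (hqpos y hy).ne'
        refine (((hasDerivAt_hermiteEnergy hg hn y).div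
          ((hasDerivAt_phaseCoeff g n y).const_mul 2)
          (mul_ne_zero two_ne_zero hqy)).congr_deriv ?_).hasDerivWithinAt
        field_simp
        ring
      · have h1 := hqpos y hy
        obtain ⟨h2, h3, h4, -, h5⟩ := hM n hn y hy
        refine (norm_add_le _ _).trans (add_le_add ?_ (hb y hy _ ?_))
        · rw [norm_neg, norm_div, norm_mul, Real.norm_of_nonneg (sq_nonneg _),
            Real.norm_of_nonneg (by linarith : 0 ≤ 2 * phaseCoeff g n y)]
          refine div_le_div₀ (by positivity) ?_ hq₀ (by linarith)
          exact mul_le_mul h4 h5 (abs_nonneg _) (by linarith)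
        · rw [abs_of_nonneg (hE0 y hy)]; exact h3
    rw [h0]
    obtain ⟨-, -, h2, h3, -⟩ := hM n hn x hx
    have h4 := hb x hx _ (abs_mul_le_of_sq_le h2 h3)
    calc _ ≤ _ := abs_add_le _ _
      _ ≤ D * |x - a| + D * (1 / n) := by
          refine add_le_add hlip ?_
          rw [abs_mul, abs_of_pos (by positivity : 0 < 1 / (n : ℝ))]
          gcongr
          linarith
      _ = _ := by ring

theorem oscillatesAround_hermiteFun_mul_pred (hg : 0 < g) (hδ : 0 < δ)
    (hR : |a| + δ < 2 * √g) :
    OscillatesAround a δ fun n x => hermiteFun (g / n) n x * hermiteFun (g / n) (n - 1) x := by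
  refine (((oscillatesAround_hermiteFun_mul_slope hg hδ hR).const_mul √g).add
    ((oscillatesAround_hermiteFun_sq hg hδ hR).id_mul.const_mul (1 / (2 * √g)))).congr
    (Eventually.of_forall fun n => ?_)
  ext x
  rw [hermiteFun_pred_eq hg]
  ring

theorem oscillatesAround_hermiteFun_pred_sq (hg : 0 < g) (hδ : 0 < δ)
    (hR : |a| + δ < 2 * √g) :
    OscillatesAround a δ fun n x => hermiteFun (g / n) (n - 1) x ^ 2 := by
  have hs : √g ≠ 0 := by positivity
  refine ((((oscillatesAround_slope_sq hg hδ hR).const_mul (√g ^ 2)).add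
    (oscillatesAround_hermiteFun_mul_slope hg hδ hR).id_mul).add
    ((oscillatesAround_hermiteFun_sq hg hδ hR).id_mul.id_mul.const_mul (1 / (2 * √g) ^ 2))).congr
    (Eventually.of_forall fun n => ?_)
  ext x
  rw [hermiteFun_pred_eq hg]
  field_simp
  ring

end HermiteAverage

/-! ### Laplace transforms and logarithmic divergence -/

section Laplace

variable {t κ C ε δ c : ℝ} {h f : ℝ → ℝ} {S : Set ℝ}

theorem integrableOn_exp_neg_mul (ht : 0 < t) :
    IntegrableOn (fun s : ℝ => Real.exp (-(t * s))) (Set.Ioi 0) := by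
  simpa only [neg_mul] using integrableOn_exp_mul_Ioi (neg_lt_zero.2 ht) 0

theorem integral_exp_neg_mul (ht : 0 < t) (u : ℝ) :
    ∫ s in Set.Ioi u, t * Real.exp (-(t * s)) = Real.exp (-(t * u)) := by
  have h1 := integral_exp_mul_Ioi (neg_lt_zero.2 ht) u
  simp only [neg_mul] at h1
  rw [integral_const_mul, h1]
  field_simp

/-- The Laplace transform of `s ^ 2`. -/
theorem integral_sq_mul_exp (ht : 0 < t) :
    IntegrableOn (fun s : ℝ => s ^ 2 * Real.exp (-(t * s))) (Set.Ioi 0) ∧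
    ∫ s in Set.Ioi (0 : ℝ), s ^ 2 * Real.exp (-(t * s)) = 2 / t ^ 3 := by
  constructor
  · refine (integrableOn_rpow_mul_exp_neg_mul_rpow (s := 2) (p := 1) (b := t) (by norm_num)
      one_pos ht).congr_fun (fun s _ => ?_) measurableSet_Ioi
    simp only [Real.rpow_one, Real.rpow_two, neg_mul]
  · have h := Real.integral_rpow_mul_exp_neg_mul_Ioi (a := 3) three_pos ht
    rw [show (3 : ℝ) - 1 = 2 by norm_num] at h
    have hG : Real.Gamma 3 = 2 := by
      rw [show (3 : ℝ) = 2 + 1 by norm_num, Real.Gamma_add_one two_ne_zero, Real.Gamma_two, mul_one]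
    have h3 : (1 / t) ^ (3 : ℝ) = 1 / t ^ 3 := by
      rw [show (3 : ℝ) = ((3 : ℕ) : ℝ) by norm_num, Real.rpow_natCast, one_div_pow]
    simp only [Real.rpow_two] at h
    rw [h, hG, h3]; ring

/-- Integration by parts for the Laplace transform, as an instance of Fubini's theorem. -/
theorem laplace_eq (ht : 0 < t) (hh : IntegrableOn h (Set.Ioi 0)) :
    ∫ u in Set.Ioi (0 : ℝ), Real.exp (-(t * u)) * h u =
      ∫ s in Set.Ioi (0 : ℝ), t * Real.exp (-(t * s)) * ∫ u in Set.Ioc 0 s, h u ∧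
    IntegrableOn (fun s => t * Real.exp (-(t * s)) * ∫ u in Set.Ioc 0 s, h u) (Set.Ioi 0) := by
  set F : ℝ → ℝ → ℝ := fun s u => {p : ℝ × ℝ | p.2 ≤ p.1}.indicator
    (fun p => t * Real.exp (-(t * p.1)) * h p.2) (s, u) with hF
  have hint : Integrable (Function.uncurry F)
      ((volume.restrict (Set.Ioi 0)).prod (volume.restrict (Set.Ioi 0))) :=
    (((integrableOn_exp_neg_mul ht).const_mul t).mul_prod hh).indicator
      (measurableSet_le measurable_snd measurable_fst)
  have h1 : ∀ s, ∫ u in Set.Ioi (0 : ℝ), F s u =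
      t * Real.exp (-(t * s)) * ∫ u in Set.Ioc 0 s, h u := by
    intro s
    have e1 : F s = (Set.Iic s).indicator fun u => t * Real.exp (-(t * s)) * h u := by
      ext u
      by_cases hu : u ≤ s <;> simp [hF, hu]
    rw [e1, integral_indicator measurableSet_Iic, Measure.restrict_restrict measurableSet_Iic,
      Set.inter_comm, Set.Ioi_inter_Iic, integral_const_mul]
  have h2 : ∀ u ∈ Set.Ioi (0 : ℝ), ∫ s in Set.Ioi (0 : ℝ), F s u =
      Real.exp (-(t * u)) * h u := by
    intro u hu
    have e1 : (fun s => F s u) = (Set.Ici u).indicator fun s => t * Real.exp (-(t * s)) * h u := by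
      ext s
      by_cases hs : u ≤ s <;> simp [hF, hs]
    have e2 : Set.Ici u ∩ Set.Ioi 0 = Set.Ici u :=
      Set.inter_eq_left.2 fun s hs => lt_of_lt_of_le (Set.mem_Ioi.1 hu) (Set.mem_Ici.1 hs)
    rw [e1, integral_indicator measurableSet_Ici, Measure.restrict_restrict measurableSet_Ici, e2,
      integral_mul_const, integral_Ici_eq_integral_Ioi, integral_exp_neg_mul ht]
  refine ⟨?_, hint.integral_prod_left.congr (ae_of_all _ h1)⟩
  rw [← setIntegral_congr_fun measurableSet_Ioi h2, ← integral_integral_swap hint]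
  exact integral_congr_ae (ae_of_all _ h1)

/-- If the primitive of `h` is close to `κ s`, its Laplace transform is close to `κ / t`. -/
theorem abs_laplace_sub_le (ht : 0 < t) (hh : IntegrableOn h (Set.Ioi 0))
    (hG : ∀ s, 0 < s → |(∫ u in Set.Ioc 0 s, h u) - κ * s| ≤ C * (s ^ 2 + ε)) :
    |(∫ u in Set.Ioi (0 : ℝ), Real.exp (-(t * u)) * h u) - κ / t| ≤ C * (2 / t ^ 2 + ε) := by
  obtain ⟨h1, h2⟩ := laplace_eq ht hh
  have i1 : IntegrableOn (fun s : ℝ => t * κ * (s * Real.exp (-(s * t)))) (Set.Ioi 0) :=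
    (integrableOn_mul_exp ht).const_mul _
  have e1 : κ / t = ∫ s in Set.Ioi (0 : ℝ), t * κ * (s * Real.exp (-(s * t))) := by
    rw [integral_const_mul, integral_mul_exp ht]; field_simp
  have i2 : IntegrableOn (fun s : ℝ => t * C * (s ^ 2 * Real.exp (-(t * s))) +
      C * ε * (t * Real.exp (-(t * s)))) (Set.Ioi 0) :=
    ((integral_sq_mul_exp ht).1.const_mul _).add
      (((integrableOn_exp_neg_mul ht).const_mul t).const_mul _)
  have e2 : C * (2 / t ^ 2 + ε) = ∫ s in Set.Ioi (0 : ℝ), (t * C * (s ^ 2 * Real.exp (-(t * s))) +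
      C * ε * (t * Real.exp (-(t * s)))) := by
    rw [integral_add ((integral_sq_mul_exp ht).1.const_mul _)
      (((integrableOn_exp_neg_mul ht).const_mul t).const_mul _), integral_const_mul,
      integral_const_mul, (integral_sq_mul_exp ht).2, integral_exp_neg_mul ht, mul_zero, neg_zero,
      Real.exp_zero]
    field_simp
  rw [h1, e1, ← integral_sub h2 i1, e2, ← Real.norm_eq_abs]
  refine norm_integral_le_of_norm_le i2 ?_
  filter_upwards [ae_restrict_mem measurableSet_Ioi] with s hs
  have h3 : t * Real.exp (-(t * s)) * (∫ u in Set.Ioc 0 s, h u) -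
      t * κ * (s * Real.exp (-(s * t))) =
      t * Real.exp (-(t * s)) * ((∫ u in Set.Ioc 0 s, h u) - κ * s) := by
    rw [mul_comm s t]; ring
  rw [h3, norm_mul, Real.norm_of_nonneg (by positivity), Real.norm_eq_abs]
  calc _ ≤ t * Real.exp (-(t * s)) * (C * (s ^ 2 + ε)) := by gcongr; exact hG s hs
    _ = _ := by ring

/-- Laplace transform at the left end of a set, for a function with regular local averages. -/
theorem abs_setIntegral_exp_sub_le (hS : MeasurableSet S) (hSc : S ⊆ Set.Ici c) (hδ : 0 < δ)
    (hSδ : Set.Ioo c (c + δ) ⊆ S) (hf : Integrable f) (hf1 : ∫ x, |f x| ≤ 1) (hκ : |κ| ≤ C)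
    (hε : 0 ≤ ε)
    (hG : ∀ s ∈ Set.Ioo 0 δ, |(∫ u in c..(c + s), f u) - κ * s| ≤ C * (s ^ 2 + ε)) (ht : 0 < t) :
    |(∫ y in S, Real.exp (-(t * (y - c))) * f y) - κ / t| ≤
      (C + (1 + C * δ) / δ ^ 2) * (2 / t ^ 2 + ε) := by
  have hC : 0 ≤ C := (abs_nonneg _).trans hκ
  have hfS : Integrable (S.indicator f) := hf.indicator hS
  have hh : Integrable (fun u => S.indicator f (c + u)) := hfS.comp_add_left c
  have e1 : ∫ y in S, Real.exp (-(t * (y - c))) * f y =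
      ∫ u in Set.Ioi (0 : ℝ), Real.exp (-(t * u)) * S.indicator f (c + u) := by
    rw [← integral_indicator hS, ← integral_add_left_eq_self _ c, ← integral_Ici_eq_integral_Ioi,
      setIntegral_eq_integral_of_forall_compl_eq_zero]
    · refine integral_congr_ae (ae_of_all _ fun u => ?_)
      by_cases hu : c + u ∈ S <;> simp [hu]
    · intro u hu
      have : c + u ∉ S := fun h' => hu (by simpa using hSc h')
      simp [this]
  rw [e1]
  refine abs_laplace_sub_le ht hh.integrableOn fun s hs => ?_
  have hq : 0 ≤ (1 + C * δ) / δ ^ 2 := by positivity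
  rcases lt_or_ge s δ with hsδ | hsδ
  · have e2 : ∫ u in Set.Ioc 0 s, S.indicator f (c + u) = ∫ u in c..(c + s), f u := by
      have e3 : ∫ u in c..(c + s), f u = ∫ u in (0 : ℝ)..s, f (c + u) := by
        rw [intervalIntegral.integral_comp_add_left, add_zero]
      rw [e3, intervalIntegral.integral_of_le hs.le]
      refine setIntegral_congr_fun measurableSet_Ioc fun u hu => ?_
      exact Set.indicator_of_mem (hSδ ⟨by linarith [hu.1], by linarith [hu.2]⟩) f
    rw [e2]
    refine (hG s ⟨hs, hsδ⟩).trans ?_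
    gcongr
    linarith
  -- Beyond distance `δ` nothing is known about `S`, but there the error term `s ^ 2` is at least
  -- `δ ^ 2`, and `∫ |f| ≤ 1` suffices.
  · have e2 : |∫ u in Set.Ioc 0 s, S.indicator f (c + u)| ≤ 1 := by
      rw [← Real.norm_eq_abs]
      refine (norm_integral_le_integral_norm _).trans ?_
      refine (setIntegral_le_integral hh.norm (ae_of_all _ fun u => norm_nonneg _)).trans ?_
      rw [integral_add_left_eq_self (fun u => ‖S.indicator f u‖)]
      refine le_trans ?_ hf1
      refine integral_mono hfS.norm hf.abs fun u => ?_
      exact norm_indicator_le_norm_self f u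
    have e3 : |κ * s| ≤ C * s := by rw [abs_mul, abs_of_pos hs]; gcongr
    have e4 : 1 + C * s ≤ (1 + C * δ) / δ ^ 2 * s ^ 2 := by
      rw [div_mul_eq_mul_div, le_div_iff₀ (by positivity)]
      have h1 : δ ^ 2 ≤ s ^ 2 := by gcongr
      have h2 : C * s * δ ^ 2 ≤ C * δ * s ^ 2 := by
        have := mul_nonneg (mul_nonneg hC hs.le) (mul_nonneg hδ.le (sub_nonneg.2 hsδ))
        nlinarith
      nlinarith
    calc _ ≤ 1 + C * s := (abs_sub _ _).trans (add_le_add e2 e3)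
      _ ≤ (1 + C * δ) / δ ^ 2 * s ^ 2 := e4
      _ ≤ _ := by
        have h3 : 0 ≤ C * s ^ 2 := by positivity
        have h4 : 0 ≤ (C + (1 + C * δ) / δ ^ 2) * ε := by positivity
        nlinarith

/-- Laplace transform at the right end of a set, for a function with regular local averages: the
reflection of `abs_setIntegral_exp_sub_le`. -/
theorem abs_setIntegral_exp_sub_le' (hS : MeasurableSet S) (hSc : S ⊆ Set.Iic c) (hδ : 0 < δ)
    (hSδ : Set.Ioo (c - δ) c ⊆ S) (hf : Integrable f) (hf1 : ∫ x, |f x| ≤ 1) (hκ : |κ| ≤ C)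
    (hε : 0 ≤ ε)
    (hG : ∀ s ∈ Set.Ioo 0 δ, |(∫ u in (c - s)..c, f u) - κ * s| ≤ C * (s ^ 2 + ε)) (ht : 0 < t) :
    |(∫ y in S, Real.exp (-(t * (c - y))) * f y) - κ / t| ≤
      (C + (1 + C * δ) / δ ^ 2) * (2 / t ^ 2 + ε) := by
  have e1 := (Measure.measurePreserving_neg (volume : Measure ℝ)).setIntegral_preimage_emb
    (Homeomorph.neg ℝ).measurableEmbedding (fun y => Real.exp (-(t * (c - y))) * f y) S
  rw [← e1]
  have e2 : ∀ x : ℝ, Real.exp (-(t * (c - -x))) * f (-x) =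
      Real.exp (-(t * (x - -c))) * f (-x) := fun x => by
    congr 3; ring
  simp only [e2]
  refine abs_setIntegral_exp_sub_le (f := fun x => f (-x)) (hS.preimage measurable_neg)
    (fun x hx => ?_) hδ (fun x hx => ?_) hf.comp_neg ?_ hκ hε (fun s hs => ?_) ht
  · have : -x ≤ c := hSc hx
    exact neg_le.1 this
  · exact hSδ ⟨by linarith [hx.2], by linarith [hx.1]⟩
  · rwa [integral_neg_eq_self (fun x => |f x|)]
  · rw [intervalIntegral.integral_comp_neg (fun x => f x), neg_neg, neg_add, neg_neg,
      ← sub_eq_add_neg]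
    exact hG s hs

/-- The pointwise comparison behind the logarithmic divergence: two Laplace transforms `α` and `β`
close to `κ / t` and `κ' / t` make the integrand close to `κ κ' / t` for `1 < t ≤ N` and negligible
otherwise. Each of the three terms of the bound has an integral over `t > 0` that does not depend
on `N`. -/
theorem abs_mul_exp_sub_le {α β κ κ' N : ℝ} (hN : 1 ≤ N) (ht : 0 < t) (hα : |α| ≤ 1)
    (hβ : |β| ≤ 1) (hκ : |κ| ≤ C) (hκ' : |κ'| ≤ C) (hακ : |α - κ / t| ≤ C * (2 / t ^ 2 + 1 / N))
    (hβκ : |β - κ' / t| ≤ C * (2 / t ^ 2 + 1 / N)) :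
    |t * Real.exp (-(t * (1 / N))) * (α * β) -
      (Set.Ioc 1 N).indicator (fun t => κ * κ' * t⁻¹) t| ≤
      (24 * C ^ 2 + 2) * ((1 + t ^ 2)⁻¹ + 1 / N * Real.exp (-(t * (1 / N))) +
        (1 / N) ^ 2 * (t * Real.exp (-(t * (1 / N))))) := by
  have hC : 0 ≤ C := (abs_nonneg _).trans hκ
  set e := Real.exp (-(t * (1 / N))) with he
  have he0 : 0 < e := Real.exp_pos _
  have he1 : e ≤ 1 := by
    rw [he, Real.exp_le_one_iff]
    have : 0 ≤ t * (1 / N) := by positivity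
    linarith
  set b := 1 / N with hb
  have hb0 : 0 < b := by positivity
  -- For `t ≤ 1` the integrand is at most `1`, and `(1 + t ^ 2)⁻¹` is at least `1 / 2`.
  rcases le_or_gt t 1 with ht1 | ht1
  · rw [Set.indicator_of_notMem (fun h => absurd h.1 (not_lt.2 ht1)), sub_zero, abs_mul, abs_mul α,
      abs_of_pos (by positivity : 0 < t * e)]
    have h1 : t * e * (|α| * |β|) ≤ 1 * 1 * (1 * 1) := by gcongr
    have h2 : (1 : ℝ) / 2 ≤ (1 + t ^ 2)⁻¹ := by
      rw [← one_div]
      apply one_div_le_one_div_of_le (by positivity)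
      nlinarith
    have h3 : (2 : ℝ) ≤ 24 * C ^ 2 + 2 := by nlinarith [sq_nonneg C]
    calc _ ≤ (1 : ℝ) := by linarith
      _ = 2 * (1 / 2) := by norm_num
      _ ≤ (24 * C ^ 2 + 2) * ((1 + t ^ 2)⁻¹ + b * e + b ^ 2 * (t * e)) := by
        have h4 : 0 ≤ b * e + b ^ 2 * (t * e) := by positivity
        gcongr; linarith
  · set u := 1 / t with hu
    have hu0 : 0 < u := by positivity
    have hu1 : u ≤ 1 := by rw [hu, div_le_one ht]; exact ht1.le
    have htu : t * u = 1 := by rw [hu]; field_simp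
    have h2u : 2 / t ^ 2 = 2 * u ^ 2 := by rw [hu]; ring
    rw [h2u] at hακ hβκ
    have hκu : κ / t = κ * u := by rw [hu]; ring
    have hκu' : κ' / t = κ' * u := by rw [hu]; ring
    rw [hκu] at hακ
    rw [hκu'] at hβκ
    set x := α - κ * u with hx
    set y := β - κ' * u with hy
    -- The main term, with `u = 1 / t`: for `t ≤ N` the factor `e` is `1 - O(t / N)` and at least
    -- `1 / 3`, and for `t > N` it remains to use `u ≤ 1 / N`.
    have hmain : |κ * κ' * u * e - (Set.Ioc 1 N).indicator (fun t => κ * κ' * t⁻¹) t| ≤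
        3 * C ^ 2 * (b * e) := by
      have hκκ : |κ * κ'| ≤ C ^ 2 := by
        rw [abs_mul, pow_two]; gcongr
      rcases le_or_gt t N with htN | htN
      · rw [Set.indicator_of_mem (show t ∈ Set.Ioc 1 N from ⟨ht1, htN⟩)]
        have htb : t * b ≤ 1 := by rw [hb, mul_one_div]; exact (div_le_one (by linarith)).2 htN
        have h1 : 1 - t * b ≤ e := by
          have := Real.add_one_le_exp (-(t * b))
          linarith
        have h2 : 1 ≤ 3 * e := by
          have h3 : Real.exp (-1) ≤ e := Real.exp_le_exp.2 (by linarith)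
          have h4 : Real.exp 1 < 3 := by linarith [Real.exp_one_lt_d9]
          rw [Real.exp_neg] at h3
          have h5 : (1 : ℝ) / 3 ≤ (Real.exp 1)⁻¹ := by
            rw [← one_div]
            exact one_div_le_one_div_of_le (Real.exp_pos 1) h4.le
          linarith
        have h6 : κ * κ' * u * e - κ * κ' * t⁻¹ = κ * κ' * (u * (e - 1)) := by
          rw [← one_div, ← hu]; ring
        have h7 : |u * (e - 1)| ≤ b := by
          rw [abs_mul, abs_of_pos hu0, abs_of_nonpos (by linarith)]
          have := mul_le_mul_of_nonneg_left (show -(e - 1) ≤ t * b by linarith) hu0.le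
          rw [← mul_assoc, mul_comm u t, htu] at this
          linarith
        rw [h6, abs_mul]
        calc _ ≤ C ^ 2 * b := by gcongr
          _ ≤ C ^ 2 * b * (3 * e) := le_mul_of_one_le_right (by positivity) h2
          _ = _ := by ring
      · rw [Set.indicator_of_notMem (fun h => absurd h.2 (not_le.2 htN)), sub_zero, abs_mul,
          abs_mul, abs_of_pos hu0, abs_of_pos he0]
        have h1 : u ≤ b := one_div_le_one_div_of_le (by linarith) htN.le
        calc _ ≤ C ^ 2 * b * e := by gcongr
          _ ≤ 3 * C ^ 2 * (b * e) := by
            have : 0 ≤ C ^ 2 * (b * e) := by positivity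
            linarith
    have hdec : t * e * (α * β) - (Set.Ioc 1 N).indicator (fun t => κ * κ' * t⁻¹) t =
        (κ * κ' * u * e - (Set.Ioc 1 N).indicator (fun t => κ * κ' * t⁻¹) t) +
        (κ * y * e + κ' * x * e + t * e * (x * y)) := by
      have h1 : α = x + κ * u := by rw [hx]; ring
      have h2 : β = y + κ' * u := by rw [hy]; ring
      rw [h1, h2]
      linear_combination (e * κ * κ' * u + e * κ * y + e * κ' * x) * htu
    have hz : ∀ {z w : ℝ}, |z| ≤ C * (2 * u ^ 2 + b) → |w| ≤ C →
        |w * z * e| ≤ C ^ 2 * (2 * u ^ 2 + b * e) := by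
      intro z w hz hw
      rw [abs_mul, abs_mul, abs_of_pos he0]
      calc _ ≤ C * (C * (2 * u ^ 2 + b)) * e := by gcongr
        _ = C ^ 2 * (2 * u ^ 2 * e + b * e) := by ring
        _ ≤ _ := by
          have : 2 * u ^ 2 * e ≤ 2 * u ^ 2 := mul_le_of_le_one_right (by positivity) he1
          gcongr
    have hxy : |t * e * (x * y)| ≤ C ^ 2 * (8 * u ^ 2 + 2 * (b ^ 2 * (t * e))) := by
      rw [abs_mul, abs_mul x, abs_of_pos (by positivity : 0 < t * e)]
      have h1 : (2 * u ^ 2 + b) ^ 2 ≤ 8 * u ^ 4 + 2 * b ^ 2 := by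
        nlinarith [sq_nonneg (2 * u ^ 2 - b)]
      have h2 : t * e * (8 * u ^ 4) ≤ 8 * u ^ 2 := by
        have h3 : t * e * (8 * u ^ 4) = (t * u) * (e * (8 * u ^ 3)) := by ring
        rw [h3, htu, one_mul]
        have h4 : u ^ 3 ≤ u ^ 2 := pow_le_pow_of_le_one hu0.le hu1 (by norm_num)
        calc e * (8 * u ^ 3) ≤ 1 * (8 * u ^ 2) := by gcongr
          _ = _ := one_mul _
      calc _ ≤ t * e * ((C * (2 * u ^ 2 + b)) * (C * (2 * u ^ 2 + b))) := by gcongr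
        _ = C ^ 2 * (t * e * (2 * u ^ 2 + b) ^ 2) := by ring
        _ ≤ C ^ 2 * (t * e * (8 * u ^ 4 + 2 * b ^ 2)) := by gcongr
        _ = C ^ 2 * (t * e * (8 * u ^ 4) + 2 * (b ^ 2 * (t * e))) := by ring
        _ ≤ _ := by gcongr
    have hu2 : u ^ 2 ≤ 2 * (1 + t ^ 2)⁻¹ := by
      rw [hu, one_div_pow, ← div_eq_mul_inv, div_le_div_iff₀ (by positivity) (by positivity)]
      nlinarith
    rw [hdec]
    calc _ ≤ _ := abs_add_le _ _
      _ ≤ 3 * C ^ 2 * (b * e) + (C ^ 2 * (2 * u ^ 2 + b * e) + C ^ 2 * (2 * u ^ 2 + b * e) +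
          C ^ 2 * (8 * u ^ 2 + 2 * (b ^ 2 * (t * e)))) := by
        refine add_le_add hmain ((abs_add_three _ _ _).trans ?_)
        gcongr
        · exact hz hβκ hκ
        · exact hz hακ hκ'
      _ = C ^ 2 * (12 * u ^ 2 + 5 * (b * e) + 2 * (b ^ 2 * (t * e))) := by ring
      _ ≤ C ^ 2 * (24 * ((1 + t ^ 2)⁻¹ + b * e + b ^ 2 * (t * e))) := by
        have h1 : 0 ≤ b * e := by positivity
        have h2 : 0 ≤ b ^ 2 * (t * e) := by positivity
        gcongr; linarith
      _ ≤ _ := by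
        have h1 : 0 ≤ (1 + t ^ 2)⁻¹ + b * e + b ^ 2 * (t * e) := by positivity
        linarith

/-- If the Laplace transforms `IA n` and `IB n` behave like `κ n / t` and `κ' n / t` on the scales
`1 ≪ t ≪ n`, the integral of their product diverges like `∫_1^n κ n κ' n dt / t`. -/
theorem tendsto_laplace_div_log {IA IB : ℕ → ℝ → ℝ} {κ κ' : ℕ → ℝ} {k k' : ℝ}
    (hκ : Tendsto κ atTop (𝓝 k)) (hκ' : Tendsto κ' atTop (𝓝 k'))
    (h : ∀ᶠ n : ℕ in atTop, |κ n| ≤ C ∧ |κ' n| ≤ C ∧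
      IntegrableOn (fun t => t * Real.exp (-(t * (1 / (n : ℝ)))) * (IA n t * IB n t)) (Set.Ioi 0) ∧
      ∀ t, 0 < t → |IA n t| ≤ 1 ∧ |IB n t| ≤ 1 ∧ |IA n t - κ n / t| ≤ C * (2 / t ^ 2 + 1 / n) ∧
        |IB n t - κ' n / t| ≤ C * (2 / t ^ 2 + 1 / n)) :
    Tendsto (fun n : ℕ => (∫ t in Set.Ioi (0 : ℝ),
      t * Real.exp (-(t * (1 / (n : ℝ)))) * (IA n t * IB n t)) / Real.log n) atTop
      (𝓝 (k * k')) := by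
  set D := (24 * C ^ 2 + 2) * (Real.pi / 2 + 1 + 1) with hD
  have hD0 : 0 ≤ D := by have := Real.pi_pos; positivity
  have hbound : ∀ᶠ n : ℕ in atTop, |(∫ t in Set.Ioi (0 : ℝ),
      t * Real.exp (-(t * (1 / (n : ℝ)))) * (IA n t * IB n t)) - κ n * κ' n * Real.log n| ≤ D := by
    filter_upwards [h, eventually_ge_atTop 1] with n ⟨h1, h2, h3, h4⟩ hn
    have hn' : (1 : ℝ) ≤ n := by exact_mod_cast hn
    have hb : (0 : ℝ) < 1 / n := by positivity
    have i1 : IntegrableOn (fun t => κ n * κ' n * t⁻¹) (Set.Ioc 1 (n : ℝ)) := by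
      refine IntegrableOn.mono_set (ContinuousOn.integrableOn_Icc ?_) Set.Ioc_subset_Icc_self
      exact continuousOn_const.mul (continuousOn_inv₀.mono fun x hx =>
        ne_of_gt (lt_of_lt_of_le one_pos hx.1))
    have hsub : Set.Ioc 1 (n : ℝ) ⊆ Set.Ioi 0 := fun x hx => lt_trans one_pos hx.1
    have e1 : κ n * κ' n * Real.log n = ∫ t in Set.Ioi (0 : ℝ),
        (Set.Ioc 1 (n : ℝ)).indicator (fun t => κ n * κ' n * t⁻¹) t := by
      rw [setIntegral_indicator measurableSet_Ioc, Set.inter_eq_right.2 hsub,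
        ← intervalIntegral.integral_of_le hn', intervalIntegral.integral_const_mul,
        integral_inv_of_pos one_pos (by linarith), div_one]
    have i2 : IntegrableOn ((Set.Ioc 1 (n : ℝ)).indicator (fun t => κ n * κ' n * t⁻¹))
        (Set.Ioi 0) := (i1.integrable_indicator measurableSet_Ioc).integrableOn
    have i3 : IntegrableOn (fun t : ℝ => (1 + t ^ 2)⁻¹) (Set.Ioi 0) :=
      integrable_inv_one_add_sq.integrableOn
    have hcomm : ∀ t : ℝ, t * (1 / (n : ℝ)) = 1 / (n : ℝ) * t := fun t => mul_comm _ _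
    have i4 : IntegrableOn (fun t : ℝ => 1 / (n : ℝ) * Real.exp (-(t * (1 / (n : ℝ)))))
        (Set.Ioi 0) := by
      simp only [hcomm]
      exact (integrableOn_exp_neg_mul hb).const_mul (1 / (n : ℝ))
    have i5 : IntegrableOn (fun t : ℝ => (1 / (n : ℝ)) ^ 2 *
        (t * Real.exp (-(t * (1 / (n : ℝ)))))) (Set.Ioi 0) :=
      (integrableOn_mul_exp hb).const_mul _
    have e2 : D = ∫ t in Set.Ioi (0 : ℝ), (24 * C ^ 2 + 2) * ((1 + t ^ 2)⁻¹ +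
        1 / (n : ℝ) * Real.exp (-(t * (1 / (n : ℝ)))) +
        (1 / (n : ℝ)) ^ 2 * (t * Real.exp (-(t * (1 / (n : ℝ)))))) := by
      have e3 : ∫ t in Set.Ioi (0 : ℝ), 1 / (n : ℝ) * Real.exp (-(t * (1 / (n : ℝ)))) = 1 := by
        have := integral_exp_neg_mul hb 0
        rw [mul_zero, neg_zero, Real.exp_zero] at this
        simpa only [hcomm] using this
      rw [integral_const_mul, integral_add (by exact i3.add i4) i5, integral_add i3 i4, e3,
        integral_const_mul, integral_mul_exp hb, integral_Ioi_inv_one_add_sq, Real.arctan_zero,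
        sub_zero, mul_inv_cancel₀ (by positivity)]
    rw [e1, ← integral_sub h3 i2, e2, ← Real.norm_eq_abs]
    refine norm_integral_le_of_norm_le (((i3.add i4).add i5).const_mul _) ?_
    filter_upwards [ae_restrict_mem measurableSet_Ioi] with t ht
    obtain ⟨h5, h6, h7, h8⟩ := h4 t ht
    exact abs_mul_exp_sub_le hn' ht h5 h6 h1 h2 h7 h8
  have hlog : Tendsto (fun n : ℕ => Real.log n) atTop atTop :=
    Real.tendsto_log_atTop.comp tendsto_natCast_atTop_atTop
  have hz : Tendsto (fun n : ℕ => ((∫ t in Set.Ioi (0 : ℝ),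
      t * Real.exp (-(t * (1 / (n : ℝ)))) * (IA n t * IB n t)) - κ n * κ' n * Real.log n) /
      Real.log n) atTop (𝓝 0) := by
    refine squeeze_zero_norm' ?_ (hlog.const_div_atTop D)
    filter_upwards [hbound, hlog.eventually_gt_atTop 0] with n h1 h2
    rw [norm_div, Real.norm_of_nonneg h2.le]
    gcongr
    exact h1
  have := hz.add (hκ.mul hκ')
  rw [zero_add] at this
  refine this.congr' ?_
  filter_upwards [hlog.eventually_gt_atTop 0] with n h2
  field_simp
  ring

end Laplace

/-! ### Touching sets -/

section Touching

variable {g a δ : ℝ} {A B : Set ℝ}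

theorem continuousAt_arcsine (hg : 0 < g) (ha : |a| < 2 * √g) : ContinuousAt (arcsine g) a := by
  have hs2 : √g ^ 2 = g := Real.sq_sqrt hg.le
  have h1 : 0 < 4 * g - a ^ 2 := by
    have h2 : a ^ 2 < (2 * √g) ^ 2 := by rw [← sq_abs]; gcongr
    nlinarith
  unfold arcsine
  refine ContinuousAt.inv₀ (by fun_prop) ?_
  have := Real.pi_pos
  have := Real.sqrt_pos.2 h1
  positivity

/-- A local average of products of Hermite functions converges to the limiting density. -/
theorem tendsto_local_average (hg : 0 < g) (hδ : 0 < δ) {i j : ℕ → ℕ} {d : ℤ} {r : ℝ → ℝ}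
    (hr : Integrable r) (hra : ContinuousAt r a)
    (hlim : ∀ F, limitFunctional g d F = ∫ x, F x * r x)
    (hd : ∀ᶠ n in atTop, (i n : ℤ) - j n = d)
    (hi : Tendsto (fun n => (i n : ℝ) / n) atTop (𝓝 1))
    (hj : Tendsto (fun n => (j n : ℝ) / n) atTop (𝓝 1))
    (h : OscillatesAround a δ fun n x => hermiteFun (g / n) (i n) x * hermiteFun (g / n) (j n) x) :
    ∃ (C : ℝ) (κ : ℕ → ℝ), Tendsto κ atTop (𝓝 (r a)) ∧ ∀ᶠ n : ℕ in atTop, |κ n| ≤ C ∧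
      ∀ x ∈ Set.Icc (a - δ) (a + δ), ∀ y ∈ Set.Icc (a - δ) (a + δ), x ≤ y →
        (|x - a| ≤ 1 / n ∨ |y - a| ≤ 1 / n) →
        |(∫ u in x..y, hermiteFun (g / n) (i n) u * hermiteFun (g / n) (j n) u) - κ n * (y - x)| ≤
          C * ((y - x) ^ 2 + 1 / n) := by
  have hcont : ∀ᶠ n : ℕ in atTop, Continuous
      fun x => hermiteFun (g / n) (i n) x * hermiteFun (g / n) (j n) x := by
    filter_upwards [eventually_gt_atTop 0] with n hn
    have hv : 0 < g / n := div_pos hg (Nat.cast_pos.2 hn)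
    exact (continuous_hermiteFun hv _).mul (continuous_hermiteFun hv _)
  obtain ⟨C, κ, hC⟩ := h.abs_integral_sub_le hcont
  refine ⟨C, κ, tendsto_of_abs_integral_sub_le (C := C)
    (f := fun n x => hermiteFun (g / n) (i n) x * hermiteFun (g / n) (j n) x) hδ ?_
    (fun s hs => ?_) hra hr, hC⟩
  · filter_upwards [hC] with n ⟨_, h2⟩ s hs
    have := h2 a ⟨by linarith, by linarith⟩ (a + s) ⟨by linarith [hs.1], by linarith [hs.2]⟩
      (by linarith [hs.1]) (Or.inl (by rw [sub_self, abs_zero]; positivity))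
    rwa [add_sub_cancel_left] at this
  · have h3 : a ≤ a + s := by linarith [hs.1]
    have h4 := tendsto_setIntegral_hermiteFun hg (A := Set.Ioc a (a + s)) measurableSet_Ioc
      (by rw [frontier_Ioc (by linarith [hs.1])]; exact Set.toFinite _) (w := fun _ => 1)
      continuous_const (fun _ _ => by simp) hd hi hj
    rw [hlim, integral_indicator_mul_arcsine measurableSet_Ioc] at h4
    simp only [one_mul] at h4
    simpa only [intervalIntegral.integral_of_le h3] using h4

/-- The contribution of one product of Hermite functions to the mass of two touching sets, with a
gap of width `1 / n` cut out. The gap turns into the factor `exp (-t / n)` in the integral over `t`.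
-/
theorem tendsto_touching_term (hg : 0 < g) (hA : MeasurableSet A) (hB : MeasurableSet B)
    (hAa : A ⊆ Set.Iic a) (hδ : 0 < δ) (hAδ : Set.Ioo (a - δ) a ⊆ A)
    (hBδ : Set.Ioo a (a + δ) ⊆ B) {i j i' j' : ℕ → ℕ} {d : ℤ} {r : ℝ → ℝ}
    (hr : Integrable r) (hra : ContinuousAt r a)
    (hlim : ∀ F, limitFunctional g d F = ∫ x, F x * r x)
    (hd : ∀ᶠ n in atTop, (i n : ℤ) - j n = d) (hd' : ∀ᶠ n in atTop, (i' n : ℤ) - j' n = d)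
    (hi : Tendsto (fun n => (i n : ℝ) / n) atTop (𝓝 1))
    (hj : Tendsto (fun n => (j n : ℝ) / n) atTop (𝓝 1))
    (hi' : Tendsto (fun n => (i' n : ℝ) / n) atTop (𝓝 1))
    (hj' : Tendsto (fun n => (j' n : ℝ) / n) atTop (𝓝 1))
    (h : OscillatesAround a δ fun n x => hermiteFun (g / n) (i n) x * hermiteFun (g / n) (j n) x)
    (h' : OscillatesAround a δ fun n x =>
      hermiteFun (g / n) (i' n) x * hermiteFun (g / n) (j' n) x) :
    Tendsto (fun n : ℕ => (∫ p in A ×ˢ (B ∩ Set.Ici (a + 1 / n)),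
      (hermiteFun (g / n) (i n) p.1 * hermiteFun (g / n) (j n) p.1) *
      (hermiteFun (g / n) (i' n) p.2 * hermiteFun (g / n) (j' n) p.2) / (p.1 - p.2) ^ 2) /
      Real.log n) atTop (𝓝 (r a * r a)) := by
  obtain ⟨C, κ, hκ, hC⟩ := tendsto_local_average hg hδ hr hra hlim hd hi hj h
  obtain ⟨C', κ', hκ', hC'⟩ := tendsto_local_average hg hδ hr hra hlim hd' hi' hj' h'
  set δ' := δ / 2 with hδ'
  have hδ'0 : 0 < δ' := by positivity
  set M := |C| + |C'| with hM
  have hM0 : 0 ≤ M := by positivity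
  have hCM : C ≤ M := by linarith [le_abs_self C, abs_nonneg C']
  have hCM' : C' ≤ M := by linarith [le_abs_self C', abs_nonneg C]
  set D := M + (1 + M * δ') / δ' ^ 2 with hD
  have hMD : M ≤ D := by
    have : 0 ≤ (1 + M * δ') / δ' ^ 2 := by positivity
    linarith
  have hsmall : ∀ᶠ n : ℕ in atTop, 1 / (n : ℝ) < δ' :=
    tendsto_one_div_atTop_nhds_zero_nat.eventually (gt_mem_nhds hδ'0)
  have key := tendsto_laplace_div_log (C := D) (κ := κ) (κ' := κ')
    (IA := fun n t => ∫ x in A, Real.exp (-(t * (a - x))) *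
      (hermiteFun (g / n) (i n) x * hermiteFun (g / n) (j n) x))
    (IB := fun n t => ∫ y in B ∩ Set.Ici (a + 1 / n), Real.exp (-(t * (y - (a + 1 / n)))) *
      (hermiteFun (g / n) (i' n) y * hermiteFun (g / n) (j' n) y)) hκ hκ' ?_
  · refine key.congr' ?_
    filter_upwards [eventually_gt_atTop 0] with n hn
    have hn' : (0 : ℝ) < n := Nat.cast_pos.2 hn
    have hv : 0 < g / n := div_pos hg hn'
    have hlt : a < a + 1 / (n : ℝ) := by
      have : 0 < 1 / (n : ℝ) := by positivity
      linarith
    rw [(setIntegral_div_sub_sq hA (hB.inter measurableSet_Ici) hAa Set.inter_subset_right hlt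
      (integrable_hermiteFun_mul hv _ _) (integrable_hermiteFun_mul hv _ _)).2.1,
      add_sub_cancel_left]
  filter_upwards [hC, hC', hsmall, eventually_gt_atTop 0] with n ⟨h1, h2⟩ ⟨h1', h2'⟩ h3 hn
  have hn' : (0 : ℝ) < n := Nat.cast_pos.2 hn
  have hv : 0 < g / n := div_pos hg hn'
  have hb : 0 < 1 / (n : ℝ) := by positivity
  have hlt : a < a + 1 / (n : ℝ) := by linarith
  have hBm : MeasurableSet (B ∩ Set.Ici (a + 1 / (n : ℝ))) := hB.inter measurableSet_Ici
  refine ⟨(h1.trans hCM).trans hMD, (h1'.trans hCM').trans hMD, ?_, fun t ht =>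
    ⟨?_, ?_, ?_, ?_⟩⟩
  · have := (setIntegral_div_sub_sq hA hBm hAa Set.inter_subset_right hlt
      (integrable_hermiteFun_mul hv (i n) (j n)) (integrable_hermiteFun_mul hv (i' n) (j' n))).2.2
    simpa only [add_sub_cancel_left] using this
  · refine abs_setIntegral_mul_hermiteFun_le hv hA _ _ fun x hx => ?_
    have h4 : x ≤ a := hAa hx
    rw [abs_of_pos (Real.exp_pos _), Real.exp_le_one_iff]
    have := mul_nonneg ht.le (sub_nonneg.2 h4)
    linarith
  · refine abs_setIntegral_mul_hermiteFun_le hv hBm _ _ fun x hx => ?_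
    have h4 : a + 1 / (n : ℝ) ≤ x := hx.2
    rw [abs_of_pos (Real.exp_pos _), Real.exp_le_one_iff]
    have := mul_nonneg ht.le (sub_nonneg.2 h4)
    linarith
  · refine abs_setIntegral_exp_sub_le' hA hAa hδ'0 (fun x hx => hAδ ⟨?_, hx.2⟩)
      (integrable_hermiteFun_mul hv _ _) (integral_abs_hermiteFun_mul_le hv _ _)
      (h1.trans hCM) hb.le (fun s hs => ?_) ht
    · linarith [hx.1]
    · have h4 := h2 (a - s) ⟨by linarith [hs.2], by linarith [hs.1]⟩ a
        ⟨by linarith, by linarith⟩ (by linarith [hs.1])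
        (Or.inr (by rw [sub_self, abs_zero]; exact hb.le))
      rw [sub_sub_cancel] at h4
      refine h4.trans ?_
      gcongr
  · refine abs_setIntegral_exp_sub_le hBm Set.inter_subset_right hδ'0
      (fun x hx => ⟨hBδ ⟨hlt.trans hx.1, ?_⟩, hx.1.le⟩)
      (integrable_hermiteFun_mul hv _ _) (integral_abs_hermiteFun_mul_le hv _ _)
      (h1'.trans hCM') hb.le (fun s hs => ?_) ht
    · linarith [hx.2]
    · have h4 := h2' (a + 1 / n) ⟨by linarith, by linarith⟩ (a + 1 / n + s)
        ⟨by linarith [hs.1], by linarith [hs.2]⟩ (by linarith [hs.1])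
        (Or.inl (by rw [add_sub_cancel_left, abs_of_pos hb]))
      rw [add_sub_cancel_left] at h4
      refine h4.trans ?_
      gcongr

/-- The kernel is `O(n)` on the diagonal in the bulk. -/
theorem exists_cdKernel_self_le (hg : 0 < g) (hδ : 0 < δ) (hR : |a| + δ < 2 * √g) :
    ∃ C, ∀ n : ℕ, 0 < n → ∀ x ∈ Set.Icc (a - δ) (a + δ), cdKernel (g / n) n x x ≤ C * n := by
  obtain ⟨M, q₀, -, -, hM⟩ := exists_bulk_bounds hg hδ hR
  have hs2 : √g ^ 2 = g := Real.sq_sqrt hg.le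
  have hs0 : 0 < √g := by positivity
  refine ⟨2 * (2 * g * M + 3 * M), fun n hn x hx => ?_⟩
  have hn' : (0 : ℝ) < n := Nat.cast_pos.2 hn
  obtain ⟨-, -, h1, h2, -⟩ := hM n hn x hx
  have hx2 : |x| ≤ 2 * √g := (abs_le_of_mem hx).trans hR.le
  rw [cdKernel_self (div_pos hg hn'), div_mul_eq_mul_div, mul_div_assoc, sqrt_div_sqrt_div hg]
  set p := hermiteFun (g / n) n x with hp
  set o := hermiteFun (g / n) (n - 1) x with ho
  have h3 : o ^ 2 ≤ 2 * g * M + 2 * M := by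
    rw [ho, hermiteFun_pred_eq hg, ← hp]
    set c := hermiteSlope g n x
    have h4 : (√g * c) ^ 2 ≤ g * M := by rw [mul_pow, hs2]; gcongr
    have h5 : (x / (2 * √g) * p) ^ 2 ≤ 1 * M := by
      rw [mul_pow]
      refine mul_le_mul ?_ h1 (sq_nonneg _) zero_le_one
      rw [← sq_abs, abs_div, abs_of_pos (by positivity : 0 < 2 * √g)]
      exact pow_le_one₀ (by positivity) ((div_le_one (by positivity)).2 hx2)
    nlinarith [sq_nonneg (√g * c - x / (2 * √g) * p)]
  have h6 : |x / √g * (p * o)| ≤ p ^ 2 + o ^ 2 := by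
    rw [abs_mul, abs_div, abs_of_pos hs0]
    have h7 : |x| / √g ≤ 2 := by rw [div_le_iff₀ hs0]; exact hx2
    have h8 : 2 * |p * o| ≤ p ^ 2 + o ^ 2 := by
      rw [abs_mul, ← sq_abs p, ← sq_abs o]
      nlinarith [sq_nonneg (|p| - |o|)]
    nlinarith [abs_nonneg (p * o)]
  have h9 := (abs_le.1 h6).1
  calc n * (o ^ 2 + p ^ 2) - x * (n / √g) * (p * o)
      = (o ^ 2 + p ^ 2 - x / √g * (p * o)) * n := by ring
    _ ≤ 2 * (2 * g * M + 3 * M) * n := by gcongr; linarith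

/-- A strip of width `1 / n` has bounded mass, as the integral of `K_n(x, y) ^ 2` over all `x` is
`K_n(y, y) = O(n)`. -/
theorem exists_pairMass_strip_le (hg : 0 < g) (hδ : 0 < δ) (hR : |a| + δ < 2 * √g) :
    ∃ C, ∀ᶠ n : ℕ in atTop, ∀ S : Set ℝ, S ⊆ Set.Icc a (a + 1 / n) →
      pairMass (g / n) n (A ×ˢ S) ≤ C := by
  obtain ⟨C, hC⟩ := exists_cdKernel_self_le hg hδ hR
  have hsmall : ∀ᶠ n : ℕ in atTop, 1 / (n : ℝ) < δ :=
    tendsto_one_div_atTop_nhds_zero_nat.eventually (gt_mem_nhds hδ)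
  refine ⟨C, ?_⟩
  filter_upwards [hsmall, eventually_gt_atTop 0] with n h1 hn S hS
  have hn' : (0 : ℝ) < n := Nat.cast_pos.2 hn
  have hb : 0 < 1 / (n : ℝ) := by positivity
  have hv : 0 < g / n := div_pos hg hn'
  refine (pairMass_mono hv (Set.prod_mono (Set.subset_univ A) hS)).trans ?_
  rw [pairMass_swap, pairMass_prod_univ hv, ← integral_finsetSum _ fun i _ =>
    (integrable_hermiteFun_mul hv i i).integrableOn]
  calc _ ≤ ∫ x in Set.Icc a (a + 1 / (n : ℝ)), C * n := by
        refine setIntegral_mono_on (integrable_finsetSum _ fun i _ =>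
          (integrable_hermiteFun_mul hv i i).integrableOn) (integrableOn_const (by simp))
          measurableSet_Icc fun x hx => ?_
        exact hC n hn x ⟨by linarith [hx.1], by linarith [hx.2]⟩
    _ = C := by
        rw [setIntegral_const, Measure.real, Real.volume_Icc, add_sub_cancel_left,
          ENNReal.toReal_ofReal hb.le, smul_eq_mul]
        field_simp

/-- Sets touching at one bulk point contribute `log n / (2 π ^ 2)`. -/
theorem tendsto_pairMass_touching (hg : 0 < g) (ha : |a| < 2 * √g) (hA : MeasurableSet A)
    (hB : MeasurableSet B) (hAa : A ⊆ Set.Iic a) (hBa : B ⊆ Set.Ici a) (hδ : 0 < δ)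
    (hAδ : Set.Ioo (a - δ) a ⊆ A) (hBδ : Set.Ioo a (a + δ) ⊆ B) :
    Tendsto (fun n : ℕ => pairMass (g / n) n (A ×ˢ B) / Real.log n) atTop
      (𝓝 (1 / (2 * Real.pi ^ 2))) := by
  have hs2 : √g ^ 2 = g := Real.sq_sqrt hg.le
  obtain ⟨η, hη, hηδ, hR⟩ : ∃ η, 0 < η ∧ η ≤ δ ∧ |a| + η < 2 * √g := by
    refine ⟨min δ ((2 * √g - |a|) / 2), lt_min hδ (by linarith), min_le_left _ _, ?_⟩
    linarith [min_le_right δ ((2 * √g - |a|) / 2)]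
  have hAη : Set.Ioo (a - η) a ⊆ A := fun x hx => hAδ ⟨by linarith [hx.1], hx.2⟩
  have hBη : Set.Ioo a (a + η) ⊆ B := fun x hx => hBδ ⟨hx.1, by linarith [hx.2]⟩
  have hd0 : ∀ᶠ n : ℕ in atTop, (n : ℤ) - n = 0 := Eventually.of_forall fun n => sub_self _
  have hd0' : ∀ᶠ n : ℕ in atTop, ((n - 1 : ℕ) : ℤ) - ((n - 1 : ℕ) : ℤ) = 0 :=
    Eventually.of_forall fun n => sub_self _
  have hd1 : ∀ᶠ n : ℕ in atTop, (n : ℤ) - ((n - 1 : ℕ) : ℤ) = 1 := by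
    filter_upwards [eventually_gt_atTop 0] with n hn
    omega
  have o1 := (oscillatesAround_hermiteFun_sq hg hη hR)
  have o2 := (oscillatesAround_hermiteFun_pred_sq hg hη hR)
  have o3 := (oscillatesAround_hermiteFun_mul_pred hg hη hR)
  simp only [pow_two] at o1 o2
  have c0 := continuousAt_arcsine hg ha
  have c1 : ContinuousAt (fun x => x / (2 * √g) * arcsine g x) a := by fun_prop
  have t1 := tendsto_touching_term hg hA hB hAa hη hAη hBη (integrable_arcsine hg) c0
    (limitFunctional_zero_eq hg) hd0 hd0' tendsto_self_div tendsto_self_div tendsto_sub_one_div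
    tendsto_sub_one_div o1 o2
  have t2 := tendsto_touching_term hg hA hB hAa hη hAη hBη (integrable_arcsine hg) c0
    (limitFunctional_zero_eq hg) hd0' hd0 tendsto_sub_one_div
    tendsto_sub_one_div tendsto_self_div tendsto_self_div o2 o1
  have t3 := tendsto_touching_term hg hA hB hAa hη hAη hBη (integrable_arcsine_one hg) c1
    (limitFunctional_one_eq hg) hd1 hd1 tendsto_self_div tendsto_sub_one_div tendsto_self_div
    tendsto_sub_one_div o3 o3
  have t := ((t1.add t2).sub (t3.const_mul 2)).const_mul g
  -- With `ρ ^ 2 = 1 / (π ^ 2 (4 g - a ^ 2))` the dependence on `a` cancels out.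
  have hval : g * (arcsine g a * arcsine g a + arcsine g a * arcsine g a -
      2 * (a / (2 * √g) * arcsine g a * (a / (2 * √g) * arcsine g a))) =
      1 / (2 * Real.pi ^ 2) := by
    have h1 : 0 < 4 * g - a ^ 2 := by
      have h2 : a ^ 2 < (2 * √g) ^ 2 := by rw [← sq_abs]; gcongr
      nlinarith
    have h2 : √(4 * g - a ^ 2) ^ 2 = 4 * g - a ^ 2 := Real.sq_sqrt h1.le
    have h3 : arcsine g a * arcsine g a = 1 / (Real.pi ^ 2 * (4 * g - a ^ 2)) := by
      rw [arcsine, ← mul_inv, ← pow_two, mul_pow, h2, one_div]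
    have h4 : a / (2 * √g) * arcsine g a * (a / (2 * √g) * arcsine g a) =
        a ^ 2 / (4 * √g ^ 2) * (arcsine g a * arcsine g a) := by ring
    have hpi := Real.pi_ne_zero
    have hne := h1.ne'
    rw [h4, h3, hs2]
    clear h1 h2 h3
    generalize hz : 4 * g - a ^ 2 = z at hne ⊢
    rw [show a ^ 2 = 4 * g - z by linarith]
    field_simp
    ring
  rw [hval] at t
  obtain ⟨C, hC⟩ := exists_pairMass_strip_le (A := A) hg hη hR
  have hlog : Tendsto (fun n : ℕ => Real.log n) atTop atTop :=
    Real.tendsto_log_atTop.comp tendsto_natCast_atTop_atTop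
  have hz : Tendsto (fun n : ℕ => pairMass (g / n) n (A ×ˢ (B ∩ Set.Iio (a + 1 / n))) /
      Real.log n) atTop (𝓝 0) := by
    refine squeeze_zero_norm' ?_ (hlog.const_div_atTop C)
    filter_upwards [hC, hlog.eventually_gt_atTop 0] with n h1 h2
    rw [norm_div, Real.norm_of_nonneg h2.le, Real.norm_of_nonneg (pairMass_nonneg _ _ _)]
    gcongr
    exact h1 _ fun x hx => ⟨hBa hx.1, le_of_lt hx.2⟩
  have hsum := t.add hz
  rw [add_zero] at hsum
  refine hsum.congr' ?_
  filter_upwards [eventually_gt_atTop 0] with n hn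
  have hn' : (0 : ℝ) < n := Nat.cast_pos.2 hn
  have hv : 0 < g / n := div_pos hg hn'
  have hlt : a < a + 1 / (n : ℝ) := by
    have : 0 < 1 / (n : ℝ) := by positivity
    linarith
  have hBm : MeasurableSet (B ∩ Set.Ici (a + 1 / (n : ℝ))) := hB.inter measurableSet_Ici
  have hsplit : A ×ˢ B = A ×ˢ (B ∩ Set.Ici (a + 1 / (n : ℝ))) ∪
      A ×ˢ (B ∩ Set.Iio (a + 1 / (n : ℝ))) := by
    rw [← Set.prod_union, ← Set.inter_union_distrib_left, Set.union_comm (Set.Ici _),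
      Set.Iio_union_Ici, Set.inter_univ]
  have hdisj : Disjoint (A ×ˢ (B ∩ Set.Ici (a + 1 / (n : ℝ))))
      (A ×ˢ (B ∩ Set.Iio (a + 1 / (n : ℝ)))) := by
    rw [Set.disjoint_left]
    intro p hp hp'
    exact (Set.mem_Iio.1 hp'.2.2).not_ge (Set.mem_Ici.1 hp.2.2)
  rw [hsplit, pairMass_union hv hdisj (hA.prod (hB.inter measurableSet_Iio)),
    pairMass_of_separated hg hn hA hBm hAa Set.inter_subset_right hlt]
  ring

end Touching

/-! ### Covariances for intervals -/

section Intervals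

variable {g a b : ℝ} {n : ℕ} {A B C : Set ℝ}

theorem pairMass_prod_union {v : ℝ} (hv : 0 < v) (hBC : Disjoint B C) (hA : MeasurableSet A)
    (hC : MeasurableSet C) :
    pairMass v n (A ×ˢ (B ∪ C)) = pairMass v n (A ×ˢ B) + pairMass v n (A ×ˢ C) := by
  rw [Set.prod_union, pairMass_union hv (Set.Disjoint.set_prod_right hBC _ _) (hA.prod hC)]

theorem pairMass_empty_prod (v : ℝ) (n : ℕ) : pairMass v n ((∅ : Set ℝ) ×ˢ B) = 0 := by
  simp [pairMass]

/-- The line is the union of an interval and two half-lines. -/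
theorem pairMass_prod_univ_of_Ioo {v : ℝ} (hv : 0 < v) (hab : a < b) (hA : MeasurableSet A) :
    pairMass v n (A ×ˢ Set.univ) = pairMass v n (A ×ˢ Set.Ioo a b) +
      (pairMass v n (A ×ˢ Set.Iic a) + pairMass v n (A ×ˢ Set.Ici b)) := by
  have h1 : (Set.univ : Set ℝ) = Set.Ioo a b ∪ (Set.Iic a ∪ Set.Ici b) := by
    ext x
    simp only [Set.mem_univ, Set.mem_union, Set.mem_Ioo, Set.mem_Iic, Set.mem_Ici, true_iff]
    rcases le_or_gt x a with h | h
    · exact Or.inr (Or.inl h)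
    · rcases lt_or_ge x b with h' | h'
      · exact Or.inl ⟨h, h'⟩
      · exact Or.inr (Or.inr h')
  have h2 : Disjoint (Set.Ioo a b) (Set.Iic a ∪ Set.Ici b) := by
    rw [Set.disjoint_left]
    rintro x hx (h | h)
    · exact absurd hx.1 (not_lt.2 h)
    · exact absurd hx.2 (not_lt.2 h)
  have h3 : Disjoint (Set.Iic a) (Set.Ici b) := by
    rw [Set.disjoint_left]
    intro x hx hx'
    exact absurd (hx'.trans hx) (not_le.2 hab)
  rw [h1, pairMass_prod_union hv h2 hA (measurableSet_Iic.union measurableSet_Ici),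
    pairMass_prod_union hv h3 hA measurableSet_Ici]

/-- The covariance of nested sets measures how much the kernel couples the smaller one to the
complement of the larger one. -/
theorem covariance_count_of_subset (hg : 0 < g) (hn : 0 < n) (hA : MeasurableSet A) (hab : a < b)
    (hAB : A ⊆ Set.Ioo a b) : cov[count n A, count n (Set.Ioo a b); law g n] =
      pairMass (g / n) n (A ×ˢ Set.Iic a) + pairMass (g / n) n (A ×ˢ Set.Ici b) := by
  have hv : 0 < g / n := div_pos hg (Nat.cast_pos.2 hn)
  rw [covariance_count hg hn hA measurableSet_Ioo, Set.inter_eq_left.2 hAB,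
    pairMass_prod_univ_of_Ioo hv hab hA]
  ring

/-- For disjoint sets the covariance is minus the mass of their product. -/
theorem covariance_count_of_disjoint (hg : 0 < g) (hn : 0 < n) (hA : MeasurableSet A)
    (hB : MeasurableSet B) (hAB : Disjoint A B) :
    cov[count n A, count n B; law g n] = -pairMass (g / n) n (A ×ˢ B) := by
  rw [covariance_count hg hn hA hB, hAB.inter_eq, pairMass_empty_prod, zero_sub]

/-- For overlapping intervals the coupling of the intersection with itself and with the two
remaining pieces cancels out, except for the coupling between these two pieces. -/
theorem covariance_count_of_overlap {a₁ b₁ a₂ b₂ : ℝ} (hg : 0 < g) (hn : 0 < n) (h1 : a₁ < a₂)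
    (h2 : a₂ < b₁) (h3 : b₁ < b₂) :
    cov[count n (Set.Ioo a₁ b₁), count n (Set.Ioo a₂ b₂); law g n] =
      pairMass (g / n) n (Set.Ioo a₂ b₁ ×ˢ Set.Iic a₁) +
      pairMass (g / n) n (Set.Ioo a₂ b₁ ×ˢ Set.Ici b₂) -
      pairMass (g / n) n (Set.Ioc a₁ a₂ ×ˢ Set.Ico b₁ b₂) := by
  have hv : 0 < g / n := div_pos hg (Nat.cast_pos.2 hn)
  have d1 : Disjoint (Set.Ioc a₁ a₂) (Set.Ioo a₂ b₁) := by
    rw [Set.disjoint_left]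
    intro x hx hx'
    exact absurd hx'.1 (not_lt.2 hx.2)
  have d2 : Disjoint (Set.Ioo a₂ b₁) (Set.Ico b₁ b₂) := by
    rw [Set.disjoint_left]
    intro x hx hx'
    exact absurd hx.2 (not_lt.2 hx'.1)
  have d3 : Disjoint (Set.Ioc a₁ a₂) (Set.Ioo a₂ b₁ ∪ Set.Ico b₁ b₂) := by
    rw [Set.disjoint_left]
    rintro x hx (hx' | hx')
    · exact absurd hx'.1 (not_lt.2 hx.2)
    · exact absurd (h2.trans_le hx'.1) (not_lt.2 hx.2)
  have u1 : Set.Ioo a₁ b₁ = Set.Ioc a₁ a₂ ∪ Set.Ioo a₂ b₁ :=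
    (Set.Ioc_union_Ioo_eq_Ioo h1.le h2).symm
  have u2 : Set.Ioo a₂ b₂ = Set.Ioo a₂ b₁ ∪ Set.Ico b₁ b₂ :=
    (Set.Ioo_union_Ico_eq_Ioo h2 h3.le).symm
  have u3 : Set.Ioo a₁ b₂ = Set.Ioc a₁ a₂ ∪ (Set.Ioo a₂ b₁ ∪ Set.Ico b₁ b₂) := by
    rw [← u2, Set.Ioc_union_Ioo_eq_Ioo h1.le (h2.trans h3)]
  have hI : Set.Ioo a₁ b₁ ∩ Set.Ioo a₂ b₂ = Set.Ioo a₂ b₁ := by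
    rw [Set.Ioo_inter_Ioo, sup_eq_right.2 h1.le, inf_eq_left.2 h3.le]
  rw [covariance_count hg hn measurableSet_Ioo measurableSet_Ioo, hI,
    pairMass_prod_univ_of_Ioo hv (h1.trans (h2.trans h3)) measurableSet_Ioo, u3,
    pairMass_prod_union hv d3 measurableSet_Ioo (measurableSet_Ioo.union measurableSet_Ico),
    ← u2, u1, pairMass_swap _ _ (Set.Ioc a₁ a₂ ∪ Set.Ioo a₂ b₁) (Set.Ioo a₂ b₂),
    pairMass_prod_union hv d1 measurableSet_Ioo measurableSet_Ioo,
    pairMass_swap _ _ (Set.Ioo a₂ b₂) (Set.Ioc a₁ a₂),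
    pairMass_swap _ _ (Set.Ioo a₂ b₂) (Set.Ioo a₂ b₁)]
  rw [u2, pairMass_prod_union hv d2 measurableSet_Ioc measurableSet_Ico,
    pairMass_swap _ _ (Set.Ioo a₂ b₁) (Set.Ioc a₁ a₂)]
  ring

theorem covKernel_comm (g s t : ℝ) : covKernel g s t = covKernel g t s := by
  rw [covKernel, covKernel, mul_comm s t, ← neg_sub t s, neg_sq]
  ring

/-- The limiting kernel vanishes off the limiting support: the square root of a negative number is
`0`, and so is the quotient by it. -/
theorem covKernel_eq_zero (hg : 0 < g) (s : ℝ) {t : ℝ} (ht : t ∉ spectralSupport g) :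
    covKernel g s t = 0 := by
  have h1 : √g ^ 2 = g := Real.sq_sqrt hg.le
  have : 4 * g - t ^ 2 ≤ 0 := by
    rw [spectralSupport, Set.mem_Icc, not_and_or, not_le, not_le] at ht
    have h0 := Real.sqrt_nonneg g
    rcases ht with ht | ht <;> nlinarith
  rw [covKernel, Real.sqrt_eq_zero'.2 this, mul_zero, div_zero]

theorem integrableOn_covKernel_swap (h : IntegrableOn (fun p : ℝ × ℝ => covKernel g p.1 p.2)
    (A ×ˢ B)) : IntegrableOn (fun p : ℝ × ℝ => covKernel g p.1 p.2) (B ×ˢ A) ∧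
    ∫ p in A ×ˢ B, covKernel g p.1 p.2 = ∫ p in B ×ˢ A, covKernel g p.1 p.2 := by
  constructor
  · have := IntegrableOn.swap (μ := volume) (ν := volume) h
    refine this.congr (ae_of_all _ fun p => ?_)
    exact covKernel_comm _ _ _
  · rw [Measure.volume_eq_prod, ← setIntegral_prod_swap]
    refine integral_congr_ae (ae_of_all _ fun p => ?_)
    exact covKernel_comm _ _ _

/-- The coupling of a set with the complement of an interval that contains it strictly. -/
theorem tendsto_pairMass_compl {a₁ b₁ a₂ b₂ : ℝ} (hg : 0 < g) (h1 : a₂ < a₁) (h2 : a₁ < b₁)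
    (h3 : b₁ < b₂) :
    IntegrableOn (fun p : ℝ × ℝ => covKernel g p.1 p.2)
      (Set.Ioo a₁ b₁ ×ˢ (spectralSupport g \ Set.Ioo a₂ b₂)) ∧
    Tendsto (fun n : ℕ => pairMass (g / n) n (Set.Ioo a₁ b₁ ×ˢ Set.Iic a₂) +
      pairMass (g / n) n (Set.Ioo a₁ b₁ ×ˢ Set.Ici b₂)) atTop
      (𝓝 (1 / (2 * Real.pi ^ 2) *
        ∫ s in Set.Ioo a₁ b₁, ∫ t in spectralSupport g \ Set.Ioo a₂ b₂, covKernel g s t)) := by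
  have hf : ∀ {a b : ℝ}, a < b → (frontier (Set.Ioo a b)).Finite := fun h => by
    rw [frontier_Ioo h]; exact Set.toFinite _
  have hIoo : MeasurableSet (Set.Ioo a₁ b₁) := measurableSet_Ioo
  have hcup : (Set.Ioo a₂ b₂)ᶜ = Set.Iic a₂ ∪ Set.Ici b₂ := by
    ext x; simp [Set.mem_Ioo, or_iff_not_imp_left]
  have t1 := tendsto_pairMass_separated hg (measurableSet_Iic (a := a₂)) hIoo
    (by rw [frontier_Iic]; exact Set.toFinite _) (hf h2) le_rfl
    (fun x hx => hx.1.le) h1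
  have t2 := tendsto_pairMass_separated hg hIoo (measurableSet_Ici (a := b₂)) (hf h2)
    (by rw [frontier_Ici]; exact Set.toFinite _) (fun x hx => hx.2.le) le_rfl h3
  have i1 := (integrableOn_covKernel hg (measurableSet_Iic (a := a₂)) hIoo le_rfl
    (fun x hx => hx.1.le) h1).1
  have i2 := (integrableOn_covKernel hg hIoo (measurableSet_Ici (a := b₂))
    (fun x hx => hx.2.le) le_rfl h3).1
  obtain ⟨i1', e1⟩ := integrableOn_covKernel_swap i1
  have hsub : Set.Ioo a₁ b₁ ×ˢ (spectralSupport g \ Set.Ioo a₂ b₂) ⊆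
      Set.Ioo a₁ b₁ ×ˢ Set.Iic a₂ ∪ Set.Ioo a₁ b₁ ×ˢ Set.Ici b₂ := by
    rw [← Set.prod_union, ← hcup]
    exact Set.prod_mono le_rfl fun x hx => hx.2
  have i3 := (i1'.union i2).mono_set hsub
  refine ⟨i3, ?_⟩
  have hdisj : Disjoint (Set.Ioo a₁ b₁ ×ˢ Set.Iic a₂) (Set.Ioo a₁ b₁ ×ˢ Set.Ici b₂) := by
    refine Set.Disjoint.set_prod_right ?_ _ _
    rw [Set.disjoint_left]
    intro x hx hx'
    exact absurd ((h1.trans h2).trans h3) (not_lt.2 (hx'.trans hx))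
  have e2 : ∫ s in Set.Ioo a₁ b₁, ∫ t in spectralSupport g \ Set.Ioo a₂ b₂, covKernel g s t =
      (∫ p in Set.Iic a₂ ×ˢ Set.Ioo a₁ b₁, covKernel g p.1 p.2) +
      ∫ p in Set.Ioo a₁ b₁ ×ˢ Set.Ici b₂, covKernel g p.1 p.2 := by
    rw [e1, ← setIntegral_union hdisj (hIoo.prod measurableSet_Ici) i1' i2]
    refine (setIntegral_prod (μ := volume) (ν := volume) _ i3).symm.trans ?_
    rw [← Measure.volume_eq_prod]
    -- The half-lines may be cut down to the limiting support, where alone the kernel is nonzero.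
    refine (setIntegral_eq_of_subset_of_forall_sdiff_eq_zero
      ((hIoo.prod measurableSet_Iic).union (hIoo.prod measurableSet_Ici)) hsub
      fun p hp => ?_).symm
    refine covKernel_eq_zero hg _ fun hp2 => hp.2 ?_
    rw [← Set.prod_union, ← hcup] at hp
    exact ⟨hp.1.1, hp2, hp.1.2⟩
  rw [e2, mul_add]
  refine (t1.add t2).congr fun n => ?_
  rw [pairMass_swap]

/-- Asymptotic equivalence to a multiple of the logarithm, as convergence of a quotient. -/
theorem isEquivalent_log {u : ℕ → ℝ} {c : ℝ} (hc : c ≠ 0)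
    (h : Tendsto (fun n : ℕ => u n / Real.log n) atTop (𝓝 c)) :
    u ~[atTop] fun n : ℕ => c * Real.log n := by
  have hlog : Tendsto (fun n : ℕ => Real.log n) atTop atTop :=
    Real.tendsto_log_atTop.comp tendsto_natCast_atTop_atTop
  refine (isEquivalent_iff_tendsto_one ?_).2 ?_
  · filter_upwards [hlog.eventually_gt_atTop 0] with n hn
    positivity
  · have := h.div_const c
    rw [div_self hc] at this
    refine this.congr fun n => ?_
    simp only [Pi.div_apply]
    rw [div_div, mul_comm c]

theorem tendsto_zero_div_log {u : ℕ → ℝ} {c : ℝ} (h : Tendsto u atTop (𝓝 c)) :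
    Tendsto (fun n : ℕ => u n / Real.log n) atTop (𝓝 0) :=
  h.div_atTop (Real.tendsto_log_atTop.comp tendsto_natCast_atTop_atTop)

/-- An interval touching a half-line from the right. -/
theorem tendsto_pairMass_Ioo_Iic {a b : ℝ} (hg : 0 < g) (ha : |a| < 2 * √g) (hab : a < b) :
    Tendsto (fun n : ℕ => pairMass (g / n) n (Set.Ioo a b ×ˢ Set.Iic a) / Real.log n) atTop
      (𝓝 (1 / (2 * Real.pi ^ 2))) := by
  refine (tendsto_pairMass_touching hg ha (measurableSet_Iic (a := a)) measurableSet_Ioo le_rfl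
    (fun x hx => hx.1.le) (sub_pos.2 hab) (fun x hx => hx.2.le) (B := Set.Ioo a b)
    (by rw [add_sub_cancel])).congr fun n => ?_
  rw [pairMass_swap]

end Intervals

end GUE

theorem mainTheorem7 (g : ℝ) (hg : 0 < g) :
    -- variance for one interval in the bulk
    (∀ a b : ℝ, -(2 * √g) < a → a < b → b < 2 * √g →
      (fun n : ℕ => Var[GUE.count n (Set.Ioo a b); GUE.law g n])
        ~[atTop] fun n : ℕ => 1 / Real.pi ^ 2 * Real.log n) ∧
    -- (i) disjoint intervals
    (∀ a₁ b₁ a₂ b₂ : ℝ, -(2 * √g) ≤ a₁ → a₁ < b₁ → b₁ < a₂ → a₂ < b₂ → b₂ ≤ 2 * √g →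
      IntegrableOn (fun p : ℝ × ℝ => GUE.covKernel g p.1 p.2)
        (Set.Ioo a₁ b₁ ×ˢ Set.Ioo a₂ b₂) ∧
      Tendsto (fun n : ℕ =>
          cov[GUE.count n (Set.Ioo a₁ b₁), GUE.count n (Set.Ioo a₂ b₂); GUE.law g n]) atTop
        (𝓝 (-(1 / (2 * Real.pi ^ 2)) *
          ∫ s in Set.Ioo a₁ b₁, ∫ t in Set.Ioo a₂ b₂, GUE.covKernel g s t))) ∧
    -- (ii) intervals touching from outside
    (∀ a₁ b₁ b₂ : ℝ, -(2 * √g) ≤ a₁ → a₁ < b₁ → b₁ < b₂ → b₂ ≤ 2 * √g →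
      (fun n : ℕ => cov[GUE.count n (Set.Ioo a₁ b₁), GUE.count n (Set.Ioo b₁ b₂); GUE.law g n])
        ~[atTop] fun n : ℕ => -(1 / (2 * Real.pi ^ 2)) * Real.log n) ∧
    -- (iii) intervals touching from inside: a common left endpoint
    (∀ a b₁ b₂ : ℝ, -(2 * √g) < a → a < b₁ → b₁ < b₂ → b₂ ≤ 2 * √g →
      (fun n : ℕ => cov[GUE.count n (Set.Ioo a b₁), GUE.count n (Set.Ioo a b₂); GUE.law g n])
        ~[atTop] fun n : ℕ => 1 / (2 * Real.pi ^ 2) * Real.log n) ∧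
    -- (iv) embedded intervals
    (∀ a₁ b₁ a₂ b₂ : ℝ, -(2 * √g) ≤ a₂ → a₂ < a₁ → a₁ < b₁ → b₁ < b₂ → b₂ ≤ 2 * √g →
      IntegrableOn (fun p : ℝ × ℝ => GUE.covKernel g p.1 p.2)
        (Set.Ioo a₁ b₁ ×ˢ (GUE.spectralSupport g \ Set.Ioo a₂ b₂)) ∧
      Tendsto (fun n : ℕ =>
          cov[GUE.count n (Set.Ioo a₁ b₁), GUE.count n (Set.Ioo a₂ b₂); GUE.law g n]) atTop
        (𝓝 (1 / (2 * Real.pi ^ 2) *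
          ∫ s in Set.Ioo a₁ b₁, ∫ t in GUE.spectralSupport g \ Set.Ioo a₂ b₂,
            GUE.covKernel g s t))) ∧
    -- (v) intersecting intervals
    (∀ a₁ b₁ a₂ b₂ : ℝ, -(2 * √g) ≤ a₁ → a₁ < a₂ → a₂ < b₁ → b₁ < b₂ → b₂ ≤ 2 * √g →
      IntegrableOn (fun p : ℝ × ℝ => GUE.covKernel g p.1 p.2)
        (Set.Ioo a₂ b₁ ×ˢ (GUE.spectralSupport g \ Set.Ioo a₁ b₂)) ∧
      IntegrableOn (fun p : ℝ × ℝ => GUE.covKernel g p.1 p.2)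
        (Set.Ioo a₁ a₂ ×ˢ Set.Ioo b₁ b₂) ∧
      Tendsto (fun n : ℕ =>
          cov[GUE.count n (Set.Ioo a₁ b₁), GUE.count n (Set.Ioo a₂ b₂); GUE.law g n]) atTop
        (𝓝 (1 / (2 * Real.pi ^ 2) *
          ((∫ s in Set.Ioo a₂ b₁, ∫ t in GUE.spectralSupport g \ Set.Ioo a₁ b₂,
              GUE.covKernel g s t) -
            ∫ s in Set.Ioo a₁ a₂, ∫ t in Set.Ioo b₁ b₂, GUE.covKernel g s t)))) := by
  have hpi := Real.pi_pos
  have hf : ∀ {a b : ℝ}, a < b → (frontier (Set.Ioo a b)).Finite := fun h => by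
    rw [frontier_Ioo h]; exact Set.toFinite _
  refine ⟨?_, ?_, ?_, ?_, ?_, ?_⟩
  · intro a b ha hab hb
    have ha' : |a| < 2 * √g := abs_lt.2 ⟨ha, hab.trans hb⟩
    have hb' : |b| < 2 * √g := abs_lt.2 ⟨ha.trans hab, hb⟩
    refine GUE.isEquivalent_log (by positivity) ?_
    -- each of the two endpoints contributes `log n / (2 π ^ 2)`
    have t1 := GUE.tendsto_pairMass_Ioo_Iic hg ha' hab
    have t2 := GUE.tendsto_pairMass_touching hg hb' (A := Set.Ioo a b) measurableSet_Ioo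
      (measurableSet_Ici (a := b)) (fun x hx => hx.2.le) le_rfl (sub_pos.2 hab)
      (by rw [sub_sub_cancel]) (fun x hx => hx.1.le)
    have t := t1.add t2
    have hval : 1 / (2 * Real.pi ^ 2) + 1 / (2 * Real.pi ^ 2) = 1 / Real.pi ^ 2 := by
      field_simp; norm_num
    rw [hval] at t
    refine t.congr' ?_
    filter_upwards [eventually_gt_atTop 0] with n hn
    rw [← covariance_self (GUE.measurable_count measurableSet_Ioo).aemeasurable,
      GUE.covariance_count_of_subset hg hn measurableSet_Ioo hab le_rfl, add_div]
  · intro a₁ b₁ a₂ b₂ _ h1 h2 h3 _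
    have i1 := (GUE.integrableOn_covKernel hg (A := Set.Ioo a₁ b₁) (B := Set.Ioo a₂ b₂)
      measurableSet_Ioo measurableSet_Ioo (fun x hx => hx.2.le) (fun x hx => hx.1.le) h2).1
    refine ⟨i1, ?_⟩
    have t := GUE.tendsto_pairMass_separated hg (A := Set.Ioo a₁ b₁) (B := Set.Ioo a₂ b₂)
      measurableSet_Ioo measurableSet_Ioo (hf h1) (hf h3) (fun x hx => hx.2.le)
      (fun x hx => hx.1.le) h2
    have e := setIntegral_prod (μ := volume) (ν := volume) _ i1
    rw [← Measure.volume_eq_prod] at e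
    rw [e] at t
    rw [neg_mul]
    refine t.neg.congr' ?_
    filter_upwards [eventually_gt_atTop 0] with n hn
    rw [GUE.covariance_count_of_disjoint hg hn measurableSet_Ioo measurableSet_Ioo]
    rw [Set.disjoint_left]
    intro x hx hx'
    linarith [hx.2, hx'.1]
  · intro a₁ b₁ b₂ h0 h1 h2 h3
    have hb : |b₁| < 2 * √g := abs_lt.2 ⟨by linarith, by linarith⟩
    refine GUE.isEquivalent_log (by simp [hpi.ne']) ?_
    have t := GUE.tendsto_pairMass_touching hg hb (A := Set.Ioo a₁ b₁) (B := Set.Ioo b₁ b₂)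
      measurableSet_Ioo measurableSet_Ioo (fun x hx => hx.2.le) (fun x hx => hx.1.le)
      (δ := min (b₁ - a₁) (b₂ - b₁)) (lt_min (by linarith) (by linarith))
      (fun x hx => ⟨by linarith [hx.1, min_le_left (b₁ - a₁) (b₂ - b₁)], hx.2⟩)
      (fun x hx => ⟨hx.1, by linarith [hx.2, min_le_right (b₁ - a₁) (b₂ - b₁)]⟩)
    refine t.neg.congr' ?_
    filter_upwards [eventually_gt_atTop 0] with n hn
    rw [GUE.covariance_count_of_disjoint hg hn measurableSet_Ioo measurableSet_Ioo, neg_div]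
    rw [Set.disjoint_left]
    intro x hx hx'
    linarith [hx.2, hx'.1]
  · intro a b₁ b₂ h0 h1 h2 h3
    have ha : |a| < 2 * √g := abs_lt.2 ⟨h0, by linarith⟩
    refine GUE.isEquivalent_log (by positivity) ?_
    -- only the common left endpoint contributes a logarithm; on the right the sets are separated
    have t1 := GUE.tendsto_pairMass_Ioo_Iic hg ha h1
    have t2 := GUE.tendsto_zero_div_log (GUE.tendsto_pairMass_separated hg (A := Set.Ioo a b₁)
      (B := Set.Ici b₂) measurableSet_Ioo measurableSet_Ici (hf h1)
      (by rw [frontier_Ici]; exact Set.toFinite _) (fun x hx => hx.2.le) le_rfl h2)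
    have t := t1.add t2
    rw [add_zero] at t
    refine t.congr' ?_
    filter_upwards [eventually_gt_atTop 0] with n hn
    rw [GUE.covariance_count_of_subset hg hn measurableSet_Ioo (h1.trans h2)
      (Set.Ioo_subset_Ioo le_rfl h2.le), add_div]
  · intro a₁ b₁ a₂ b₂ _ h1 h2 h3 _
    obtain ⟨i, t⟩ := GUE.tendsto_pairMass_compl hg h1 h2 h3
    refine ⟨i, t.congr' ?_⟩
    filter_upwards [eventually_gt_atTop 0] with n hn
    rw [GUE.covariance_count_of_subset hg hn measurableSet_Ioo (h1.trans (h2.trans h3))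
      (Set.Ioo_subset_Ioo h1.le h3.le)]
  · intro a₁ b₁ a₂ b₂ _ h1 h2 h3 _
    obtain ⟨i, t⟩ := GUE.tendsto_pairMass_compl hg h1 h2 h3
    have i1 := (GUE.integrableOn_covKernel hg (A := Set.Ioo a₁ a₂) (B := Set.Ioo b₁ b₂)
      measurableSet_Ioo measurableSet_Ioo (fun x hx => hx.2.le) (fun x hx => hx.1.le) h2).1
    refine ⟨i, i1, ?_⟩
    -- the outer pieces appear half-open, which does not affect the integrals
    have i2 := (GUE.integrableOn_covKernel hg (A := Set.Ioc a₁ a₂) (B := Set.Ico b₁ b₂)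
      measurableSet_Ioc measurableSet_Ico (fun x hx => hx.2) (fun x hx => hx.1) h2).1
    have t2 := GUE.tendsto_pairMass_separated hg (A := Set.Ioc a₁ a₂) (B := Set.Ico b₁ b₂)
      measurableSet_Ioc measurableSet_Ico (by rw [frontier_Ioc h1]; exact Set.toFinite _)
      (by rw [frontier_Ico h3]; exact Set.toFinite _) (fun x hx => hx.2) (fun x hx => hx.1) h2
    have e := setIntegral_prod (μ := volume) (ν := volume) _ i2
    rw [← Measure.volume_eq_prod] at e
    simp only [integral_Ico_eq_integral_Ioo, integral_Ioc_eq_integral_Ioo] at e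
    rw [e] at t2
    rw [mul_sub]
    refine (t.sub t2).congr' ?_
    filter_upwards [eventually_gt_atTop 0] with n hn
    rw [GUE.covariance_count_of_overlap hg hn h1 h2 h3]
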